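/- Let $S$ be a set of $n \ge 1$ points in the plane in convex position, numbered clockwise from $1$ to $n$. A non-crossing path partition of $S$ is a graph with vertex set $S$, drawn with straight-line edges, in which two distinct edges meet at most in a common endpoint and every connected component is a path; an isolated vertex counts as a path of length $0$, whose two endpoints coincide. It is called ordered if, whenever $i<j$ are the numbers of the two endpoints of one of its paths, no point with number strictly between $i$ and $j$ is an endpoint of a path. Let $N(S)$ be the number of ordered non-crossing path partitions of $S$. Then $N(S)=\mathcal{O}^*(4.642126305^n)$: there are constants $C$ and $d$, independent of $n$ and $S$, such that $$N(S)\le C\,n^{d}\,4.642126305^{\,n}.$$ Moreover, up to polynomial factors the exact exponential growth is $\rho^n$ for a constant $\rho$ with $4.6421263038<\rho<4.6421263039$: there are constants $C>0$ and $d$, independent of $n$ and $S$, such that $$\frac{\rho^{n}}{C\,n^{d}}\;\le\; N(S)\;\le\; C\,n^{d}\,\rho^{n}.$$ -/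

import Mathlib

/-- The Euclidean plane. -/
abbrev Plane : Type := EuclideanSpace ℝ (Fin 2)

/-- The points `p 0, …, p (n-1)` are in convex position (none of them lies in the convex hull
of the others; in particular they are distinct) and are numbered clockwise: every triple
`p i, p j, p k` with `i < j < k` makes a right turn. -/
def IsClockwiseConvex {n : ℕ} (p : Fin n → Plane) : Prop :=
  ConvexIndependent ℝ p ∧
    ∀ i j k : Fin n, i < j → j < k →
      (p j 0 - p i 0) * (p k 1 - p i 1) - (p j 1 - p i 1) * (p k 0 - p i 0) < 0

/-- The straight-line drawing of `G` on the points `p` is non-crossing: two distinct edges,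
drawn as segments, have no point in common except possibly a common endpoint. -/
def NonCrossing {n : ℕ} (p : Fin n → Plane) (G : SimpleGraph (Fin n)) : Prop :=
  ∀ a b c d : Fin n, G.Adj a b → G.Adj c d → s(a, b) ≠ s(c, d) →
    segment ℝ (p a) (p b) ∩ segment ℝ (p c) (p d) ⊆ {p a, p b} ∩ {p c, p d}

/-- The walk `w` is a path that constitutes a whole connected component of `G`: it repeats no
vertex, and it contains every vertex and every edge of the component of `u`. A path of
length `0` is allowed; it is an isolated vertex of `G`. -/
def IsComponentPath {V : Type*} {G : SimpleGraph V} {u v : V} (w : G.Walk u v) : Prop :=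
  w.IsPath ∧ (∀ x, G.Reachable u x → x ∈ w.support) ∧
    ∀ x y, x ∈ w.support → G.Adj x y → s(x, y) ∈ w.edges

/-- `i` and `j` are the two endpoints of a component of `G` that is a path
(`i = j` for an isolated vertex). -/
def ArePathEnds {V : Type*} (G : SimpleGraph V) (i j : V) : Prop :=
  ∃ w : G.Walk i j, IsComponentPath w

/-- A non-crossing path partition of the points `p`: a non-crossing graph each of whose
components is a path. -/
def IsNCPPartition {n : ℕ} (p : Fin n → Plane) (G : SimpleGraph (Fin n)) : Prop :=
  NonCrossing p G ∧
    ∀ x, ∃ (u v : Fin n) (w : G.Walk u v), IsComponentPath w ∧ x ∈ w.support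

/-- An ordered non-crossing path partition: if `i < j` are the endpoints of a path, then no
number strictly between `i` and `j` is an endpoint of a path. -/
def IsOrderedNCPPartition {n : ℕ} (p : Fin n → Plane) (G : SimpleGraph (Fin n)) : Prop :=
  IsNCPPartition p G ∧
    ∀ i j : Fin n, i < j → ArePathEnds G i j →
      ∀ k : Fin n, i < k → k < j → ¬ ∃ l : Fin n, ArePathEnds G k l

/-- The number of ordered non-crossing path partitions of the points `p`. -/
noncomputable def numOrderedNCP {n : ℕ} (p : Fin n → Plane) : ℕ :=
  {G : SimpleGraph (Fin n) | IsOrderedNCPPartition p G}.ncard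

/-! For points in convex position two edges cross exactly when their endpoints alternate in the
numbering (`nonCrossing_iff`), so $N(S)$ depends on $n$ alone. Write each component path as the list
of its vertices, from its smaller to its larger endpoint. Vertex sets of disjoint uncrossed paths do
not alternate (`no_alternation`); hence being ordered amounts to every list visiting all points
between its first and last entry (`Good`).

Such families decompose recursively. Behind the largest point of the list through the first point an
ordered system splits off an irreducible block. In an irreducible block, the list through both
extremes either starts at the left end, or is cut behind the left end into two tipped lists, one of
them mirrored. A tipped list loses its first entry: non-crossing forces the next entry to be extreme
again, and removal of a right end also frees an independent ordered system. With $F,\tau,q,\kappa$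
the generating functions of ordered, tipped, right-tipped and irreducible systems this gives
$q=z\tau F$, $\tau=1+z\tau+q$, $\kappa=1+z\tau+zq\tau$, $F=1+z\kappa F$.

Upper bound: a nonnegative solution of these equations at one $z>0$ dominates all partial sums
(`sum_counts_le`), so the $n$-th count is at most $F z^{-n}$.

Lower bound: elimination gives $q=t\,\Psi(q)$ with $t=z/(1-z)^2$ and $\Psi(Y)=(1+Y)(1+zY(1+Y))$.
Lagrange inversion (`pow_dvd_pow_sub_sum_lagrangeCoeff`) writes the coefficients of $q$ as sums of
nonnegative products of three binomial coefficients, and a single summand suffices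
(`choose_mul_choose_mul_choose_le`). A binomial probability near its mean is at least the inverse of
a polynomial (`one_le_mul_binomialTerm`), which estimates that summand.

Both bounds are applied at the singular point, where in addition $q\Psi'(q)=\Psi(q)$. In terms of
$s=z\tau$ it is given by $q=(1-s^2)/(2s^2)$ and $z=2s^3/(1+s^2+2s^3)$, with $s$ a root of a
polynomial of degree six; then $\rho=1/z$ (`exists_growth_bounds`, `exists_root`). -/

namespace PathSystem

/-! ### Paths as lists and their steps -/

/-- `x` and `y` are consecutive entries of the list, in one order or the other. -/
def Linked {α : Type*} : List α → α → α → Prop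
  | a :: b :: l, x, y => (x = a ∧ y = b) ∨ (x = b ∧ y = a) ∨ Linked (b :: l) x y
  | _, _, _ => False

section Linked

variable {α β : Type*}

@[simp] theorem linked_nil (x y : α) : ¬ Linked [] x y := by simp [Linked]

@[simp] theorem linked_singleton (a x y : α) : ¬ Linked [a] x y := by simp [Linked]

@[simp] theorem linked_cons_cons (a b : α) (l : List α) (x y : α) :
    Linked (a :: b :: l) x y ↔ (x = a ∧ y = b) ∨ (x = b ∧ y = a) ∨ Linked (b :: l) x y := by
  simp [Linked]

theorem Linked.symm {l : List α} {x y : α} (h : Linked l x y) : Linked l y x := by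
  induction l with
  | nil => simp at h
  | cons a l ih =>
    cases l with
    | nil => simp at h
    | cons b l =>
      simp only [linked_cons_cons] at h ⊢
      rcases h with h | h | h
      · exact Or.inr (Or.inl ⟨h.2, h.1⟩)
      · exact Or.inl ⟨h.2, h.1⟩
      · exact Or.inr (Or.inr (ih h))

theorem Linked.mem_left {l : List α} {x y : α} (h : Linked l x y) : x ∈ l := by
  induction l with
  | nil => simp at h
  | cons a l ih =>
    cases l with
    | nil => simp at h
    | cons b l =>
      simp only [linked_cons_cons] at h
      rcases h with h | h | h
      · simp [h.1]
      · simp [h.1]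
      · exact List.mem_cons_of_mem _ (ih h)

theorem Linked.mem_right {l : List α} {x y : α} (h : Linked l x y) : y ∈ l := h.symm.mem_left

theorem linked_append {l₁ l₂ : List α} {x y : α} :
    Linked (l₁ ++ l₂) x y ↔ Linked l₁ x y ∨ Linked l₂ x y ∨
      (x ∈ l₁.getLast? ∧ y ∈ l₂.head?) ∨ (y ∈ l₁.getLast? ∧ x ∈ l₂.head?) := by
  induction l₁ with
  | nil => simp
  | cons a l ih =>
    cases l with
    | nil =>
      cases l₂ with
      | nil => simp
      | cons b l₂ =>
        simp only [List.cons_append, List.nil_append, linked_cons_cons, linked_singleton,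
          false_or, List.getLast?_singleton, Option.mem_def, Option.some.injEq, List.head?_cons]
        constructor
        · rintro (h | h | h)
          · exact Or.inr (Or.inl ⟨h.1.symm, h.2.symm⟩)
          · exact Or.inr (Or.inr ⟨h.2.symm, h.1.symm⟩)
          · exact Or.inl h
        · rintro (h | h | h)
          · exact Or.inr (Or.inr h)
          · exact Or.inl ⟨h.1.symm, h.2.symm⟩
          · exact Or.inr (Or.inl ⟨h.2.symm, h.1.symm⟩)
    | cons b l =>
      simp only [List.cons_append, linked_cons_cons, List.getLast?_cons_cons] at ih ⊢
      rw [ih]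
      tauto

theorem linked_reverse {l : List α} {x y : α} : Linked l.reverse x y ↔ Linked l x y := by
  induction l with
  | nil => simp
  | cons a l ih =>
    cases l with
    | nil => simp
    | cons b l =>
      rw [List.reverse_cons, linked_append, ih]
      simp only [linked_singleton, List.getLast?_reverse, List.head?_cons, Option.mem_def,
        Option.some.injEq, linked_cons_cons]
      constructor
      · rintro (h | h | h | h)
        · exact Or.inr (Or.inr h)
        · exact h.elim
        · exact Or.inr (Or.inl ⟨h.1.symm, h.2.symm⟩)
        · exact Or.inl ⟨h.2.symm, h.1.symm⟩
      · rintro (h | h | h)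
        · exact Or.inr (Or.inr (Or.inr ⟨h.2.symm, h.1.symm⟩))
        · exact Or.inr (Or.inr (Or.inl ⟨h.1.symm, h.2.symm⟩))
        · exact Or.inl h

theorem linked_map {f : α → β} (hf : Function.Injective f) {l : List α} {x y : α} :
    Linked (l.map f) (f x) (f y) ↔ Linked l x y := by
  induction l with
  | nil => simp
  | cons a l ih =>
    cases l with
    | nil => simp
    | cons b l =>
      simp only [List.map_cons, linked_cons_cons] at ih ⊢
      rw [ih, hf.eq_iff, hf.eq_iff, hf.eq_iff, hf.eq_iff]

theorem Linked.exists_of_map {f : α → β} {l : List α} {x y : β} (h : Linked (l.map f) x y) :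
    ∃ x' y', x = f x' ∧ y = f y' ∧ Linked l x' y' := by
  induction l with
  | nil => simp at h
  | cons a l ih =>
    cases l with
    | nil => simp at h
    | cons b l =>
      simp only [List.map_cons, linked_cons_cons] at ih h
      rcases h with h | h | h
      · exact ⟨a, b, h.1, h.2, by simp⟩
      · exact ⟨b, a, h.1, h.2, by simp⟩
      · obtain ⟨x', y', hx, hy, hl⟩ := ih h
        exact ⟨x', y', hx, hy, by simp [hl]⟩

theorem Linked.ne {l : List α} (hl : l.Nodup) {x y : α} (h : Linked l x y) : x ≠ y := by
  induction l with
  | nil => simp at h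
  | cons a l ih =>
    cases l with
    | nil => simp at h
    | cons b l =>
      simp only [linked_cons_cons] at h
      simp only [List.nodup_cons, List.mem_cons, not_or] at hl ih
      rcases h with h | h | h
      · rw [h.1, h.2]; exact hl.1.1
      · rw [h.1, h.2]; exact fun h => hl.1.1 h.symm
      · exact ih hl.2 h

/-- A list that meets both `S` and its complement has consecutive entries, one in `S` and the
other one outside. -/
theorem exists_linked_of_mem_of_notMem {l : List α} {S : Set α} {p q : α} (hp : p ∈ l)
    (hq : q ∈ l) (hpS : p ∈ S) (hqS : q ∉ S) : ∃ x y, Linked l x y ∧ x ∈ S ∧ y ∉ S := by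
  induction l generalizing p q with
  | nil => simp at hp
  | cons a l ih =>
    cases l with
    | nil =>
      simp only [List.mem_singleton] at hp hq
      subst hp; subst hq; contradiction
    | cons b l =>
      by_cases hb : (∃ p' ∈ b :: l, p' ∈ S) ∧ (∃ q' ∈ b :: l, q' ∉ S)
      · obtain ⟨⟨p', hp', hpS'⟩, q', hq', hqS'⟩ := hb
        obtain ⟨x, y, h, hx, hy⟩ := ih hp' hq' hpS' hqS'
        exact ⟨x, y, by simp [h], hx, hy⟩
      · by_cases haS : a ∈ S <;> by_cases hbS : b ∈ S
        · refine (hb ⟨⟨b, by simp, hbS⟩, q, ?_, hqS⟩).elim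
          rcases List.mem_cons.1 hq with rfl | h
          · contradiction
          · exact h
        · exact ⟨a, b, by simp, haS, hbS⟩
        · exact ⟨b, a, by simp, hbS, haS⟩
        · refine (hb ⟨⟨p, ?_, hpS⟩, b, by simp, hbS⟩).elim
          rcases List.mem_cons.1 hp with rfl | h
          · contradiction
          · exact h

/-- An interior entry of a duplicate-free list has two distinct neighbours, so an entry with only
one neighbour sits at an end. -/
theorem eq_head?_of_unique {l : List α} {x y : α} (hl : (x :: y :: l).Nodup) {l' : List α}
    (hl' : l'.Nodup) (hx : x ∈ l') (h : ∀ z, Linked l' x z ↔ Linked (x :: y :: l) x z) :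
    x ∈ l'.head? ∨ x ∈ l'.getLast? := by
  obtain ⟨A, B, rfl⟩ := List.append_of_mem hx
  have key : ∀ z, Linked (A ++ x :: B) x z → z = y := by
    intro z hz
    rw [h, linked_cons_cons] at hz
    simp only [List.nodup_cons, List.mem_cons, not_or] at hl
    rcases hz with hz | hz | hz
    · exact hz.2
    · exact (hl.1.1 hz.1).elim
    · exact (hl.1.2 (by
        have := hz.mem_left
        simp only [List.mem_cons] at this
        exact this.resolve_left hl.1.1)).elim
  rcases List.eq_nil_or_concat A with rfl | ⟨A', p, rfl⟩
  · left; simp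
  cases B with
  | nil => right; simp
  | cons q B =>
    exfalso
    have hp : p = y := key p (by simp [linked_append])
    have hq : q = y := key q (by simp [linked_append])
    subst hp
    subst hq
    simp [List.nodup_append] at hl'

/-- The head has one neighbour only, the second entry; so a common head forces a common second
entry, and the links of the tails are those that avoid the head. -/
theorem eq_of_linked_iff_of_head {l l' : List α} (hl : l.Nodup) (hl' : l'.Nodup)
    (hh : l.head? = l'.head?) (h : ∀ x y, Linked l x y ↔ Linked l' x y) : l = l' := by
  induction l generalizing l' with
  | nil =>
    cases l' with
    | nil => rfl
    | cons => simp at hh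
  | cons a l ih =>
    cases l' with
    | nil => simp at hh
    | cons a' l' =>
      simp only [List.head?_cons, Option.some.injEq] at hh
      subst hh
      congr 1
      have notin : ∀ (m : List α), (a :: m).Nodup → ∀ z, ¬ Linked m a z ∧ ¬ Linked m z a := by
        intro m hm z
        rw [List.nodup_cons] at hm
        exact ⟨fun h => hm.1 h.mem_left, fun h => hm.1 h.mem_right⟩
      cases l with
      | nil =>
        cases l' with
        | nil => rfl
        | cons b' l' => exact absurd ((h a b').2 (by simp)) (by simp)
      | cons b l =>
        cases l' with
        | nil => exact absurd ((h a b).1 (by simp)) (by simp)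
        | cons b' l' =>
          have hab : a ≠ b' := by
            intro h; subst h; simp at hl'
          have hbb : b = b' := by
            have := (h a b').2 (by simp)
            rw [linked_cons_cons] at this
            rcases this with h | h | h
            · exact h.2.symm
            · exact (hab h.2.symm).elim
            · exact ((notin _ hl _).1 h).elim
          subst hbb
          refine ih (List.nodup_cons.1 hl).2 (List.nodup_cons.1 hl').2 rfl ?_
          intro x y
          by_cases hx : x = a
          · subst hx
            simp [(notin _ hl y).1, (notin _ hl' y).1]
          by_cases hy : y = a
          · subst hy
            simp [(notin _ hl x).2, (notin _ hl' x).2]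
          have := h x y
          simpa [hx, hy] using this

/-- A path is determined by its vertices and its edges, up to reversal. -/
theorem eq_or_eq_reverse_of_linked_iff {l l' : List α} (hl : l.Nodup) (hl' : l'.Nodup)
    (hmem : ∀ x, x ∈ l ↔ x ∈ l') (h : ∀ x y, Linked l x y ↔ Linked l' x y) :
    l' = l ∨ l' = l.reverse := by
  cases l with
  | nil =>
    left
    exact List.eq_nil_iff_forall_not_mem.2 fun x hx => by simpa using (hmem x).2 hx
  | cons a l =>
    cases l with
    | nil =>
      left
      cases l' with
      | nil => simpa using hmem a
      | cons a' l' =>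
        have : a' = a := by simpa using (hmem a').2 (by simp)
        subst this
        cases l' with
        | nil => rfl
        | cons b' l' => exact absurd ((h a' b').2 (by simp)) (by simp)
    | cons b l =>
      rcases eq_head?_of_unique hl hl' ((hmem a).1 (by simp)) (fun z => (h a z).symm) with h1 | h1
      · left
        exact (eq_of_linked_iff_of_head hl hl' h1.symm h).symm
      · right
        have := eq_of_linked_iff_of_head (l' := l'.reverse) hl (List.nodup_reverse.2 hl')
          (by rw [List.head?_reverse]; exact h1.symm) (fun x y => by rw [linked_reverse, h])
        rw [this, List.reverse_reverse]

end Linked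

end PathSystem

/-! ### Systems of uncrossed lists: cutting, joining, uniting -/

namespace PathSystem

/-- No entry-to-entry step of `l` alternates with one of `l'`. -/
def Uncrossed (l l' : List ℤ) : Prop :=
  ∀ x y x' y', Linked l x y → Linked l' x' y' → x < x' → x' < y → y < y' → False

/-- Disjoint lists with uncrossed steps have uncrossed vertex sets. -/
theorem no_alternation {l l' : List ℤ} (h : Uncrossed l l') (h' : Uncrossed l' l)
    (hd : ∀ x ∈ l, x ∉ l') {p q r s : ℤ} (hp : p ∈ l) (hq : q ∈ l') (hr : r ∈ l) (hs : s ∈ l')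
    (hpq : p < q) (hqr : q < r) (hrs : r < s) : False := by
  -- Between `r` and `p` the list `l` has a step leaving the interval from `q` to `s`. That step
  -- separates `q` from `s`, whichever side it leaves on, so `l'` has a step crossing it.
  obtain ⟨y, x, hl, hy, hx⟩ := exists_linked_of_mem_of_notMem (S := Set.Ioo q s) hr hp
    ⟨hqr, hrs⟩ (fun h => by have := h.1; omega)
  have hxq : x ≠ q := fun e => hd x hl.mem_right (e ▸ hq)
  have hxs : x ≠ s := fun e => hd x hl.mem_right (e ▸ hs)
  have hy1 := hy.1
  have hy2 := hy.2
  rw [Set.mem_Ioo, not_and, not_lt] at hx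
  by_cases hxq' : x < q
  · obtain ⟨u, v, hl', hu, hv⟩ := exists_linked_of_mem_of_notMem (S := Set.Ioo x y) hq hs
      ⟨hxq', hy1⟩ (fun h => by have := h.2; omega)
    have hvx : v ≠ x := fun e => hd x hl.mem_right (e ▸ hl'.mem_right)
    have hvy : v ≠ y := fun e => hd y hl.mem_left (e ▸ hl'.mem_right)
    have hu1 := hu.1
    have hu2 := hu.2
    rw [Set.mem_Ioo, not_and, not_lt] at hv
    rcases lt_or_ge v x with h1 | h1
    · exact h' v u x y hl'.symm hl.symm h1 hu1 hu2
    · exact h x y u v hl.symm hl' hu1 hu2 (lt_of_le_of_ne (hv (by omega)) hvy.symm)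
  · have hsx : s < x := lt_of_le_of_ne (hx (by omega)) hxs.symm
    obtain ⟨u, v, hl', hu, hv⟩ := exists_linked_of_mem_of_notMem (S := Set.Ioo y x) hs hq
      ⟨hy2, hsx⟩ (fun h => by have := h.1; omega)
    have hvx : v ≠ x := fun e => hd x hl.mem_right (e ▸ hl'.mem_right)
    have hvy : v ≠ y := fun e => hd y hl.mem_left (e ▸ hl'.mem_right)
    have hu1 := hu.1
    have hu2 := hu.2
    rw [Set.mem_Ioo, not_and, not_lt] at hv
    rcases lt_or_ge v y with h1 | h1
    · exact h' v u y x hl'.symm hl h1 hu1 hu2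
    · exact h y x u v hl hl' hu1 hu2 (lt_of_le_of_ne (hv (by omega)) hvx.symm)

/-- Pairwise disjoint, pairwise uncrossed simple lists of integers. -/
structure IsSystem (P : Set (List ℤ)) : Prop where
  ne_nil : ∀ l ∈ P, l ≠ []
  nodup : ∀ l ∈ P, l.Nodup
  eq_of_mem : ∀ l ∈ P, ∀ l' ∈ P, ∀ x, x ∈ l → x ∈ l' → l = l'
  uncrossed : ∀ l ∈ P, ∀ l' ∈ P, Uncrossed l l'

/-- The lists in `P` visit exactly the elements of `U`. -/
def Covers (P : Set (List ℤ)) (U : Set ℤ) : Prop := ∀ x, (∃ l ∈ P, x ∈ l) ↔ x ∈ U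

/-- The list ends at a point not before its first entry, and it visits all the points between
these two. -/
def Good (l : List ℤ) : Prop :=
  ∀ h ∈ l.head?, ∀ t ∈ l.getLast?, h ≤ t ∧ ∀ x, h ≤ x → x ≤ t → x ∈ l

namespace IsSystem

variable {P Q : Set (List ℤ)}

theorem mono (h : IsSystem Q) (hPQ : P ⊆ Q) : IsSystem P :=
  ⟨fun l hl => h.ne_nil l (hPQ hl), fun l hl => h.nodup l (hPQ hl),
    fun l hl l' hl' => h.eq_of_mem l (hPQ hl) l' (hPQ hl'),
    fun l hl l' hl' => h.uncrossed l (hPQ hl) l' (hPQ hl')⟩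

theorem no_alternation (h : IsSystem P) {l l' : List ℤ} (hl : l ∈ P) (hl' : l' ∈ P) (hne : l ≠ l')
    {p q r s : ℤ} (hp : p ∈ l) (hq : q ∈ l') (hr : r ∈ l) (hs : s ∈ l')
    (hpq : p < q) (hqr : q < r) (hrs : r < s) : False :=
  PathSystem.no_alternation (h.uncrossed l hl l' hl') (h.uncrossed l' hl' l hl)
    (fun x hx hx' => hne (h.eq_of_mem l hl l' hl' x hx hx')) hp hq hr hs hpq hqr hrs

theorem union (hP : IsSystem P) (hQ : IsSystem Q) {m : ℤ} (hPm : ∀ l ∈ P, ∀ x ∈ l, x < m)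
    (hQm : ∀ l ∈ Q, ∀ x ∈ l, m ≤ x) : IsSystem (P ∪ Q) := by
  refine ⟨?_, ?_, ?_, ?_⟩
  · rintro l (hl | hl)
    exacts [hP.ne_nil l hl, hQ.ne_nil l hl]
  · rintro l (hl | hl)
    exacts [hP.nodup l hl, hQ.nodup l hl]
  · rintro l (hl | hl) l' (hl' | hl') x hx hx'
    · exact hP.eq_of_mem l hl l' hl' x hx hx'
    · exact absurd (hPm l hl x hx) (not_lt.2 (hQm l' hl' x hx'))
    · exact absurd (hPm l' hl' x hx') (not_lt.2 (hQm l hl x hx))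
    · exact hQ.eq_of_mem l hl l' hl' x hx hx'
  · rintro l (hl | hl) l' (hl' | hl')
    · exact hP.uncrossed l hl l' hl'
    · intro x y x' y' hxy hxy' h1 h2 h3
      have := hPm l hl y hxy.mem_right
      have := hQm l' hl' x' hxy'.mem_left
      omega
    · intro x y x' y' hxy hxy' h1 h2 h3
      have := hQm l hl x hxy.mem_left
      have := hPm l' hl' x' hxy'.mem_left
      omega
    · exact hQ.uncrossed l hl l' hl'

/-- Cutting a list of a system into two. -/
theorem cut {l₁ l₂ : List ℤ} (h : IsSystem (insert (l₁ ++ l₂) P)) (hP : l₁ ++ l₂ ∉ P)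
    (h₁ : l₁ ≠ []) (h₂ : l₂ ≠ []) : IsSystem (insert l₁ (insert l₂ P)) := by
  have hn := h.nodup _ (Set.mem_insert _ _)
  rw [List.nodup_append] at hn
  have hL : ∀ l ∈ insert l₁ (insert l₂ P), ∃ m ∈ insert (l₁ ++ l₂) P,
      (∀ x ∈ l, x ∈ m) ∧ ∀ x y, Linked l x y → Linked m x y := by
    rintro l (rfl | rfl | hl)
    · exact ⟨_, Set.mem_insert _ _, fun x hx => List.mem_append_left _ hx,
        fun x y hxy => linked_append.2 (Or.inl hxy)⟩
    · exact ⟨_, Set.mem_insert _ _, fun x hx => List.mem_append_right _ hx,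
        fun x y hxy => linked_append.2 (Or.inr (Or.inl hxy))⟩
    · exact ⟨l, Set.mem_insert_of_mem _ hl, fun x hx => hx, fun x y hxy => hxy⟩
  have hdis : ∀ l ∈ P, ∀ x ∈ l, x ∉ l₁ ++ l₂ := fun l hl x hx hx' =>
    hP (h.eq_of_mem _ (Set.mem_insert_of_mem _ hl) _ (Set.mem_insert _ _) x hx hx' ▸ hl)
  refine ⟨?_, ?_, ?_, ?_⟩
  · rintro l (rfl | rfl | hl)
    exacts [h₁, h₂, h.ne_nil l (Set.mem_insert_of_mem _ hl)]
  · rintro l (rfl | rfl | hl)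
    exacts [hn.1, hn.2.1, h.nodup l (Set.mem_insert_of_mem _ hl)]
  · rintro l (rfl | rfl | hl) l' (rfl | rfl | hl') x hx hx'
    · rfl
    · exact (hn.2.2 x hx x hx' rfl).elim
    · exact (hdis l' hl' x hx' (List.mem_append_left _ hx)).elim
    · exact (hn.2.2 x hx' x hx rfl).elim
    · rfl
    · exact (hdis l' hl' x hx' (List.mem_append_right _ hx)).elim
    · exact (hdis l hl x hx (List.mem_append_left _ hx')).elim
    · exact (hdis l hl x hx (List.mem_append_right _ hx')).elim
    · exact h.eq_of_mem l (Set.mem_insert_of_mem _ hl) l' (Set.mem_insert_of_mem _ hl') x hx hx'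
  · intro l hl l' hl' x y x' y' hxy hxy'
    obtain ⟨m, hm, -, hm2⟩ := hL l hl
    obtain ⟨m', hm', -, hm2'⟩ := hL l' hl'
    exact h.uncrossed m hm m' hm' x y x' y' (hm2 x y hxy) (hm2' x' y' hxy')

/-- Joining two lists of a system by a step that does not cross the others. -/
theorem join {l₁ l₂ : List ℤ} (h : IsSystem (insert l₁ (insert l₂ P)))
    (hne : l₁ ≠ l₂) (h₁P : l₁ ∉ P) (h₂P : l₂ ∉ P)
    (hcr : ∀ u ∈ l₁.getLast?, ∀ v ∈ l₂.head?, ∀ l ∈ insert l₁ (insert l₂ P), ∀ x y, Linked l x y →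
      min u v < x → x < max u v → y < min u v ∨ max u v < y → False) :
    IsSystem (insert (l₁ ++ l₂) P) := by
  have m₁ : l₁ ∈ insert l₁ (insert l₂ P) := Set.mem_insert _ _
  have m₂ : l₂ ∈ insert l₁ (insert l₂ P) := Set.mem_insert_of_mem _ (Set.mem_insert _ _)
  have mP : ∀ l ∈ P, l ∈ insert l₁ (insert l₂ P) := fun l hl =>
    Set.mem_insert_of_mem _ (Set.mem_insert_of_mem _ hl)
  have hL : ∀ l ∈ insert (l₁ ++ l₂) P, ∀ x y, Linked l x y →
      (∃ m ∈ insert l₁ (insert l₂ P), Linked m x y) ∨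
        ∃ u ∈ l₁.getLast?, ∃ v ∈ l₂.head?, min x y = min u v ∧ max x y = max u v := by
    rintro l (rfl | hl) x y hxy
    · rcases linked_append.1 hxy with h | h | h | h
      · exact Or.inl ⟨_, m₁, h⟩
      · exact Or.inl ⟨_, m₂, h⟩
      · exact Or.inr ⟨x, h.1, y, h.2, rfl, rfl⟩
      · exact Or.inr ⟨y, h.1, x, h.2, min_comm _ _, max_comm _ _⟩
    · exact Or.inl ⟨l, mP l hl, hxy⟩
  refine ⟨?_, ?_, ?_, ?_⟩
  · rintro l (rfl | hl)
    · simp [h.ne_nil _ m₁]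
    · exact h.ne_nil l (mP l hl)
  · rintro l (rfl | hl)
    · rw [List.nodup_append]
      refine ⟨h.nodup _ m₁, h.nodup _ m₂, ?_⟩
      rintro x hx _ hx' rfl
      exact hne (h.eq_of_mem _ m₁ _ m₂ x hx hx')
    · exact h.nodup l (mP l hl)
  · have key : ∀ l ∈ P, ∀ x ∈ l, x ∉ l₁ ++ l₂ := by
      intro l hl x hx hx'
      rcases List.mem_append.1 hx' with h' | h'
      · exact h₁P (h.eq_of_mem _ (mP l hl) _ m₁ x hx h' ▸ hl)
      · exact h₂P (h.eq_of_mem _ (mP l hl) _ m₂ x hx h' ▸ hl)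
    rintro l (rfl | hl) l' (rfl | hl') x hx hx'
    · rfl
    · exact (key l' hl' x hx' hx).elim
    · exact (key l hl x hx hx').elim
    · exact h.eq_of_mem l (mP l hl) l' (mP l' hl') x hx hx'
  · intro l hl l' hl' x y x' y' hxy hxy' a b c
    rcases hL l hl x y hxy with ⟨m, hm, h1⟩ | ⟨u, hu, v, hv, e1, e2⟩ <;>
    rcases hL l' hl' x' y' hxy' with ⟨m', hm', h1'⟩ | ⟨u', hu', v', hv', e1', e2'⟩
    · exact h.uncrossed m hm m' hm' x y x' y' h1 h1' a b c
    · refine hcr u' hu' v' hv' m hm y x h1.symm ?_ ?_ (Or.inl ?_)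
      · rw [← e1']; omega
      · rw [← e2']; omega
      · rw [← e1']; omega
    · refine hcr u hu v hv m' hm' x' y' h1' ?_ ?_ (Or.inr ?_)
      · rw [← e1]; omega
      · rw [← e2]; omega
      · rw [← e2]; omega
    · rw [Option.mem_def] at hu hv hu' hv'
      have e3 : u = u' := by rw [hu] at hu'; exact Option.some.inj hu'
      have e4 : v = v' := by rw [hv] at hv'; exact Option.some.inj hv'
      subst e3; subst e4
      omega

theorem singleton (a : ℤ) : IsSystem {[a]} := by
  refine ⟨?_, ?_, ?_, ?_⟩
  · rintro l rfl; simp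
  · rintro l rfl; simp
  · rintro l rfl l' rfl; simp
  · rintro l rfl l' rfl x y x' y' h; simp at h

end IsSystem

end PathSystem

/-! ### Classes of systems; removing a left end -/

namespace PathSystem

/-- Common shape of the decompositions below: `X` is a disjoint union of injective images of the `A
i`. Finiteness is carried along because `ncard` is `0` on infinite sets. -/
theorem ncard_eq_sum {ι α β : Type*} [DecidableEq ι] {X : Set α} {I : Finset ι} {A : ι → Set β}
    (f : ι → β → α) (hA : ∀ i ∈ I, (A i).Finite) (hmaps : ∀ i ∈ I, ∀ x ∈ A i, f i x ∈ X)
    (hinj : ∀ i ∈ I, ∀ x ∈ A i, ∀ j ∈ I, ∀ y ∈ A j, f i x = f j y → i = j ∧ x = y)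
    (hsurj : ∀ z ∈ X, ∃ i ∈ I, ∃ x ∈ A i, f i x = z) :
    X.Finite ∧ X.ncard = ∑ i ∈ I, (A i).ncard := by
  classical
  have hX : X = ⋃ i ∈ I, f i '' A i := by
    ext z
    simp only [Set.mem_iUnion, Set.mem_image, exists_prop]
    constructor
    · intro hz
      exact hsurj z hz
    · rintro ⟨i, hi, x, hx, rfl⟩
      exact hmaps i hi x hx
  have hfin : ∀ i ∈ I, (f i '' A i).Finite := fun i hi => (hA i hi).image _
  constructor
  · rw [hX]
    exact Set.Finite.biUnion I.finite_toSet hfin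
  · rw [hX]
    have : ∀ J ⊆ I, (⋃ i ∈ J, f i '' A i).ncard = ∑ i ∈ J, (A i).ncard := by
      intro J hJ
      induction J using Finset.induction_on with
      | empty => simp
      | insert i J hi ih =>
        have hiI := hJ (Finset.mem_insert_self i J)
        have hJI := fun j (hj : j ∈ J) => hJ (Finset.mem_insert_of_mem hj)
        have hJfin : (⋃ j ∈ J, f j '' A j).Finite :=
          Set.Finite.biUnion J.finite_toSet fun j hj => hfin j (hJI j hj)
        rw [Finset.set_biUnion_insert, Finset.sum_insert hi, Set.ncard_union_eq ?_ (hfin i hiI)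
          hJfin, ih hJI,
          Set.InjOn.ncard_image]
        · intro x hx y hy hxy
          exact (hinj i hiI x hx i hiI y hy hxy).2
        · rw [Set.disjoint_left]
          rintro _ ⟨x, hx, rfl⟩ hz
          simp only [Set.mem_iUnion, Set.mem_image, exists_prop] at hz
          obtain ⟨j, hj, y, hy, hxy⟩ := hz
          exact hi ((hinj j (hJI j hj) y hy i hiI x hx hxy).1 ▸ hj)
    exact this I (Finset.Subset.refl I)

/-- The ordered systems on the integer interval `[a, b)`. -/
def ordered (a b : ℤ) : Set (Set (List ℤ)) :=
  {P | IsSystem P ∧ Covers P (Set.Ico a b) ∧ ∀ l ∈ P, Good l}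

/-- A system on `[a, b]` with a distinguished list `l` that visits `a` and `b`, and good other
lists. -/
structure IsRooted (a b : ℤ) (l : List ℤ) (P : Set (List ℤ)) : Prop where
  notMem : l ∉ P
  sys : IsSystem (insert l P)
  cov : Covers (insert l P) (Set.Ico a (b + 1))
  good : ∀ m ∈ P, Good m
  left : a ∈ l
  right : b ∈ l

/-- Rooted systems in which the distinguished list starts at `a` or `b`, and visits all the
points from `a` up to its last entry. -/
def tipped (a b : ℤ) : Set (List ℤ × Set (List ℤ)) :=
  {x | IsRooted a b x.1 x.2 ∧ (a ∈ x.1.head? ∨ b ∈ x.1.head?) ∧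
    ∀ t ∈ x.1.getLast?, ∀ y, a ≤ y → y ≤ t → y ∈ x.1}

def tippedLeft (a b : ℤ) : Set (List ℤ × Set (List ℤ)) := {x ∈ tipped a b | a ∈ x.1.head?}

def tippedRight (a b : ℤ) : Set (List ℤ × Set (List ℤ)) := {x ∈ tipped a b | a ∉ x.1.head?}

/-- Ordered systems in which one list visits both `a` and `b`. -/
def irreducible (a b : ℤ) : Set (List ℤ × Set (List ℤ)) :=
  {x | IsRooted a b x.1 x.2 ∧ Good x.1}

def irreducibleOuter (a b : ℤ) : Set (List ℤ × Set (List ℤ)) :=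
  {x ∈ irreducible a b | a ∉ x.1.head?}

theorem IsRooted.bounds {a b : ℤ} {l : List ℤ} {P : Set (List ℤ)} (h : IsRooted a b l P)
    {x : ℤ} (hx : x ∈ l) : a ≤ x ∧ x ≤ b := by
  have := (h.cov x).1 ⟨l, Set.mem_insert _ _, hx⟩
  exact ⟨this.1, by have := this.2; omega⟩

theorem IsRooted.bounds' {a b : ℤ} {l : List ℤ} {P : Set (List ℤ)} (h : IsRooted a b l P)
    {m : List ℤ} (hm : m ∈ insert l P) {x : ℤ} (hx : x ∈ m) : a ≤ x ∧ x ≤ b := by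
  have := (h.cov x).1 ⟨m, hm, hx⟩
  exact ⟨this.1, by have := this.2; omega⟩

theorem IsRooted.disjoint {a b : ℤ} {l : List ℤ} {P : Set (List ℤ)} (h : IsRooted a b l P)
    {m : List ℤ} (hm : m ∈ P) {x : ℤ} (hx : x ∈ m) : x ∉ l := fun hx' =>
  h.notMem (h.sys.eq_of_mem _ (Set.mem_insert_of_mem _ hm) _ (Set.mem_insert _ _) x hx hx' ▸ hm)

/-- The lists of a system lie on one side of `r` if some list visits both `r` and a lower bound. -/
theorem IsSystem.side {S : Set (List ℤ)} (hS : IsSystem S) {l m : List ℤ} (hl : l ∈ S)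
    (hm : m ∈ S) (hne : l ≠ m) {a r : ℤ} (ha : a ∈ l) (hr : r ∈ l) (hma : ∀ x ∈ m, a ≤ x) :
    (∀ x ∈ m, x < r) ∨ ∀ x ∈ m, r < x := by
  by_contra! hc
  obtain ⟨⟨d, hd, hrd⟩, c, hc, hcr⟩ := hc
  have h1 : ∀ x ∈ l, ∀ y ∈ m, x ≠ y := by
    rintro x hx y hy rfl
    exact hne (hS.eq_of_mem l hl m hm x hx hy)
  have := h1 a ha c hc
  have := h1 r hr c hc
  have := h1 r hr d hd
  have := hma c hc
  exact hS.no_alternation hl hm hne ha hc hr hd (by omega) (by omega) (by omega)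

/-- After a step from an extreme point to `y`, a path that visits both extremes of the remaining
points has to start at one of them. -/
theorem eq_or_eq_of_extreme {l r : List ℤ} {x y c d : ℤ} (hl : Uncrossed l l) (hxy : Linked l x y)
    (hr : ∀ u v, Linked r u v → Linked l u v) (hy : y ∉ r)
    (hx : (∀ z ∈ y :: r, x < z) ∨ ∀ z ∈ y :: r, z < x) (hc : c ∈ y :: r) (hd : d ∈ y :: r)
    (hcd : ∀ z ∈ y :: r, c ≤ z ∧ z ≤ d) : y = c ∨ y = d := by
  by_contra! hne
  have hc' : c ∈ r := (List.mem_cons.1 hc).resolve_left hne.1.symm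
  have hd' : d ∈ r := (List.mem_cons.1 hd).resolve_left hne.2.symm
  have hyb := hcd y (by simp)
  -- If `y` were not extreme, the rest of the path would jump over `y` by some step; as `x` lies
  -- beyond all remaining points, this step crosses the one from `x` to `y`.
  obtain ⟨u, v, huv, hu, hv⟩ := exists_linked_of_mem_of_notMem (S := Set.Iio y) hc' hd'
    (lt_of_le_of_ne hyb.1 hne.1.symm) (not_lt.2 hyb.2)
  have hu' : u < y := hu
  have hv' : y < v := lt_of_le_of_ne (not_lt.1 hv) (fun e => hy (e ▸ huv.mem_right))
  rcases hx with hx | hx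
  · exact hl x y u v hxy (hr u v huv) (hx u (by simp [huv.mem_left])) hu' hv'
  · exact hl u v y x (hr u v huv) hxy.symm hu' hv' (hx v (by simp [huv.mem_right]))

theorem exists_max_of_ne_nil {l : List ℤ} (h : l ≠ []) : ∃ M ∈ l, ∀ x ∈ l, x ≤ M := by
  obtain ⟨a, ha⟩ := List.exists_mem_of_ne_nil l h
  obtain ⟨M, hM, h'⟩ := l.toFinset.exists_max_image id ⟨a, by simpa using ha⟩
  exact ⟨M, by simpa using hM, fun x hx => h' x (by simpa using hx)⟩

theorem Covers.insert_iff {l : List ℤ} {P : Set (List ℤ)} {U : Set ℤ} :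
    Covers (insert l P) U ↔ ∀ x, (x ∈ l ∨ ∃ m ∈ P, x ∈ m) ↔ x ∈ U := by
  refine forall_congr' fun x => ?_
  simp [Set.mem_insert_iff]

theorem isRooted_singleton (a : ℤ) : IsRooted a a [a] ∅ := by
  refine ⟨by simp, ?_, ?_, by simp, by simp, by simp⟩
  · simpa using IsSystem.singleton a
  · rw [Covers.insert_iff]
    intro x
    simp only [List.mem_singleton, Set.mem_empty_iff_false, false_and, exists_false, or_false,
      Set.mem_Ico]
    omega

theorem IsRooted.eq_singleton {a : ℤ} {l : List ℤ} {P : Set (List ℤ)} (h : IsRooted a a l P) :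
    l = [a] ∧ P = ∅ := by
  constructor
  · have hn := h.sys.nodup l (Set.mem_insert _ _)
    have hb := fun x (hx : x ∈ l) => h.bounds hx
    have hne := h.sys.ne_nil l (Set.mem_insert _ _)
    match l, hne with
    | [x], _ => have := hb x (by simp); rw [show x = a by omega]
    | x :: y :: l, _ =>
      have h1 := hb x (by simp)
      have h2 := hb y (by simp)
      simp only [List.nodup_cons, List.mem_cons, not_or] at hn
      omega
  · rw [Set.eq_empty_iff_forall_notMem]
    intro m hm
    obtain ⟨x, hx⟩ := List.exists_mem_of_ne_nil m (h.sys.ne_nil m (Set.mem_insert_of_mem _ hm))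
    have := h.bounds' (Set.mem_insert_of_mem _ hm) hx
    have e : x = a := by omega
    subst e
    exact h.disjoint hm hx h.left

theorem tipped_self (a : ℤ) : tipped a a = {([a], ∅)} := by
  ext ⟨l, P⟩
  simp only [tipped, Set.mem_ofPred_eq, Set.mem_singleton_iff, Prod.mk.injEq]
  constructor
  · rintro ⟨h, -⟩
    exact h.eq_singleton
  · rintro ⟨rfl, rfl⟩
    refine ⟨isRooted_singleton a, by simp, ?_⟩
    simp only [List.getLast?_singleton, Option.mem_def, Option.some.injEq, List.mem_singleton]
    intros; omega

theorem tippedLeft_self (a : ℤ) : tippedLeft a a = {([a], ∅)} := by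
  rw [tippedLeft, tipped_self]
  ext x
  simp only [Set.mem_singleton_iff, Set.mem_ofPred_eq]
  constructor
  · exact fun h => h.1
  · rintro rfl; simp

theorem tippedRight_self (a : ℤ) : tippedRight a a = ∅ := by
  rw [tippedRight, tipped_self]
  ext x
  simp only [Set.mem_singleton_iff, Set.mem_ofPred_eq, Set.mem_empty_iff_false, iff_false]
  rintro ⟨rfl, h⟩
  simp at h

theorem ordered_self (a : ℤ) : ordered a a = {∅} := by
  ext P
  simp only [ordered, Set.mem_ofPred_eq, Set.mem_singleton_iff, Set.Ico_self]
  constructor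
  · rintro ⟨h, hc, -⟩
    rw [Set.eq_empty_iff_forall_notMem]
    intro m hm
    obtain ⟨x, hx⟩ := List.exists_mem_of_ne_nil m (h.ne_nil m hm)
    exact (hc x).1 ⟨m, hm, hx⟩
  · rintro rfl
    exact ⟨⟨by simp, by simp, by simp, by simp⟩, by simp [Covers], by simp⟩

/-- If the list starts at `a`, the run between its ends is the run from `a` to its last entry, so
goodness and the tip condition coincide. -/
theorem irreducible_left (a b : ℤ) : {x ∈ irreducible a b | a ∈ x.1.head?} = tippedLeft a b := by
  ext ⟨l, P⟩
  simp only [irreducible, tippedLeft, tipped, Set.mem_ofPred_eq, Good]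
  constructor
  · rintro ⟨⟨h, hg⟩, ha⟩
    exact ⟨⟨h, Or.inl ha, fun t ht => (hg a ha t ht).2⟩, ha⟩
  · rintro ⟨⟨h, -, hg⟩, ha⟩
    refine ⟨⟨h, ?_⟩, ha⟩
    intro c hc t ht
    rw [Option.mem_def] at ha hc
    rw [ha, Option.some.injEq] at hc
    subst hc
    exact ⟨(h.bounds (List.mem_of_getLast? ht)).1, hg t ht⟩

theorem getLast?_cons_of_ne_nil {α : Type*} {x : α} {l : List α} (h : l ≠ []) :
    (x :: l).getLast? = l.getLast? := by
  cases l with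
  | nil => contradiction
  | cons y l => simp

/-- Removing the first entry from a list that starts at the left end. -/
theorem ncard_tippedLeft {a b : ℤ} (hab : a < b) (hfin : (tipped (a + 1) b).Finite) :
    (tippedLeft a b).Finite ∧ (tippedLeft a b).ncard = (tipped (a + 1) b).ncard := by
  have := ncard_eq_sum (X := tippedLeft a b) (I := {()}) (A := fun _ => tipped (a + 1) b)
    (fun _ x => (a :: x.1, x.2)) (fun _ _ => hfin) ?_ ?_ ?_
  · simpa using this
  · rintro - - ⟨l, P⟩ ⟨hR, hh, ht⟩
    dsimp only at hR hh ht ⊢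
    have hne := hR.sys.ne_nil l (Set.mem_insert _ _)
    have hb : ∀ m ∈ insert l P, ∀ x ∈ m, a + 1 ≤ x ∧ x ≤ b := fun m hm x hx => hR.bounds' hm hx
    have hs : IsSystem (insert [a] (insert l P)) := by
      rw [← Set.singleton_union]
      refine (IsSystem.singleton a).union hR.sys (m := a + 1) ?_ fun m hm x hx => (hb m hm x hx).1
      simp
    have haP : ∀ m ∈ insert l P, a ∉ m := fun m hm ha => by have := (hb m hm a ha).1; omega
    refine ⟨⟨⟨?_, ?_, ?_, hR.good, by simp, by simp [hR.right]⟩, by simp, ?_⟩, by simp⟩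
    · exact fun h => haP _ (Set.mem_insert_of_mem _ h) (by simp)
    · refine hs.join (l₁ := [a]) (l₂ := l) ?_ ?_ hR.notMem ?_
      · rintro rfl
        exact haP _ (Set.mem_insert _ _) (by simp)
      · exact fun h => haP _ (Set.mem_insert_of_mem _ h) (by simp)
      · intro u hu v hv m hm x y hxy h1 h2 h3
        have hu' : a = u := by simpa using hu
        subst hu'
        have hm' : m ∈ insert l P := by
          rcases hm with rfl | hm
          · simp at hxy
          · exact hm
        have hx := hb m hm' x hxy.mem_left
        have hy := hb m hm' y hxy.mem_right
        -- The new step joins neighbouring points or spans the whole interval; neither can be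
        -- crossed.
        have hv' : v = a + 1 ∨ v = b := by
          rw [Option.mem_def] at hv
          simpa [hv] using hh
        omega
    · rw [Covers.insert_iff]
      intro x
      have := Covers.insert_iff.1 hR.cov x
      rw [List.mem_cons, or_assoc, this, Set.mem_Ico, Set.mem_Ico]
      omega
    · dsimp only
      intro t h y hy1 hy2
      rw [getLast?_cons_of_ne_nil hne] at h
      rcases eq_or_lt_of_le hy1 with rfl | hy1
      · simp
      · exact List.mem_cons_of_mem _ (ht t h y hy1 hy2)
  · rintro - - ⟨l, P⟩ - - - ⟨l', P'⟩ - h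
    simpa using h
  · rintro ⟨l, P⟩ ⟨⟨hR, -, ht⟩, hh⟩
    dsimp only at hR ht hh
    refine ⟨(), by simp, ?_⟩
    cases l with
    | nil => simp at hh
    | cons a' r =>
      have : a' = a := by simpa using hh
      subst this
      have hbr : b ∈ r := (List.mem_cons.1 hR.right).resolve_left (by omega)
      have hne : r ≠ [] := List.ne_nil_of_mem hbr
      have hcut := hR.sys.cut (l₁ := [a']) (l₂ := r) hR.notMem (by simp) hne
      have hn := hR.sys.nodup _ (Set.mem_insert _ _)
      rw [List.nodup_cons] at hn
      have hbd : ∀ x ∈ r, a' + 1 ≤ x ∧ x ≤ b := by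
        intro x hx
        have := hR.bounds (List.mem_cons_of_mem _ hx)
        have : x ≠ a' := fun e => hn.1 (e ▸ hx)
        omega
      have har : a' + 1 ∈ r := by
        have h1 := ht _ (by
          rw [getLast?_cons_of_ne_nil hne]
          exact List.getLast?_eq_some_getLast hne) (a' + 1) (by omega)
          (hbd _ (List.getLast_mem hne)).1
        exact (List.mem_cons.1 h1).resolve_left (by omega)
      refine ⟨(r, P), ⟨⟨?_, hcut.mono (Set.subset_insert _ _), ?_, hR.good, har, hbr⟩, ?_, ?_⟩, rfl⟩
      · exact fun h => hR.disjoint h hbr (by simp [hbr])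
      · rw [Covers.insert_iff]
        intro x
        have := Covers.insert_iff.1 hR.cov x
        rw [List.mem_cons, or_assoc] at this
        have hx : x = a' → ¬ (x ∈ r ∨ ∃ m ∈ P, x ∈ m) := by
          rintro rfl (h | ⟨m, hm, h⟩)
          · exact hn.1 h
          · exact hR.disjoint hm h (by simp)
        rw [Set.mem_Ico] at this ⊢
        constructor
        · intro h
          have h1 := this.1 (Or.inr h)
          have : x ≠ a' := fun e => hx e h
          omega
        · intro h
          exact (this.2 (by omega)).resolve_left (by omega)
      · dsimp only
        cases r with
        | nil => contradiction
        | cons y r =>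
          have := eq_or_eq_of_extreme (l := a' :: y :: r) (r := r) (x := a') (y := y)
            (c := a' + 1) (d := b)
            (hR.sys.uncrossed _ (Set.mem_insert _ _) _ (Set.mem_insert _ _)) (by simp)
            (fun u v h => ?_) (List.nodup_cons.1 hn.2).1
            (Or.inl fun z hz => by have := hbd z hz; omega) har hbr hbd
          · simpa using this
          · have : Linked ([a', y] ++ r) u v := linked_append.2 (Or.inr (Or.inl h))
            simpa using this
      · intro t h y hy1 hy2
        have := ht t (by rwa [getLast?_cons_of_ne_nil hne]) y (by omega) hy2
        exact (List.mem_cons.1 this).resolve_left (by omega)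

end PathSystem

/-! ### Removing a right end; splitting off the first block -/

namespace PathSystem

/-- A nonempty list shows by its position relative to `c` to which part it belongs, so the union
determines both parts. -/
theorem union_inj_of_separated {P P' Q Q' : Set (List ℤ)} {c : ℤ}
    (hP : ∀ l ∈ P, ∃ x ∈ l, x < c) (hP' : ∀ l ∈ P', ∃ x ∈ l, x < c)
    (hQ : ∀ l ∈ Q, ∀ x ∈ l, c ≤ x) (hQ' : ∀ l ∈ Q', ∀ x ∈ l, c ≤ x) (h : P ∪ Q = P' ∪ Q') :
    P = P' ∧ Q = Q' := by
  have key : ∀ {A B : Set (List ℤ)}, (∀ l ∈ A, ∃ x ∈ l, x < c) → (∀ l ∈ B, ∀ x ∈ l, c ≤ x) →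
      ∀ l ∈ A, l ∉ B := by
    intro A B hA hB l hl hl'
    obtain ⟨x, hx, hxc⟩ := hA l hl
    exact absurd (hB l hl' x hx) (not_le.2 hxc)
  have h' : ∀ l, l ∈ P ∨ l ∈ Q ↔ l ∈ P' ∨ l ∈ Q' := fun l => by
    simpa using Set.ext_iff.1 h l
  constructor
  · ext l
    constructor
    · exact fun hl => ((h' l).1 (Or.inl hl)).resolve_right (key hP hQ' l hl)
    · exact fun hl => ((h' l).2 (Or.inl hl)).resolve_right (key hP' hQ l hl)
  · ext l
    constructor
    · exact fun hl => ((h' l).1 (Or.inr hl)).resolve_left fun hl' => key hP' hQ l hl' hl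
    · exact fun hl => ((h' l).2 (Or.inr hl)).resolve_left fun hl' => key hP hQ' l hl' hl

theorem insert_inj_of_notMem {α : Type*} {P P' : Set α} {l : α} (h : insert l P = insert l P')
    (hP : l ∉ P) (hP' : l ∉ P') : P = P' := by
  rw [← Set.insert_sdiff_self_of_notMem hP, h, Set.insert_sdiff_self_of_notMem hP']

theorem mem_ordered_bounds {a b : ℤ} {P : Set (List ℤ)} (h : P ∈ ordered a b) {l : List ℤ}
    (hl : l ∈ P) {x : ℤ} (hx : x ∈ l) : a ≤ x ∧ x < b :=
  (h.2.1 x).1 ⟨l, hl, hx⟩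

theorem IsRooted.right_le {a b b' : ℤ} {l : List ℤ} {P P' : Set (List ℤ)} (h : IsRooted a b l P)
    (h' : IsRooted a b' l P') : b ≤ b' := (h'.bounds h.right).2

theorem IsRooted.exists_mem {a b : ℤ} {l : List ℤ} {P : Set (List ℤ)} (h : IsRooted a b l P)
    {m : List ℤ} (hm : m ∈ insert l P) : ∃ x ∈ m, x < b + 1 := by
  obtain ⟨x, hx⟩ := List.exists_mem_of_ne_nil m (h.sys.ne_nil m hm)
  exact ⟨x, hx, by have := (h.bounds' hm hx).2; omega⟩

/-- Removing the first entry from a list that starts at the right end. -/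
theorem ncard_tippedRight (a : ℤ) (n : ℕ)
    (hT : ∀ m ≤ n, (tipped a (a + m)).Finite)
    (hO : ∀ m ≤ n, (ordered (a + m + 1) (a + n + 1)).Finite) :
    (tippedRight a (a + n + 1)).Finite ∧ (tippedRight a (a + n + 1)).ncard =
      ∑ m ∈ Finset.range (n + 1),
        (tipped a (a + m)).ncard * (ordered (a + m + 1) (a + n + 1)).ncard := by
  have := ncard_eq_sum (X := tippedRight a (a + n + 1)) (I := Finset.range (n + 1))
    (A := fun m => tipped a (a + m) ×ˢ ordered (a + m + 1) (a + n + 1))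
    (fun _ x => ((a + n + 1) :: x.1.1, x.1.2 ∪ x.2)) ?_ ?_ ?_ ?_
  · simpa only [Set.ncard_prod] using this
  · intro m hm
    have : m ≤ n := by simpa [Nat.lt_succ_iff] using hm
    exact (hT m this).prod (hO m this)
  · rintro m hm ⟨⟨l, P⟩, Q⟩ ⟨⟨hR, hh, ht⟩, hQ⟩
    have hmn : m < n + 1 := by simpa using hm
    dsimp only at hR hh ht hQ ⊢
    obtain ⟨b, hb⟩ : ∃ b, b = a + n + 1 := ⟨_, rfl⟩
    rw [← hb] at hQ ⊢
    have hmb : a + m + 1 ≤ b := by omega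
    have hne := hR.sys.ne_nil l (Set.mem_insert _ _)
    have hb1 : ∀ k ∈ insert l P, ∀ x ∈ k, a ≤ x ∧ x < a + m + 1 := fun k hk x hx => by
      have := hR.bounds' hk hx
      omega
    have hb2 : ∀ k ∈ Q, ∀ x ∈ k, a + m + 1 ≤ x ∧ x < b := fun k hk x hx =>
      mem_ordered_bounds hQ hk hx
    have hbP : ∀ k ∈ insert l (P ∪ Q), ∀ x ∈ k, a ≤ x ∧ x < b := by
      rintro k hk x hx
      rw [← Set.insert_union] at hk
      rcases hk with hk | hk
      · have := hb1 k hk x hx; omega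
      · have := hb2 k hk x hx; omega
    have hs : IsSystem (insert [b] (insert l (P ∪ Q))) := by
      rw [← Set.union_singleton, ← Set.insert_union]
      refine ((hR.sys.union hQ.1 (m := a + m + 1) (fun k hk x hx => (hb1 k hk x hx).2)
        fun k hk x hx => (hb2 k hk x hx).1)).union (IsSystem.singleton b) (m := b) ?_ ?_
      · rw [Set.insert_union]
        exact fun k hk x hx => (hbP k hk x hx).2
      · simp
    have hbN : ∀ k ∈ insert l (P ∪ Q), b ∉ k := fun k hk h => by have := (hbP k hk b h).2; omega
    have hlN : l ∉ P ∪ Q := by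
      rintro (h | h)
      · exact hR.notMem h
      · have := (hb1 l (Set.mem_insert _ _) _ hR.left).2
        have := (hb2 l h _ hR.left).1
        omega
    refine ⟨⟨⟨?_, ?_, ?_, ?_, by simp [hR.left], by simp⟩, by simp, ?_⟩, ?_⟩
    · exact fun h => hbN _ (Set.mem_insert_of_mem _ h) (by simp)
    · refine hs.join (l₁ := [b]) (l₂ := l) ?_ ?_ hlN ?_
      · rintro rfl
        exact hbN _ (Set.mem_insert _ _) (by simp)
      · exact fun h => hbN _ (Set.mem_insert_of_mem _ h) (by simp)
      · intro u hu v hv k hk x y hxy h1 h2 h3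
        have hu' : b = u := by simpa using hu
        subst hu'
        have hk' : k ∈ insert l P ∪ Q := by
          rw [Set.insert_union]
          rcases hk with rfl | hk
          · simp at hxy
          · exact hk
        -- The new step spans either the whole interval or exactly the points covered by `Q`, so no
        -- list crosses it.
        have hv' : v = a ∨ v = a + m := by
          rw [Option.mem_def] at hv
          simpa [hv] using hh
        rcases hk' with hk' | hk'
        · have hx := hb1 k hk' x hxy.mem_left
          have hy := hb1 k hk' y hxy.mem_right
          omega
        · have hx := hb2 k hk' x hxy.mem_left
          have hy := hb2 k hk' y hxy.mem_right
          omega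
    · rw [Covers.insert_iff]
      intro x
      have h1 := Covers.insert_iff.1 hR.cov x
      have h2 := hQ.2.1 x
      rw [Set.mem_Ico] at h1 h2 ⊢
      have h3 : (x ∈ b :: l ∨ ∃ k ∈ P ∪ Q, x ∈ k) ↔
          x = b ∨ (x ∈ l ∨ ∃ k ∈ P, x ∈ k) ∨ ∃ k ∈ Q, x ∈ k := by
        simp only [List.mem_cons, Set.mem_union, or_and_right, exists_or, or_assoc]
      rw [h3, h1, h2]
      omega
    · rintro k (hk | hk)
      exacts [hR.good k hk, hQ.2.2 k hk]
    · dsimp only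
      intro t h y hy1 hy2
      rw [getLast?_cons_of_ne_nil hne] at h
      exact List.mem_cons_of_mem _ (ht t h y hy1 hy2)
    · simp only [List.head?_cons, Option.mem_def, Option.some.injEq]
      omega
  · rintro m hm ⟨⟨l, P⟩, Q⟩ ⟨⟨hR, -, -⟩, hQ⟩ m' hm' ⟨⟨l', P'⟩, Q'⟩ ⟨⟨hR', -, -⟩, hQ'⟩ h
    simp only [Prod.mk.injEq, List.cons.injEq, true_and] at h
    dsimp only at hR hR' hQ hQ'
    obtain ⟨rfl, h⟩ := h
    have h1 := hR.right_le hR'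
    have h2 := hR'.right_le hR
    have : m = m' := by omega
    subst this
    obtain ⟨rfl, rfl⟩ := union_inj_of_separated (c := a + m + 1)
      (fun k hk => hR.exists_mem (Set.mem_insert_of_mem _ hk))
      (fun k hk => hR'.exists_mem (Set.mem_insert_of_mem _ hk))
      (fun k hk x hx => (mem_ordered_bounds hQ hk hx).1)
      (fun k hk x hx => (mem_ordered_bounds hQ' hk hx).1) h
    exact ⟨rfl, rfl⟩
  · rintro ⟨l, P⟩ ⟨⟨hR, hh, ht⟩, hh'⟩
    dsimp only at hR ht hh hh' ⊢
    obtain ⟨b, hb⟩ : ∃ b, b = a + n + 1 := ⟨_, rfl⟩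
    rw [← hb] at hR hh ⊢
    replace hh := hh.resolve_left hh'
    cases l with
    | nil => simp at hh
    | cons b' r =>
      have : b' = b := by simpa using hh
      subst this
      have har : a ∈ r := (List.mem_cons.1 hR.left).resolve_left (by omega)
      have hne : r ≠ [] := List.ne_nil_of_mem har
      have hcut := hR.sys.cut (l₁ := [b']) (l₂ := r) hR.notMem (by simp) hne
      have hn := hR.sys.nodup _ (Set.mem_insert _ _)
      rw [List.nodup_cons] at hn
      have hbd : ∀ x ∈ r, a ≤ x ∧ x < b' := by
        intro x hx
        have := hR.bounds (List.mem_cons_of_mem _ hx)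
        have : x ≠ b' := fun e => hn.1 (e ▸ hx)
        omega
      -- What remains of the distinguished list visits both `a` and its maximum `M`, hence no other
      -- list has points on both sides of `M`. The lists behind `M` form the independent ordered
      -- system.
      obtain ⟨M, hM, hmax⟩ := exists_max_of_ne_nil hne
      have hMb := hbd M hM
      obtain ⟨m, hm⟩ : ∃ m : ℕ, M = a + m := ⟨(M - a).toNat, by omega⟩
      have hside : ∀ k ∈ P, (∀ x ∈ k, x < M + 1) ∨ ∀ x ∈ k, M + 1 ≤ x := by
        intro k hk
        rcases hR.sys.side (Set.mem_insert _ _) (Set.mem_insert_of_mem _ hk)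
          (fun h => hR.notMem (h ▸ hk)) (r := M) hR.left (List.mem_cons_of_mem _ hM)
          (fun x hx => (hR.bounds' (Set.mem_insert_of_mem _ hk) hx).1) with h | h
        · exact Or.inl fun x hx => by have := h x hx; omega
        · exact Or.inr fun x hx => by have := h x hx; omega
      have hcovP : ∀ x, a ≤ x → x < b' → x ∈ r ∨ ∃ k ∈ P, x ∈ k := by
        intro x h1 h2
        have := (Covers.insert_iff.1 hR.cov x).2 ⟨h1, by omega⟩
        rw [List.mem_cons, or_assoc] at this
        exact this.resolve_left (by omega)
      refine ⟨m, by simp; omega, ((r, {k ∈ P | ∀ x ∈ k, x < M + 1}),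
        {k ∈ P | ∀ x ∈ k, M + 1 ≤ x}), ⟨⟨⟨?_, ?_, ?_, ?_, har, ?_⟩, ?_, ?_⟩, ?_, ?_, ?_⟩, ?_⟩
      · exact fun h => hR.disjoint h.1 har (List.mem_cons_of_mem _ har)
      · refine hcut.mono ?_
        rintro k (rfl | hk)
        · exact Set.mem_insert_of_mem _ (Set.mem_insert _ _)
        · exact Set.mem_insert_of_mem _ (Set.mem_insert_of_mem _ hk.1)
      · rw [Covers.insert_iff]
        intro x
        rw [Set.mem_Ico]
        dsimp only
        constructor
        · rintro (h | ⟨k, hk, h⟩)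
          · have := hbd x h
            have := hmax x h
            omega
          · have := hk.2 x h
            have := hR.bounds' (Set.mem_insert_of_mem _ hk.1) h
            omega
        · rintro ⟨h1, h2⟩
          refine (hcovP x h1 (by omega)).imp_right ?_
          rintro ⟨k, hk, h⟩
          refine ⟨k, ⟨hk, (hside k hk).resolve_right fun h' => ?_⟩, h⟩
          have := h' x h
          omega
      · exact fun k hk => hR.good k hk.1
      · rw [← hm]; exact hM
      · dsimp only
        cases r with
        | nil => contradiction
        | cons y r =>
          have := eq_or_eq_of_extreme (l := b' :: y :: r) (r := r) (x := b') (y := y)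
            (c := a) (d := M)
            (hR.sys.uncrossed _ (Set.mem_insert _ _) _ (Set.mem_insert _ _)) (by simp)
            (fun u v h => ?_) (List.nodup_cons.1 hn.2).1
            (Or.inr fun z hz => (hbd z hz).2) har hM (fun z hz => ⟨(hbd z hz).1, hmax z hz⟩)
          · simpa [← hm] using this
          · have : Linked ([b', y] ++ r) u v := linked_append.2 (Or.inr (Or.inl h))
            simpa using this
      · intro t h y hy1 hy2
        have h1 := ht t (by rwa [getLast?_cons_of_ne_nil hne]) y (by omega) hy2
        have := hbd t (List.mem_of_getLast? h)
        exact (List.mem_cons.1 h1).resolve_left (by omega)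
      · refine hR.sys.mono ?_
        rintro k hk
        exact Set.mem_insert_of_mem _ hk.1
      · intro x
        rw [Set.mem_Ico]
        dsimp only
        constructor
        · rintro ⟨k, hk, h⟩
          have := hk.2 x h
          have := hR.bounds' (Set.mem_insert_of_mem _ hk.1) h
          have : x ≠ b' := fun e => hR.disjoint hk.1 h (e ▸ hR.right)
          omega
        · rintro ⟨h1, h2⟩
          have h3 := (hcovP x (by omega) (by omega)).resolve_left fun h => by
            have := hmax x h
            omega
          obtain ⟨k, hk, h⟩ := h3
          refine ⟨k, ⟨hk, (hside k hk).resolve_left fun h' => ?_⟩, h⟩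
          have := h' x h
          omega
      · exact fun k hk => hR.good k hk.1
      · have hP : {k ∈ P | ∀ x ∈ k, x < M + 1} ∪ {k ∈ P | ∀ x ∈ k, M + 1 ≤ x} = P := by
          ext k
          constructor
          · rintro (h | h) <;> exact h.1
          · intro hk
            exact (hside k hk).imp (fun h => ⟨hk, h⟩) fun h => ⟨hk, h⟩
        simp only [hP]

/-- Splitting an ordered system behind the list that visits the first point. -/
theorem ncard_ordered (a : ℤ) (n : ℕ)
    (hT : ∀ m ≤ n, (irreducible a (a + m)).Finite)
    (hO : ∀ m ≤ n, (ordered (a + m + 1) (a + n + 1)).Finite) :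
    (ordered a (a + n + 1)).Finite ∧ (ordered a (a + n + 1)).ncard =
      ∑ m ∈ Finset.range (n + 1),
        (irreducible a (a + m)).ncard * (ordered (a + m + 1) (a + n + 1)).ncard := by
  have := ncard_eq_sum (X := ordered a (a + n + 1)) (I := Finset.range (n + 1))
    (A := fun m => irreducible a (a + m) ×ˢ ordered (a + m + 1) (a + n + 1))
    (fun _ x => insert x.1.1 x.1.2 ∪ x.2) ?_ ?_ ?_ ?_
  · simpa only [Set.ncard_prod] using this
  · intro m hm
    have : m ≤ n := by simpa [Nat.lt_succ_iff] using hm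
    exact (hT m this).prod (hO m this)
  · rintro m hm ⟨⟨l, P⟩, Q⟩ ⟨⟨hR, hg⟩, hQ⟩
    have hmn : m < n + 1 := by simpa using hm
    dsimp only at hR hg hQ ⊢
    have hb1 : ∀ k ∈ insert l P, ∀ x ∈ k, a ≤ x ∧ x < a + m + 1 := fun k hk x hx => by
      have := hR.bounds' hk hx
      omega
    have hb2 : ∀ k ∈ Q, ∀ x ∈ k, a + m + 1 ≤ x ∧ x < a + n + 1 := fun k hk x hx =>
      mem_ordered_bounds hQ hk hx
    refine ⟨hR.sys.union hQ.1 (m := a + m + 1) (fun k hk x hx => (hb1 k hk x hx).2)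
        fun k hk x hx => (hb2 k hk x hx).1, ?_, ?_⟩
    · intro x
      have h1 := hR.cov x
      have h2 := hQ.2.1 x
      rw [Set.mem_Ico] at h1 h2 ⊢
      have h3 : (∃ k ∈ insert l P ∪ Q, x ∈ k) ↔ (∃ k ∈ insert l P, x ∈ k) ∨ ∃ k ∈ Q, x ∈ k := by
        simp only [Set.mem_union, or_and_right, exists_or]
      rw [h3, h1, h2]
      omega
    · rintro k ((rfl | hk) | hk)
      exacts [hg, hR.good k hk, hQ.2.2 k hk]
  · rintro m hm ⟨⟨l, P⟩, Q⟩ ⟨⟨hR, hg⟩, hQ⟩ m' hm' ⟨⟨l', P'⟩, Q'⟩ ⟨⟨hR', hg'⟩, hQ'⟩ h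
    dsimp only at hR hR' hQ hQ' h
    -- The block is recovered from the union: its distinguished list is the one through `a`, and its
    -- right end is the maximum of that list.
    have hl : l = l' := by
      have h1 : l ∈ insert l' P' ∪ Q' := h ▸ Or.inl (Set.mem_insert _ _)
      rcases h1 with h1 | h1
      · exact hR'.sys.eq_of_mem _ h1 _ (Set.mem_insert _ _) a hR.left hR'.left
      · have := (mem_ordered_bounds hQ' h1 hR.left).1
        omega
    subst hl
    have h1 := hR.right_le hR'
    have h2 := hR'.right_le hR
    have : m = m' := by omega
    subst this
    obtain ⟨hPP, rfl⟩ := union_inj_of_separated (c := a + m + 1)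
      (fun k hk => hR.exists_mem hk)
      (fun k hk => hR'.exists_mem hk)
      (fun k hk x hx => (mem_ordered_bounds hQ hk hx).1)
      (fun k hk x hx => (mem_ordered_bounds hQ' hk hx).1) h
    have := insert_inj_of_notMem hPP hR.notMem hR'.notMem
    subst this
    exact ⟨rfl, rfl⟩
  · rintro R ⟨hR, hc, hg⟩
    obtain ⟨l, hl, hal⟩ := (hc a).2 ⟨le_rfl, by omega⟩
    obtain ⟨M, hM, hmax⟩ := exists_max_of_ne_nil (hR.ne_nil l hl)
    have hbd : ∀ k ∈ R, ∀ x ∈ k, a ≤ x ∧ x < a + n + 1 := fun k hk x hx => (hc x).1 ⟨k, hk, hx⟩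
    have hMb := hbd l hl M hM
    obtain ⟨m, hm⟩ : ∃ m : ℕ, M = a + m := ⟨(M - a).toNat, by omega⟩
    have hside : ∀ k ∈ R, (∀ x ∈ k, x < M + 1) ∨ ∀ x ∈ k, M + 1 ≤ x := by
      intro k hk
      by_cases hkl : l = k
      · subst hkl
        exact Or.inl fun x hx => by have := hmax x hx; omega
      rcases hR.side hl hk hkl hal hM (fun x hx => (hbd k hk x hx).1) with h | h
      · exact Or.inl fun x hx => by have := h x hx; omega
      · exact Or.inr fun x hx => by have := h x hx; omega
    have hins : insert l {k ∈ R | k ≠ l ∧ ∀ x ∈ k, x < M + 1} = {k ∈ R | ∀ x ∈ k, x < M + 1} := by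
      ext k
      constructor
      · rintro (rfl | h)
        · exact ⟨hl, fun x hx => by have := hmax x hx; omega⟩
        · exact ⟨h.1, h.2.2⟩
      · rintro ⟨h1, h2⟩
        by_cases hkl : k = l
        · exact Or.inl hkl
        · exact Or.inr ⟨h1, hkl, h2⟩
    refine ⟨m, by simp; omega, ((l, {k ∈ R | k ≠ l ∧ ∀ x ∈ k, x < M + 1}),
      {k ∈ R | ∀ x ∈ k, M + 1 ≤ x}), ⟨⟨⟨?_, ?_, ?_, ?_, hal, ?_⟩, hg l hl⟩, ?_, ?_, ?_⟩, ?_⟩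
    · exact fun h => h.2.1 rfl
    · dsimp only
      rw [hins]
      exact hR.mono fun k hk => hk.1
    · dsimp only
      rw [hins]
      intro x
      rw [Set.mem_Ico]
      constructor
      · rintro ⟨k, hk, h⟩
        have := hk.2 x h
        have := hbd k hk.1 x h
        omega
      · rintro ⟨h1, h2⟩
        obtain ⟨k, hk, h⟩ := (hc x).2 ⟨h1, by omega⟩
        refine ⟨k, ⟨hk, (hside k hk).resolve_right fun h' => ?_⟩, h⟩
        have := h' x h
        omega
    · exact fun k hk => hg k hk.1
    · rw [← hm]; exact hM
    · exact hR.mono fun k hk => hk.1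
    · intro x
      rw [Set.mem_Ico]
      dsimp only
      constructor
      · rintro ⟨k, hk, h⟩
        have := hk.2 x h
        have := hbd k hk.1 x h
        omega
      · rintro ⟨h1, h2⟩
        obtain ⟨k, hk, h⟩ := (hc x).2 ⟨by omega, h2⟩
        refine ⟨k, ⟨hk, (hside k hk).resolve_left fun h' => ?_⟩, h⟩
        have := h' x h
        omega
    · exact fun k hk => hg k hk.1
    · dsimp only
      rw [hins]
      ext k
      constructor
      · rintro (h | h) <;> exact h.1
      · intro hk
        exact (hside k hk).imp (fun h => ⟨hk, h⟩) fun h => ⟨hk, h⟩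

end PathSystem

/-! ### Reflection; irreducible systems not starting at the left end -/

namespace PathSystem

/-- The image of a list under the reflection `x ↦ c - x`, traversed backwards. -/
def mirror (c : ℤ) (l : List ℤ) : List ℤ := (l.map fun x => c - x).reverse

theorem mirror_mirror (c : ℤ) (l : List ℤ) : mirror c (mirror c l) = l := by
  simp [mirror]

theorem mem_mirror {c x : ℤ} {l : List ℤ} : x ∈ mirror c l ↔ c - x ∈ l := by
  simp only [mirror, List.mem_reverse, List.mem_map]
  constructor
  · rintro ⟨y, hy, rfl⟩
    simpa using hy
  · exact fun h => ⟨_, h, by omega⟩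

theorem linked_mirror {c x y : ℤ} {l : List ℤ} :
    Linked (mirror c l) x y ↔ Linked l (c - x) (c - y) := by
  have hf : Function.Injective fun x : ℤ => c - x := fun x y h => by simpa using h
  have := linked_map hf (l := l) (x := c - x) (y := c - y)
  rw [mirror, linked_reverse, ← this]
  simp

theorem head?_mirror {c x : ℤ} {l : List ℤ} : x ∈ (mirror c l).head? ↔ c - x ∈ l.getLast? := by
  simp only [mirror, List.head?_reverse, List.getLast?_map, Option.mem_def, Option.map_eq_some_iff]
  constructor
  · rintro ⟨y, hy, rfl⟩
    simpa using hy
  · exact fun h => ⟨_, h, by omega⟩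

theorem getLast?_mirror {c x : ℤ} {l : List ℤ} :
    x ∈ (mirror c l).getLast? ↔ c - x ∈ l.head? := by
  conv_rhs => rw [← mirror_mirror c l]
  rw [head?_mirror]
  simp

theorem Good.mirror {l : List ℤ} (h : Good l) (c : ℤ) : Good (mirror c l) := by
  intro u hu v hv
  rw [head?_mirror] at hu
  rw [getLast?_mirror] at hv
  obtain ⟨h1, h2⟩ := h _ hv _ hu
  refine ⟨by omega, fun x hx1 hx2 => ?_⟩
  rw [mem_mirror]
  exact h2 _ (by omega) (by omega)

theorem mem_mirror_image {c : ℤ} {P : Set (List ℤ)} {l : List ℤ} :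
    l ∈ mirror c '' P ↔ mirror c l ∈ P := by
  constructor
  · rintro ⟨m, hm, rfl⟩
    rwa [mirror_mirror]
  · exact fun h => ⟨_, h, mirror_mirror c l⟩

theorem IsSystem.mirror {P : Set (List ℤ)} (h : IsSystem P) (c : ℤ) :
    IsSystem (mirror c '' P) := by
  refine ⟨?_, ?_, ?_, ?_⟩
  · rintro _ ⟨l, hl, rfl⟩
    simpa [PathSystem.mirror] using h.ne_nil l hl
  · rintro _ ⟨l, hl, rfl⟩
    rw [PathSystem.mirror, List.nodup_reverse]
    exact (h.nodup l hl).map fun x y e => by simpa using e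
  · rintro _ ⟨l, hl, rfl⟩ _ ⟨l', hl', rfl⟩ x hx hx'
    rw [mem_mirror] at hx hx'
    rw [h.eq_of_mem l hl l' hl' _ hx hx']
  · rintro _ ⟨l, hl, rfl⟩ _ ⟨l', hl', rfl⟩ x y x' y' hxy hxy' h1 h2 h3
    rw [linked_mirror] at hxy hxy'
    -- Reflection reverses the order, so the two lists exchange their roles.
    exact h.uncrossed l' hl' l hl _ _ _ _ hxy'.symm hxy.symm (by omega) (by omega) (by omega)

theorem IsRooted.mirror {a b : ℤ} {l : List ℤ} {P : Set (List ℤ)} (h : IsRooted a b l P) :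
    IsRooted a b (mirror (a + b) l) (mirror (a + b) '' P) := by
  refine ⟨?_, ?_, ?_, ?_, ?_, ?_⟩
  · rw [mem_mirror_image, mirror_mirror]
    exact h.notMem
  · rw [← Set.image_insert_eq]
    exact h.sys.mirror _
  · rw [← Set.image_insert_eq]
    intro x
    have := h.cov (a + b - x)
    rw [Set.mem_Ico] at this ⊢
    constructor
    · rintro ⟨_, ⟨m, hm, rfl⟩, hx⟩
      have := this.1 ⟨m, hm, mem_mirror.1 hx⟩
      omega
    · intro hx
      obtain ⟨m, hm, hx⟩ := this.2 (by omega)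
      exact ⟨_, ⟨m, hm, rfl⟩, mem_mirror.2 hx⟩
  · rintro _ ⟨m, hm, rfl⟩
    exact (h.good m hm).mirror _
  · rw [mem_mirror]
    simpa using h.right
  · rw [mem_mirror]
    simpa using h.left

/-- The mirror images of the elements of `tippedRight a b`. -/
def tippedMirror (a b : ℤ) : Set (List ℤ × Set (List ℤ)) :=
  {x | IsRooted a b x.1 x.2 ∧ a ∈ x.1.getLast? ∧ a ≠ b ∧
    ∀ h ∈ x.1.head?, ∀ y, h ≤ y → y ≤ b → y ∈ x.1}

/-- Reflection with reversal turns a first entry `b` into a last entry `a`. The condition `a ≠ b`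
excludes the one-point list, which counts as starting on the left. -/
theorem tippedMirror_eq (a b : ℤ) : tippedMirror a b =
    (fun x : List ℤ × Set (List ℤ) => (mirror (a + b) x.1, mirror (a + b) '' x.2)) ''
      tippedRight a b := by
  have hinv : ∀ P : Set (List ℤ), mirror (a + b) '' (mirror (a + b) '' P) = P := by
    intro P
    ext l
    rw [mem_mirror_image, mem_mirror_image, mirror_mirror]
  ext ⟨l, P⟩
  constructor
  · rintro ⟨hR, ha, hab, hh⟩
    dsimp only at hR ha hab hh
    refine ⟨(mirror (a + b) l, mirror (a + b) '' P), ⟨⟨hR.mirror, Or.inr ?_, ?_⟩, ?_⟩, ?_⟩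
    · rw [head?_mirror]
      simpa using ha
    · intro t ht y h1 h2
      rw [getLast?_mirror] at ht
      rw [mem_mirror]
      exact hh _ ht _ (by omega) (by omega)
    · dsimp only
      rw [head?_mirror]
      intro h
      rw [Option.mem_def] at h ha
      rw [ha] at h
      have := Option.some.inj h
      omega
    · simp only [mirror_mirror, hinv]
  · rintro ⟨⟨m, Q⟩, ⟨⟨hR, hh, ht⟩, hne⟩, he⟩
    obtain ⟨rfl, rfl⟩ := Prod.mk.inj he
    dsimp only at hR ht hh hne
    refine ⟨hR.mirror, ?_, ?_, ?_⟩
    · rw [getLast?_mirror]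
      simpa using hh.resolve_left hne
    · rintro rfl
      exact hne (hh.elim id id)
    · intro u hu y h1 h2
      rw [head?_mirror] at hu
      rw [mem_mirror]
      exact ht _ hu _ (by omega) (by omega)

theorem ncard_tippedMirror (a b : ℤ) : (tippedMirror a b).ncard = (tippedRight a b).ncard := by
  rw [tippedMirror_eq]
  refine Set.ncard_image_of_injective _ ?_
  rintro ⟨l, P⟩ ⟨l', P'⟩ h
  obtain ⟨h1, h2⟩ := Prod.mk.inj h
  dsimp only at h1 h2
  have e1 := congrArg (mirror (a + b)) h1
  rw [mirror_mirror, mirror_mirror] at e1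
  subst e1
  congr 1
  ext l
  have := Set.ext_iff.1 h2 (mirror (a + b) l)
  simpa only [mem_mirror_image, mirror_mirror] using this

theorem eq_singleton_of_head?_of_getLast? {α : Type*} {l : List α} {x : α} (hl : l.Nodup)
    (h : x ∈ l.head?) (h' : x ∈ l.getLast?) : l = [x] := by
  match l with
  | [] => simp at h
  | [y] => simpa using h
  | y :: z :: l =>
    have e : y = x := by simpa using h
    subst e
    rw [List.getLast?_cons_cons] at h'
    exact absurd (List.mem_of_getLast? h') (List.nodup_cons.1 hl).1

/-- The joining step runs from `a` to `r + 1` or to `b`, and in both cases no step of the two halves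
crosses it. The run of the first half ends at `r`, where that of the second half continues, so the
joined list is good. -/
theorem append_mem_irreducibleOuter {a r b : ℤ} {l₁ l₂ : List ℤ} {P₁ P₂ : Set (List ℤ)}
    (har : a < r) (h₁ : (l₁, P₁) ∈ tippedMirror a r) (h₂ : (l₂, P₂) ∈ tipped (r + 1) b) :
    (l₁ ++ l₂, P₁ ∪ P₂) ∈ irreducibleOuter a b := by
  obtain ⟨hR₁, ha, -, hh₁⟩ := h₁
  obtain ⟨hR₂, hh₂, ht₂⟩ := h₂
  dsimp only at hR₁ hR₂ ha hh₁ hh₂ ht₂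
  have hrb : r < b := (hR₂.bounds hR₂.right).1
  have hb1 : ∀ k ∈ insert l₁ P₁, ∀ x ∈ k, a ≤ x ∧ x ≤ r := fun k hk x hx => hR₁.bounds' hk hx
  have hb2 : ∀ k ∈ insert l₂ P₂, ∀ x ∈ k, r + 1 ≤ x ∧ x ≤ b :=
    fun k hk x hx => hR₂.bounds' hk hx
  have hsep : ∀ k ∈ insert l₁ P₁, k ∉ insert l₂ P₂ := by
    intro k hk hk'
    obtain ⟨x, hx⟩ := List.exists_mem_of_ne_nil k (hR₁.sys.ne_nil k hk)
    have := hb1 k hk x hx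
    have := hb2 k hk' x hx
    omega
  have hset : insert l₁ P₁ ∪ insert l₂ P₂ = insert l₁ (insert l₂ (P₁ ∪ P₂)) := by
    rw [Set.insert_union, Set.union_insert]
  have hs : IsSystem (insert l₁ (insert l₂ (P₁ ∪ P₂))) := by
    rw [← hset]
    exact hR₁.sys.union hR₂.sys (m := r + 1) (fun k hk x hx => by
      have := hb1 k hk x hx; omega) fun k hk x hx => (hb2 k hk x hx).1
  have hne₁ := hR₁.sys.ne_nil l₁ (Set.mem_insert _ _)
  have hne₂ := hR₂.sys.ne_nil l₂ (Set.mem_insert _ _)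
  have hl₁ : l₁ ∉ P₁ ∪ P₂ := by
    rintro (h | h)
    · exact hR₁.notMem h
    · exact hsep _ (Set.mem_insert _ _) (Set.mem_insert_of_mem _ h)
  have hl₂ : l₂ ∉ P₁ ∪ P₂ := by
    rintro (h | h)
    · exact hsep _ (Set.mem_insert_of_mem _ h) (Set.mem_insert _ _)
    · exact hR₂.notMem h
  have hne : l₁ ≠ l₂ := fun e => hsep _ (Set.mem_insert _ _) (e ▸ Set.mem_insert _ _)
  have hhead : ∀ x, x ∈ (l₁ ++ l₂).head? ↔ x ∈ l₁.head? := by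
    intro x
    rw [List.head?_append_of_ne_nil _ hne₁]
  have hlast : ∀ x, x ∈ (l₁ ++ l₂).getLast? ↔ x ∈ l₂.getLast? := by
    intro x
    rw [List.getLast?_append_of_ne_nil _ hne₂]
  refine ⟨⟨⟨?_, ?_, ?_, ?_, ?_, ?_⟩, ?_⟩, ?_⟩
  · rintro (h | h)
    · have := hb1 _ (Set.mem_insert_of_mem _ h) (b) (List.mem_append_right _ hR₂.right)
      omega
    · have := hb2 _ (Set.mem_insert_of_mem _ h) a (List.mem_append_left _ hR₁.left)
      omega
  · refine hs.join hne hl₁ hl₂ ?_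
    intro u hu v hv k hk x y hxy h1 h2 h3
    rw [Option.mem_def] at hu ha hv
    rw [hu, Option.some.injEq] at ha
    subst ha
    rw [← hset] at hk
    have hv' : v = r + 1 ∨ v = b := by simpa [hv] using hh₂
    rcases hk with hk | hk
    · have hx := hb1 k hk x hxy.mem_left
      have hy := hb1 k hk y hxy.mem_right
      omega
    · have hx := hb2 k hk x hxy.mem_left
      have hy := hb2 k hk y hxy.mem_right
      omega
  · rw [Covers.insert_iff]
    intro x
    have h1 := Covers.insert_iff.1 hR₁.cov x
    have h2 := Covers.insert_iff.1 hR₂.cov x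
    rw [Set.mem_Ico] at h1 h2 ⊢
    have h3 : (x ∈ l₁ ++ l₂ ∨ ∃ k ∈ P₁ ∪ P₂, x ∈ k) ↔
        (x ∈ l₁ ∨ ∃ k ∈ P₁, x ∈ k) ∨ (x ∈ l₂ ∨ ∃ k ∈ P₂, x ∈ k) := by
      simp only [List.mem_append, Set.mem_union, or_and_right, exists_or]
      exact or_or_or_comm
    rw [h3, h1, h2]
    omega
  · rintro k (hk | hk)
    exacts [hR₁.good k hk, hR₂.good k hk]
  · exact List.mem_append_left _ hR₁.left
  · exact List.mem_append_right _ hR₂.right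
  · intro h hh t ht
    rw [hhead] at hh
    rw [hlast] at ht
    have e1 := hR₁.bounds (List.mem_of_head? hh)
    have e2 := hR₂.bounds (List.mem_of_getLast? ht)
    refine ⟨by omega, fun y hy1 hy2 => ?_⟩
    by_cases hy : y ≤ r
    · exact List.mem_append_left _ (hh₁ h hh y hy1 hy)
    · exact List.mem_append_right _ (ht₂ t ht y (by omega) hy2)
  · dsimp only
    rw [hhead]
    intro h
    have := eq_singleton_of_head?_of_getLast? (hR₁.sys.nodup _ (Set.mem_insert _ _)) h ha
    have hr := hR₁.right
    rw [this, List.mem_singleton] at hr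
    omega

/-- The point `a` marks the cut: it ends the first list and does not occur in the second. The
maximum of the first list is then `r`. -/
theorem append_inj_of_tippedMirror {a r r' b : ℤ} {l₁ l₂ l₁' l₂' : List ℤ}
    {P₁ P₂ P₁' P₂' : Set (List ℤ)} (har : a < r) (har' : a < r')
    (h₁ : (l₁, P₁) ∈ tippedMirror a r) (h₂ : (l₂, P₂) ∈ tipped (r + 1) b)
    (h₁' : (l₁', P₁') ∈ tippedMirror a r') (h₂' : (l₂', P₂') ∈ tipped (r' + 1) b)
    (hl : l₁ ++ l₂ = l₁' ++ l₂') (hP : P₁ ∪ P₂ = P₁' ∪ P₂') :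
    r = r' ∧ l₁ = l₁' ∧ P₁ = P₁' ∧ l₂ = l₂' ∧ P₂ = P₂' := by
  obtain ⟨hR₁, ha₁, -⟩ := h₁
  obtain ⟨hR₁', ha₁', -⟩ := h₁'
  have hR₂ := h₂.1
  have hR₂' := h₂'.1
  dsimp only at hR₁ hR₂ hR₁' hR₂' ha₁ ha₁'
  have key : ∀ c : List ℤ, a ∉ c → c ≠ [] → ∀ l, a ∉ (l ++ c).getLast? := by
    intro c hc hne l hl
    rw [List.getLast?_append_of_ne_nil _ hne] at hl
    exact hc (List.mem_of_getLast? hl)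
  have ha₂ : a ∉ l₂ := fun h => by have := (hR₂.bounds h).1; omega
  have ha₂' : a ∉ l₂' := fun h => by have := (hR₂'.bounds h).1; omega
  have hll : l₁ = l₁' ∧ l₂ = l₂' := by
    rcases List.append_eq_append_iff.1 hl with ⟨c, hc1, hc2⟩ | ⟨c, hc1, hc2⟩
    · have hc : c = [] := by
        by_contra hne
        refine key c (fun h => ha₂ ?_) hne l₁ (hc1 ▸ ha₁')
        rw [hc2]
        exact List.mem_append_left _ h
      subst hc
      simp at hc1 hc2
      exact ⟨hc1.symm, hc2⟩
    · have hc : c = [] := by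
        by_contra hne
        refine key c (fun h => ha₂' ?_) hne l₁' (hc1 ▸ ha₁)
        rw [hc2]
        exact List.mem_append_left _ h
      subst hc
      simp at hc1 hc2
      exact ⟨hc1, hc2.symm⟩
  obtain ⟨rfl, rfl⟩ := hll
  have h1 := hR₁.right_le hR₁'
  have h2 := hR₁'.right_le hR₁
  have : r = r' := by omega
  subst this
  obtain ⟨rfl, rfl⟩ := union_inj_of_separated (c := r + 1)
    (fun k hk => hR₁.exists_mem (Set.mem_insert_of_mem _ hk))
    (fun k hk => hR₁'.exists_mem (Set.mem_insert_of_mem _ hk))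
    (fun k hk x hx => (hR₂.bounds' (Set.mem_insert_of_mem _ hk) hx).1)
    (fun k hk x hx => (hR₂'.bounds' (Set.mem_insert_of_mem _ hk) hx).1) hP
  exact ⟨rfl, rfl, rfl, rfl, rfl⟩

/-- Cut the list behind `a`. The crux is `hlt`: all points before the cut have smaller numbers than
all points behind it. Then `r` is the maximum of the first half, the good run splits at `r`, and the
other lists lie on either side of it. -/
theorem exists_append_of_mem_irreducibleOuter {a b : ℤ} {l : List ℤ} {P : Set (List ℤ)}
    (h : (l, P) ∈ irreducibleOuter a b) : ∃ r l₁ l₂ P₁ P₂, a < r ∧ r < b ∧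
      (l₁, P₁) ∈ tippedMirror a r ∧ (l₂, P₂) ∈ tipped (r + 1) b ∧ l = l₁ ++ l₂ ∧ P = P₁ ∪ P₂ := by
  obtain ⟨⟨hR, hg⟩, hah⟩ := h
  dsimp only at hR hg hah
  have hn := hR.sys.nodup _ (Set.mem_insert _ _)
  have hU := hR.sys.uncrossed _ (Set.mem_insert _ _) _ (Set.mem_insert _ _)
  obtain ⟨l₁, l₂, rfl, ha₁⟩ : ∃ l₁ l₂, l = l₁ ++ l₂ ∧ a ∈ l₁.getLast? := by
    obtain ⟨A, B, rfl⟩ := List.append_of_mem hR.left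
    exact ⟨A ++ [a], B, by simp, by simp⟩
  have hal : a ∈ l₁ := List.mem_of_getLast? ha₁
  have hne₁ : l₁ ≠ [] := List.ne_nil_of_mem hal
  obtain ⟨h, hh₁⟩ : ∃ h, h ∈ l₁.head? := ⟨_, List.head?_eq_some_head hne₁⟩
  have hh : h ∈ (l₁ ++ l₂).head? := by rwa [List.head?_append_of_ne_nil _ hne₁]
  have hhl : h ∈ l₁ := List.mem_of_head? hh₁
  have hbd := fun x (hx : x ∈ l₁ ++ l₂) => hR.bounds hx
  have hah' : a < h := lt_of_le_of_ne (hbd h (List.mem_append_left _ hhl)).1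
    fun e => hah (e ▸ hh)
  -- A list ending at `a` and starting at a larger `h` is not good.
  have hne₂ : l₂ ≠ [] := by
    rintro rfl
    have := (hg h hh a (by simpa using ha₁)).1
    omega
  obtain ⟨t, ht₂⟩ : ∃ t, t ∈ l₂.getLast? := ⟨_, List.getLast?_eq_some_getLast hne₂⟩
  have ht : t ∈ (l₁ ++ l₂).getLast? := by rwa [List.getLast?_append_of_ne_nil _ hne₂]
  have htl : t ∈ l₂ := List.mem_of_getLast? ht₂
  obtain ⟨hht, hrun⟩ := hg h hh t ht
  have hcut := hR.sys.cut hR.notMem hne₁ hne₂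
  have hdis : ∀ x ∈ l₁, x ∉ l₂ := fun x hx hx' => (List.nodup_append.1 hn).2.2 x hx x hx' rfl
  have hne : l₁ ≠ l₂ := fun e => hdis a hal (e ▸ hal)
  have hlt : ∀ x ∈ l₁, ∀ y ∈ l₂, x < y := by
    intro x hx y hy
    by_contra! hyx
    have hxy : x ≠ y := fun e => hdis x hx (e ▸ hy)
    have hay : a ≠ y := fun e => hdis a hal (e ▸ hy)
    have hxt : x ≠ t := fun e => hdis x hx (e ▸ htl)
    have hht' : h ≠ t := fun e => hdis h hhl (e ▸ htl)
    have := hbd y (List.mem_append_right _ hy)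
    rcases lt_or_ge x t with h1 | h1
    -- Here `a < y < x < t`, with `a` and `x` before the cut and `y` and `t` behind it.
    · exact hcut.no_alternation (Set.mem_insert _ _)
        (Set.mem_insert_of_mem _ (Set.mem_insert _ _)) hne hal hy hx htl
        (by omega) (by omega) h1
    -- Now `t < x`. Cutting behind `x` instead puts `h` and `x` into one piece and `a` and `t` into
    -- the other, and `a < h < t < x` alternates.
    · obtain ⟨A, B, rfl⟩ := List.append_of_mem hx
      have haB : a ∈ B := by
        have h2 : a ∈ x :: B := by
          rw [List.getLast?_append_of_ne_nil _ (by simp)] at ha₁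
          exact List.mem_of_getLast? ha₁
        exact (List.mem_cons.1 h2).resolve_left (by omega)
      have e : (A ++ x :: B) ++ l₂ = (A ++ [x]) ++ (B ++ l₂) := by simp
      have hN := hR.notMem
      have hS := hR.sys
      rw [e] at hN hS hn
      have hcut' := hS.cut hN (by simp) (by simp [hne₂])
      have hhA : h ∈ A ++ [x] := by
        cases A with
        | nil => simpa using hh₁.symm
        | cons c A =>
          have : c = h := by simpa using hh₁
          simp [this]
      have haA : a ∈ B ++ l₂ := List.mem_append_left _ haB
      refine hcut'.no_alternation (Set.mem_insert_of_mem _ (Set.mem_insert _ _))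
        (Set.mem_insert _ _) ?_ haA hhA (List.mem_append_right B htl)
        (List.mem_append_right A (List.mem_singleton_self x)) (by omega) (by omega) (by omega)
      intro e'
      exact (List.nodup_append.1 hn).2.2 h hhA h (e' ▸ hhA) rfl
  obtain ⟨r, hr, hmax⟩ := exists_max_of_ne_nil hne₁
  have hhr := hmax h hhl
  have hrt := hlt r hr t htl
  have hr1 : r + 1 ∈ l₂ := by
    have := hrun (r + 1) (by omega) (by omega)
    rcases List.mem_append.1 this with h1 | h1
    · have := hmax _ h1; omega
    · exact h1
  have htb := (hbd t (List.mem_append_right _ htl)).2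
  have hbl : b ∈ l₂ := by
    rcases List.mem_append.1 hR.right with h1 | h1
    · have := hmax _ h1; omega
    · exact h1
  have hside : ∀ k ∈ P, (∀ x ∈ k, x < r + 1) ∨ ∀ x ∈ k, r + 1 ≤ x := by
    intro k hk
    rcases hR.sys.side (Set.mem_insert _ _) (Set.mem_insert_of_mem _ hk)
      (fun h => hR.notMem (h ▸ hk)) (r := r) hR.left (List.mem_append_left _ hr)
      (fun x hx => (hR.bounds' (Set.mem_insert_of_mem _ hk) hx).1) with h | h
    · exact Or.inl fun x hx => by have := h x hx; omega
    · exact Or.inr fun x hx => by have := h x hx; omega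
  have hcov : ∀ x, a ≤ x → x < b + 1 → x ∈ l₁ ∨ x ∈ l₂ ∨ ∃ k ∈ P, x ∈ k := by
    intro x h1 h2
    have := (Covers.insert_iff.1 hR.cov x).2 ⟨h1, h2⟩
    rwa [List.mem_append, or_assoc] at this
  refine ⟨r, l₁, l₂, {k ∈ P | ∀ x ∈ k, x < r + 1}, {k ∈ P | ∀ x ∈ k, r + 1 ≤ x}, by omega,
    by omega, ⟨⟨?_, ?_, ?_, ?_, hal, hr⟩, ha₁, by omega, ?_⟩,
    ⟨⟨?_, ?_, ?_, ?_, hr1, hbl⟩, ?_, ?_⟩, rfl, ?_⟩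
  · exact fun h => hR.disjoint h.1 hal (List.mem_append_left _ hal)
  · refine hcut.mono ?_
    rintro k (rfl | hk)
    · exact Set.mem_insert _ _
    · exact Set.mem_insert_of_mem _ (Set.mem_insert_of_mem _ hk.1)
  · rw [Covers.insert_iff]
    intro x
    rw [Set.mem_Ico]
    dsimp only
    constructor
    · rintro (h | ⟨k, hk, h⟩)
      · have := hbd x (List.mem_append_left _ h)
        have := hmax x h
        omega
      · have := hk.2 x h
        have := hR.bounds' (Set.mem_insert_of_mem _ hk.1) h
        omega
    · rintro ⟨h1, h2⟩
      rcases hcov x h1 (by omega) with h | h | ⟨k, hk, h⟩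
      · exact Or.inl h
      · have := hlt r hr x h; omega
      · refine Or.inr ⟨k, ⟨hk, (hside k hk).resolve_right fun h' => ?_⟩, h⟩
        have := h' x h
        omega
  · exact fun k hk => hR.good k hk.1
  · intro u hu y h1 h2
    dsimp only at hu ⊢
    rw [Option.mem_def] at hu hh₁
    have e : u = h := Option.some.inj (hu.symm.trans hh₁)
    subst e
    rcases List.mem_append.1 (hrun y h1 (by omega)) with h3 | h3
    · exact h3
    · have := hlt r hr y h3; omega
  · exact fun h => hR.disjoint h.1 hbl (List.mem_append_right _ hbl)
  · refine hcut.mono ?_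
    rintro k (rfl | hk)
    · exact Set.mem_insert_of_mem _ (Set.mem_insert _ _)
    · exact Set.mem_insert_of_mem _ (Set.mem_insert_of_mem _ hk.1)
  · rw [Covers.insert_iff]
    intro x
    rw [Set.mem_Ico]
    dsimp only
    constructor
    · rintro (h | ⟨k, hk, h⟩)
      · have := hbd x (List.mem_append_right _ h)
        have := hlt r hr x h
        omega
      · have := hk.2 x h
        have := hR.bounds' (Set.mem_insert_of_mem _ hk.1) h
        omega
    · rintro ⟨h1, h2⟩
      rcases hcov x (by omega) (by omega) with h | h | ⟨k, hk, h⟩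
      · have := hmax x h; omega
      · exact Or.inl h
      · refine Or.inr ⟨k, ⟨hk, (hside k hk).resolve_left fun h' => ?_⟩, h⟩
        have := h' x h
        omega
  · exact fun k hk => hR.good k hk.1
  · dsimp only
    cases l₂ with
    | nil => contradiction
    | cons y s =>
      have := eq_or_eq_of_extreme (l := l₁ ++ y :: s) (r := s) (x := a) (y := y)
        (c := r + 1) (d := b) hU (by simp [linked_append, Option.mem_def.1 ha₁])
        (fun u v h => ?_) (List.nodup_cons.1 (List.nodup_append.1 hn).2.1).1
        (Or.inl fun z hz => hlt a hal z hz) hr1 hbl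
        (fun z hz => ⟨hlt r hr z hz, (hbd z (List.mem_append_right _ hz)).2⟩)
      · simpa using this
      · have : Linked ((l₁ ++ [y]) ++ s) u v := linked_append.2 (Or.inr (Or.inl h))
        simpa using this
  · intro u hu y h1 h2
    dsimp only at hu ⊢
    rw [Option.mem_def] at hu ht₂
    have e : u = t := Option.some.inj (hu.symm.trans ht₂)
    subst e
    rcases List.mem_append.1 (hrun y (by omega) h2) with h3 | h3
    · have := hmax y h3; omega
    · exact h3
  · ext k
    constructor
    · intro hk
      exact (hside k hk).imp (fun h => ⟨hk, h⟩) fun h => ⟨hk, h⟩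
    · rintro (h | h) <;> exact h.1

/-- Cutting the distinguished list behind the left end. -/
theorem ncard_irreducibleOuter (a : ℤ) (n : ℕ)
    (hR : ∀ m < n, (tippedRight a (a + m)).Finite)
    (hT : ∀ m, 1 ≤ m → m < n → (tipped (a + m + 1) (a + n)).Finite) :
    (irreducibleOuter a (a + n)).Finite ∧ (irreducibleOuter a (a + n)).ncard =
      ∑ m ∈ Finset.Ico 1 n,
        (tippedRight a (a + m)).ncard * (tipped (a + m + 1) (a + n)).ncard := by
  have := ncard_eq_sum (X := irreducibleOuter a (a + n)) (I := Finset.Ico 1 n)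
    (A := fun m => tippedMirror a (a + m) ×ˢ tipped (a + m + 1) (a + n))
    (fun _ x => (x.1.1 ++ x.2.1, x.1.2 ∪ x.2.2)) ?_ ?_ ?_ ?_
  · simpa only [Set.ncard_prod, ncard_tippedMirror] using this
  · intro m hm
    have hm := Finset.mem_Ico.1 hm
    refine Set.Finite.prod ?_ (hT m hm.1 hm.2)
    rw [tippedMirror_eq]
    exact (hR m hm.2).image _
  · rintro m hm ⟨⟨l₁, P₁⟩, l₂, P₂⟩ ⟨h₁, h₂⟩
    have hm := Finset.mem_Ico.1 hm
    exact append_mem_irreducibleOuter (by omega) h₁ h₂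
  · rintro m hm ⟨⟨l₁, P₁⟩, l₂, P₂⟩ ⟨h₁, h₂⟩ m' hm' ⟨⟨l₁', P₁'⟩, l₂', P₂'⟩ ⟨h₁', h₂'⟩ h
    have hm := Finset.mem_Ico.1 hm
    have hm' := Finset.mem_Ico.1 hm'
    obtain ⟨hl, hP⟩ := Prod.mk.inj h
    obtain ⟨e, rfl, rfl, rfl, rfl⟩ := append_inj_of_tippedMirror (by omega) (by omega)
      h₁ h₂ h₁' h₂' hl hP
    exact ⟨by omega, rfl⟩
  · rintro ⟨l, P⟩ h
    obtain ⟨r, l₁, l₂, P₁, P₂, har, hrn, h₁, h₂, rfl, rfl⟩ :=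
      exists_append_of_mem_irreducibleOuter h
    obtain ⟨m, rfl⟩ : ∃ m : ℕ, r = a + m := ⟨(r - a).toNat, by omega⟩
    exact ⟨m, Finset.mem_Ico.2 ⟨by omega, by omega⟩, ((l₁, P₁), l₂, P₂), ⟨h₁, h₂⟩, rfl⟩

end PathSystem

/-! ### Counting sequences and their recursions -/

namespace PathSystem

/-- Ordered systems live on a half-open interval, the other three kinds on a closed one: index `n`
means `n` points here and `n + 1` points in the three counts below. -/
noncomputable def orderedCount (n : ℕ) : ℕ := (ordered 0 n).ncard

noncomputable def tippedCount (n : ℕ) : ℕ := (tipped 0 n).ncard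

noncomputable def tippedRightCount (n : ℕ) : ℕ := (tippedRight 0 n).ncard

noncomputable def irreducibleCount (n : ℕ) : ℕ := (irreducible 0 n).ncard

theorem ncard_tipped {a b : ℤ} (hL : (tippedLeft a b).Finite) (hR : (tippedRight a b).Finite) :
    (tipped a b).Finite ∧
      (tipped a b).ncard = (tippedLeft a b).ncard + (tippedRight a b).ncard := by
  have h : tipped a b = tippedLeft a b ∪ tippedRight a b := by
    ext x
    simp only [tippedLeft, tippedRight, Set.mem_union, Set.mem_ofPred_eq]
    tauto
  rw [h]
  refine ⟨hL.union hR, Set.ncard_union_eq ?_ hL hR⟩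
  rw [Set.disjoint_left]
  exact fun x hx hx' => hx'.2 hx.2

theorem ncard_irreducible {a b : ℤ} (hL : (tippedLeft a b).Finite)
    (hR : (irreducibleOuter a b).Finite) : (irreducible a b).Finite ∧
      (irreducible a b).ncard = (tippedLeft a b).ncard + (irreducibleOuter a b).ncard := by
  have h : irreducible a b = tippedLeft a b ∪ irreducibleOuter a b := by
    rw [← irreducible_left]
    ext x
    simp only [irreducibleOuter, Set.mem_union, Set.mem_ofPred_eq]
    tauto
  rw [h]
  refine ⟨hL.union hR, Set.ncard_union_eq ?_ hL hR⟩
  rw [Set.disjoint_left, ← irreducible_left]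
  exact fun x hx hx' => hx'.2 hx.2

/-- Finiteness of the sets of systems on intervals of length `n`, and the fact that their sizes
depend on the length only. -/
def TranslationInvariant (n : ℕ) : Prop :=
  ∀ a : ℤ, ((ordered a (a + n)).Finite ∧ (ordered a (a + n)).ncard = orderedCount n) ∧
    ((tipped a (a + n)).Finite ∧ (tipped a (a + n)).ncard = tippedCount n) ∧
    ((tippedRight a (a + n)).Finite ∧ (tippedRight a (a + n)).ncard = tippedRightCount n) ∧
    ((irreducible a (a + n)).Finite ∧ (irreducible a (a + n)).ncard = irreducibleCount n)

theorem translationInvariant_zero : TranslationInvariant 0 := by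
  intro a
  have hL : (tippedLeft a a).Finite := by rw [tippedLeft_self]; exact Set.finite_singleton _
  have hI : ∀ a, irreducible a a = {([a], ∅)} := by
    intro a
    ext ⟨l, P⟩
    simp only [irreducible, Set.mem_ofPred_eq, Set.mem_singleton_iff, Prod.mk.injEq]
    constructor
    · rintro ⟨h, -⟩
      exact h.eq_singleton
    · rintro ⟨rfl, rfl⟩
      refine ⟨isRooted_singleton a, ?_⟩
      intro h hh t ht
      simp only [List.head?_cons, List.getLast?_singleton, Option.mem_def,
        Option.some.injEq] at hh ht
      subst hh; subst ht
      refine ⟨le_rfl, fun x h1 h2 => ?_⟩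
      simp; omega
  simp [orderedCount, tippedCount, tippedRightCount, irreducibleCount, ordered_self, tipped_self,
    tippedRight_self, hI]

/-- The right-hand sides do not involve `a`. This yields translation invariance in the next length
by induction, without any translation bijection. -/
theorem count_recursion {n : ℕ} (h : ∀ m ≤ n, TranslationInvariant m) (a : ℤ) :
    ((tippedRight a (a + n + 1)).Finite ∧ (tippedRight a (a + n + 1)).ncard =
      ∑ m ∈ Finset.range (n + 1), tippedCount m * orderedCount (n - m)) ∧
    ((tipped a (a + n + 1)).Finite ∧ (tipped a (a + n + 1)).ncard =
      tippedCount n + ∑ m ∈ Finset.range (n + 1), tippedCount m * orderedCount (n - m)) ∧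
    ((irreducible a (a + n + 1)).Finite ∧ (irreducible a (a + n + 1)).ncard =
      tippedCount n + ∑ m ∈ Finset.Ico 1 (n + 1), tippedRightCount m * tippedCount (n - m)) ∧
    ((ordered a (a + n + 1)).Finite ∧ (ordered a (a + n + 1)).ncard =
      ∑ m ∈ Finset.range (n + 1), irreducibleCount m * orderedCount (n - m)) := by
  have e : ∀ m ≤ n, a + n + 1 = (a + m + 1) + ((n - m : ℕ) : ℤ) := by
    intro m hm
    push_cast [hm]
    ring
  have hO : ∀ m ≤ n, (ordered (a + m + 1) (a + n + 1)).Finite ∧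
      (ordered (a + m + 1) (a + n + 1)).ncard = orderedCount (n - m) := by
    intro m hm
    rw [e m hm]
    exact (h (n - m) (Nat.sub_le _ _) _).1
  have hT : ∀ m ≤ n, (tipped (a + m + 1) (a + n + 1)).Finite ∧
      (tipped (a + m + 1) (a + n + 1)).ncard = tippedCount (n - m) := by
    intro m hm
    rw [e m hm]
    exact (h (n - m) (Nat.sub_le _ _) _).2.1
  have h1 := ncard_tippedRight a n (fun m hm => (h m hm a).2.1.1) fun m hm => (hO m hm).1
  have hT1 := hT 0 (Nat.zero_le _)
  simp only [Nat.cast_zero, add_zero, Nat.sub_zero] at hT1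
  have h2 := ncard_tippedLeft (a := a) (b := a + n + 1) (by omega) hT1.1
  have h3 := ncard_tipped h2.1 h1.1
  have h4 := ncard_irreducibleOuter a (n + 1) (fun m hm => (h m (by omega) a).2.2.1.1) (by
    intro m hm hm'
    have := (hT m (by omega)).1
    push_cast
    rwa [← add_assoc])
  push_cast at h4
  rw [← add_assoc] at h4
  have h5 := ncard_irreducible h2.1 h4.1
  have h6 := ncard_ordered a n (fun m hm => (h m hm a).2.2.2.1) fun m hm => (hO m hm).1
  have e1 : ∀ m ∈ Finset.range (n + 1), (tipped a (a + m)).ncard *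
      (ordered (a + m + 1) (a + n + 1)).ncard = tippedCount m * orderedCount (n - m) := by
    intro m hm
    have hm : m ≤ n := by simpa [Nat.lt_succ_iff] using hm
    rw [(hO m hm).2, (h m hm a).2.1.2]
  have e2 : ∀ m ∈ Finset.range (n + 1), (irreducible a (a + m)).ncard *
      (ordered (a + m + 1) (a + n + 1)).ncard = irreducibleCount m * orderedCount (n - m) := by
    intro m hm
    have hm : m ≤ n := by simpa [Nat.lt_succ_iff] using hm
    rw [(hO m hm).2, (h m hm a).2.2.2.2]
  have e3 : ∀ m ∈ Finset.Ico 1 (n + 1), (tippedRight a (a + m)).ncard *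
      (tipped (a + m + 1) (a + n + 1)).ncard = tippedRightCount m * tippedCount (n - m) := by
    intro m hm
    have hm : m ≤ n := by have := (Finset.mem_Ico.1 hm).2; omega
    rw [(hT m hm).2, (h m hm a).2.2.1.2]
  rw [Finset.sum_congr rfl e1] at h1
  rw [Finset.sum_congr rfl e2] at h6
  rw [Finset.sum_congr rfl e3] at h4
  rw [h2.2, hT1.2] at h3 h5
  rw [h1.2] at h3
  rw [h4.2] at h5
  exact ⟨h1, h3, h5, h6⟩

theorem translationInvariant (n : ℕ) : TranslationInvariant n := by
  induction n using Nat.strong_induction_on with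
  | _ n ih =>
    cases n with
    | zero => exact translationInvariant_zero
    | succ n =>
      intro a
      have h := count_recursion (n := n) (fun m hm => ih m (by omega))
      have ha := h a
      have h0 := h 0
      rw [zero_add] at h0
      rw [orderedCount, tippedCount, tippedRightCount, irreducibleCount]
      push_cast
      rw [← add_assoc]
      refine ⟨⟨ha.2.2.2.1, ?_⟩, ⟨ha.2.1.1, ?_⟩, ⟨ha.1.1, ?_⟩, ⟨ha.2.2.1.1, ?_⟩⟩
      · rw [ha.2.2.2.2, h0.2.2.2.2]
      · rw [ha.2.1.2, h0.2.1.2]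
      · rw [ha.1.2, h0.1.2]
      · rw [ha.2.2.1.2, h0.2.2.1.2]

theorem orderedCount_zero : orderedCount 0 = 1 := by
  simp [orderedCount, ordered_self]

theorem tippedCount_zero : tippedCount 0 = 1 := by
  simp [tippedCount, tipped_self]

theorem tippedRightCount_zero : tippedRightCount 0 = 0 := by
  simp [tippedRightCount, tippedRight_self]

theorem irreducibleCount_zero : irreducibleCount 0 = 1 := by
  have h := ncard_irreducible (a := 0) (b := 0) (by rw [tippedLeft_self]; exact Set.finite_singleton _)
    (ncard_irreducibleOuter 0 0 (by simp) (by simp)).1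
  have h' := (ncard_irreducibleOuter 0 0 (by simp) (by simp)).2
  simp only [Nat.cast_zero, add_zero] at h h'
  rw [irreducibleCount, Nat.cast_zero, h.2, h', tippedLeft_self]
  simp

theorem tippedRightCount_succ (n : ℕ) : tippedRightCount (n + 1) =
    ∑ m ∈ Finset.range (n + 1), tippedCount m * orderedCount (n - m) := by
  have := (count_recursion (n := n) (fun m _ => translationInvariant m) 0).1.2
  rw [zero_add] at this
  rw [tippedRightCount, ← this]
  push_cast
  rfl

theorem tippedCount_succ (n : ℕ) :
    tippedCount (n + 1) = tippedCount n + tippedRightCount (n + 1) := by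
  have := (count_recursion (n := n) (fun m _ => translationInvariant m) 0).2.1.2
  rw [zero_add] at this
  rw [tippedRightCount_succ, ← this, tippedCount]
  push_cast
  rfl

theorem irreducibleCount_succ (n : ℕ) : irreducibleCount (n + 1) =
    tippedCount n + ∑ m ∈ Finset.range (n + 1), tippedRightCount m * tippedCount (n - m) := by
  have := (count_recursion (n := n) (fun m _ => translationInvariant m) 0).2.2.1.2
  rw [zero_add] at this
  -- The summand at `0` vanishes, so the sum from `1` may be written as a full convolution.
  rw [Finset.range_eq_Ico, Finset.sum_eq_sum_Ico_succ_bot (by omega), tippedRightCount_zero,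
    zero_mul, zero_add, zero_add, ← this, irreducibleCount]
  push_cast
  rfl

theorem orderedCount_succ (n : ℕ) : orderedCount (n + 1) =
    ∑ m ∈ Finset.range (n + 1), irreducibleCount m * orderedCount (n - m) := by
  have := (count_recursion (n := n) (fun m _ => translationInvariant m) 0).2.2.2.2
  rw [zero_add] at this
  rw [← this, orderedCount]
  push_cast
  rfl

end PathSystem

/-! ### Graphs on `Fin n` versus systems of lists -/

namespace PathSystem

section Walks

variable {V : Type*} {G : SimpleGraph V}

theorem linked_support_iff {u v : V} (w : G.Walk u v) (x y : V) :
    Linked w.support x y ↔ s(x, y) ∈ w.edges := by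
  induction w with
  | nil => simp
  | @cons u c v h w ih =>
    cases w with
    | nil => simp
    | cons h' w =>
      simp only [SimpleGraph.Walk.support_cons, SimpleGraph.Walk.edges_cons, linked_cons_cons,
        List.mem_cons, Sym2.eq_iff] at ih ⊢
      rw [ih]
      tauto

theorem exists_walk_support {l : List V} (hl : l ≠ []) (h : ∀ x y, Linked l x y → G.Adj x y) :
    ∃ (u v : V) (w : G.Walk u v), w.support = l := by
  induction l with
  | nil => contradiction
  | cons a l ih =>
    cases l with
    | nil => exact ⟨a, a, .nil, rfl⟩
    | cons b l =>
      obtain ⟨u, v, w, hw⟩ := ih (by simp) fun x y hxy => h x y (by simp [hxy])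
      have hu : u = b := by
        have := w.cons_tail_support
        rw [hw] at this
        exact (List.cons.inj this).1
      subst hu
      exact ⟨a, v, .cons (h a u (by simp)) w, by simp [hw]⟩

theorem head?_support {u v : V} (w : G.Walk u v) : w.support.head? = some u := by
  rw [← w.cons_tail_support, List.head?_cons]

theorem getLast?_support {u v : V} (w : G.Walk u v) : w.support.getLast? = some v := by
  rw [List.getLast?_eq_some_getLast w.support_ne_nil, SimpleGraph.Walk.getLast_support]

theorem isComponentPath_reverse {u v : V} {w : G.Walk u v} (h : IsComponentPath w) :
    IsComponentPath w.reverse := by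
  obtain ⟨h1, h2, h3⟩ := h
  refine ⟨h1.reverse, fun x hx => ?_, fun x y hx hxy => ?_⟩
  · rw [SimpleGraph.Walk.support_reverse, List.mem_reverse]
    exact h2 x (w.reachable.trans hx)
  · rw [SimpleGraph.Walk.support_reverse, List.mem_reverse] at hx
    rw [SimpleGraph.Walk.edges_reverse, List.mem_reverse]
    exact h3 x y hx hxy

/-- A component that is a path is traversed by that path in two ways only. -/
theorem _root_.IsComponentPath.support_eq {u v u' v' : V} {w : G.Walk u v} {w' : G.Walk u' v'}
    (h : IsComponentPath w) (h' : IsComponentPath w') {z : V} (hz : z ∈ w.support)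
    (hz' : z ∈ w'.support) : w'.support = w.support ∨ w'.support = w.support.reverse := by
  classical
  have huz : G.Reachable u z := ⟨w.takeUntil z hz⟩
  have huz' : G.Reachable u' z := ⟨w'.takeUntil z hz'⟩
  have hmem : ∀ x, x ∈ w.support ↔ x ∈ w'.support := fun x =>
    ⟨fun hx => h'.2.1 x (huz'.trans (huz.symm.trans ⟨w.takeUntil x hx⟩)),
      fun hx => h.2.1 x (huz.trans (huz'.symm.trans ⟨w'.takeUntil x hx⟩))⟩
  refine eq_or_eq_reverse_of_linked_iff h.1.support_nodup h'.1.support_nodup hmem fun x y => ?_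
  constructor
  · intro hl
    have hx := hl.mem_left
    rw [linked_support_iff] at hl ⊢
    exact h'.2.2 x y ((hmem x).1 hx) (w.adj_of_mem_edges hl)
  · intro hl
    have hx := hl.mem_left
    rw [linked_support_iff] at hl ⊢
    exact h.2.2 x y ((hmem x).2 hx) (w'.adj_of_mem_edges hl)

end Walks

/-- Goodness forces the first entry not to exceed the last, so both orientations are good only for a
list with at most one entry. -/
theorem eq_of_good_of_eq_reverse {l l' : List ℤ} (hl : l.Nodup) (hg : Good l) (hg' : Good l')
    (h : l' = l ∨ l' = l.reverse) : l' = l := by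
  rcases h with h | rfl
  · exact h
  cases l with
  | nil => rfl
  | cons a l =>
    obtain ⟨t, ht⟩ : ∃ t, t ∈ (a :: l).getLast? := ⟨_, List.getLast?_eq_some_getLast (by simp)⟩
    have h1 := (hg a (by simp) t ht).1
    have h2 := (hg' t (by rw [List.head?_reverse]; exact ht) a
      (by rw [List.getLast?_reverse]; simp)).1
    have : t = a := le_antisymm h2 h1
    subst this
    rw [eq_singleton_of_head?_of_getLast? hl (by simp) ht]
    rfl

variable {n : ℕ}

/-- The position of a point as an integer. -/
def toInt (i : Fin n) : ℤ := (i : ℕ)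

theorem toInt_injective : Function.Injective (toInt : Fin n → ℤ) := fun i j h => by
  simpa [toInt, Fin.ext_iff] using h

theorem toInt_lt {i j : Fin n} : toInt i < toInt j ↔ i < j := by simp [toInt]

theorem toInt_le {i j : Fin n} : toInt i ≤ toInt j ↔ i ≤ j := by simp [toInt]

theorem exists_toInt {x : ℤ} (h0 : 0 ≤ x) (hn : x < n) : ∃ i : Fin n, toInt i = x :=
  ⟨⟨x.toNat, by omega⟩, by simp [toInt, h0]⟩

/-- The graph whose edges are the steps of the lists in `P`. -/
def toGraph (n : ℕ) (P : Set (List ℤ)) : SimpleGraph (Fin n) where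
  Adj i j := i ≠ j ∧ ∃ l ∈ P, Linked l (toInt i) (toInt j)
  symm := ⟨fun _ _ h => ⟨h.1.symm, by
    obtain ⟨l, hl, hxy⟩ := h.2
    exact ⟨l, hl, hxy.symm⟩⟩⟩
  loopless := ⟨fun _ h => h.1 rfl⟩

/-- The combinatorial form of an ordered non-crossing path partition. -/
def IsOrderedPartition (G : SimpleGraph (Fin n)) : Prop :=
  (∀ a b c d : Fin n, a < b → b < c → c < d → G.Adj a c → G.Adj b d → False) ∧
  (∀ x, ∃ (u v : Fin n) (w : G.Walk u v), IsComponentPath w ∧ x ∈ w.support) ∧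
  ∀ i j : Fin n, i < j → ArePathEnds G i j →
    ∀ k : Fin n, i < k → k < j → ¬ ∃ l : Fin n, ArePathEnds G k l

/-- The lists of vertices of the component paths of `G`. -/
def ofGraph (G : SimpleGraph (Fin n)) : Set (List ℤ) :=
  {l | ∃ (u v : Fin n) (w : G.Walk u v), IsComponentPath w ∧ u ≤ v ∧ l = w.support.map toInt}

theorem toGraph_adj {P : Set (List ℤ)} (hP : IsSystem P) {i j : Fin n} :
    (toGraph n P).Adj i j ↔ ∃ l ∈ P, Linked l (toInt i) (toInt j) := by
  constructor
  · exact fun h => h.2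
  · rintro ⟨l, hl, h⟩
    exact ⟨fun e => h.ne (hP.nodup l hl) (congrArg toInt e), l, hl, h⟩

/-- As the lists are disjoint, every edge at a vertex of `l` is a step of `l`. Hence `l` is closed
under adjacency and exhausts its component. -/
theorem exists_componentPath {P : Set (List ℤ)} (hP : P ∈ ordered 0 (n : ℤ)) {l : List ℤ}
    (hl : l ∈ P) : ∃ (u v : Fin n) (w : (toGraph n P).Walk u v),
      IsComponentPath w ∧ w.support.map toInt = l := by
  have hb : ∀ x ∈ l, ∃ i : Fin n, toInt i = x := fun x hx => by
    have := mem_ordered_bounds hP hl hx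
    exact exists_toInt this.1 this.2
  obtain ⟨l', rfl⟩ : ∃ l' : List (Fin n), l'.map toInt = l := by
    have : l ∈ Set.range (List.map (toInt : Fin n → ℤ)) := by
      rw [Set.range_list_map]
      exact hb
    exact this
  have hne : l' ≠ [] := by
    rintro rfl
    exact hP.1.ne_nil _ hl rfl
  obtain ⟨u, v, w, rfl⟩ := exists_walk_support (G := toGraph n P) hne (fun x y hxy =>
    (toGraph_adj hP.1).2 ⟨_, hl, (linked_map toInt_injective).2 hxy⟩)
  have hadj : ∀ x y, x ∈ w.support → (toGraph n P).Adj x y → Linked w.support x y := by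
    intro x y hx hxy
    obtain ⟨m, hm, hxy⟩ := (toGraph_adj hP.1).1 hxy
    have e := hP.1.eq_of_mem m hm _ hl (toInt x) hxy.mem_left (List.mem_map_of_mem hx)
    rw [e] at hxy
    exact (linked_map toInt_injective).1 hxy
  refine ⟨u, v, w, ⟨?_, ?_, ?_⟩, rfl⟩
  · rw [SimpleGraph.Walk.isPath_def]
    exact List.Nodup.of_map _ (hP.1.nodup _ hl)
  · rintro x ⟨w'⟩
    have key : ∀ {a b : Fin n} (w' : (toGraph n P).Walk a b), a ∈ w.support → b ∈ w.support := by
      intro a b w'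
      induction w' with
      | nil => exact id
      | cons h _ ih => exact fun ha => ih (hadj _ _ ha h).mem_right
    exact key w' w.start_mem_support
  · intro x y hx hxy
    rw [← linked_support_iff]
    exact hadj x y hx hxy

/-- For the order condition: goodness places `k` on the path with ends `i` and `j`, and a component
path has no further ends. -/
theorem isOrderedPartition_toGraph {P : Set (List ℤ)} (hP : P ∈ ordered 0 (n : ℤ)) :
    IsOrderedPartition (toGraph n P) := by
  refine ⟨?_, ?_, ?_⟩
  · intro a b c d hab hbc hcd hac hbd
    obtain ⟨l, hl, h⟩ := (toGraph_adj hP.1).1 hac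
    obtain ⟨l', hl', h'⟩ := (toGraph_adj hP.1).1 hbd
    exact hP.1.uncrossed l hl l' hl' _ _ _ _ h h' (toInt_lt.2 hab) (toInt_lt.2 hbc)
      (toInt_lt.2 hcd)
  · intro x
    obtain ⟨l, hl, hx⟩ := (hP.2.1 (toInt x)).2 ⟨by simp [toInt], by simp [toInt]⟩
    obtain ⟨u, v, w, hw, rfl⟩ := exists_componentPath hP hl
    exact ⟨u, v, w, hw, by simpa [toInt_injective.eq_iff] using hx⟩
  · rintro i j hij ⟨w, hw⟩ k hik hkj ⟨m, w', hw'⟩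
    obtain ⟨l, hl, hx⟩ := (hP.2.1 (toInt i)).2 ⟨by simp [toInt], by simp [toInt]⟩
    obtain ⟨u, v, w₀, hw₀, rfl⟩ := exists_componentPath hP hl
    have hi : i ∈ w₀.support := by simpa [toInt_injective.eq_iff] using hx
    have hg := hP.2.2 _ hl (toInt u) (by simp [head?_support]) (toInt v)
      (by simp [getLast?_support])
    have huv : i = u ∧ j = v := by
      rcases hw₀.support_eq hw hi w.start_mem_support with h | h
      · have h1 := congrArg List.head? h
        have h2 := congrArg List.getLast? h
        rw [head?_support, head?_support] at h1
        rw [getLast?_support, getLast?_support] at h2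
        exact ⟨Option.some.inj h1, Option.some.inj h2⟩
      · have h1 := congrArg List.head? h
        have h2 := congrArg List.getLast? h
        rw [List.head?_reverse, getLast?_support, head?_support] at h1
        rw [List.getLast?_reverse, head?_support, getLast?_support] at h2
        have h1 := Option.some.inj h1
        have h2 := Option.some.inj h2
        subst h1; subst h2
        exact absurd (toInt_le.1 hg.1) (not_le.2 hij)
    obtain ⟨rfl, rfl⟩ := huv
    have hk : k ∈ w₀.support := by
      have := hg.2 (toInt k) (toInt_le.2 hik.le) (toInt_le.2 hkj.le)
      simpa [toInt_injective.eq_iff] using this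
    rcases hw₀.support_eq hw' hk w'.start_mem_support with h | h
    · have h1 := congrArg List.head? h
      rw [head?_support, head?_support] at h1
      exact hik.ne' (Option.some.inj h1)
    · have h1 := congrArg List.head? h
      rw [List.head?_reverse, getLast?_support, head?_support] at h1
      exact hkj.ne (Option.some.inj h1)

/-- The graph determines each component path up to reversal, and goodness selects the orientation.
-/
theorem toGraph_injOn : Set.InjOn (toGraph n) (ordered 0 (n : ℤ)) := by
  have key : ∀ P ∈ ordered 0 (n : ℤ), ∀ P' ∈ ordered 0 (n : ℤ), toGraph n P = toGraph n P' →
      P ⊆ P' := by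
    intro P hP P' hP' h l hl
    obtain ⟨u, v, w, hw, rfl⟩ := exists_componentPath hP hl
    obtain ⟨l', hl', hx⟩ := (hP'.2.1 (toInt u)).2 ⟨by simp [toInt], by simp [toInt]⟩
    obtain ⟨u', v', w', hw', rfl⟩ := exists_componentPath hP' hl'
    have hu : u ∈ w'.support := by simpa [toInt_injective.eq_iff] using hx
    obtain ⟨w₁, hw₁, hs⟩ : ∃ w₁ : (toGraph n P').Walk u v,
        IsComponentPath w₁ ∧ w₁.support = w.support := by
      clear hw' hx hu
      revert w
      rw [h]
      exact fun w hw hl => ⟨w, hw, rfl⟩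
    have := hw'.support_eq hw₁ hu w₁.start_mem_support
    rw [hs] at this
    have e : w.support.map toInt = w'.support.map toInt :=
      eq_of_good_of_eq_reverse (hP'.1.nodup _ hl') (hP'.2.2 _ hl') (hP.2.2 _ hl)
        (this.imp (fun h => by rw [h]) fun h => by rw [h, List.map_reverse])
    rwa [e]
  intro P hP P' hP' h
  exact (key P hP P' hP' h).antisymm (key P' hP' P hP h.symm)

theorem isSystem_ofGraph {G : SimpleGraph (Fin n)}
    (hG : ∀ a b c d : Fin n, a < b → b < c → c < d → G.Adj a c → G.Adj b d → False) :
    IsSystem (ofGraph G) := by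
  refine ⟨?_, ?_, ?_, ?_⟩
  · rintro _ ⟨u, v, w, hw, huv, rfl⟩
    simp
  · rintro _ ⟨u, v, w, hw, huv, rfl⟩
    exact hw.1.support_nodup.map toInt_injective
  · rintro _ ⟨u, v, w, hw, huv, rfl⟩ _ ⟨u', v', w', hw', huv', rfl⟩ x hx hx'
    obtain ⟨z, hz, rfl⟩ := List.mem_map.1 hx
    have hz' : z ∈ w'.support := by simpa [toInt_injective.eq_iff] using hx'
    rcases hw.support_eq hw' hz hz' with h | h
    · rw [h]
    · have h1 := congrArg List.head? h
      have h2 := congrArg List.getLast? h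
      rw [List.head?_reverse, getLast?_support, head?_support] at h1
      rw [List.getLast?_reverse, head?_support, getLast?_support] at h2
      have h1 := Option.some.inj h1
      have h2 := Option.some.inj h2
      have e : u = v := le_antisymm huv (by rw [← h1, ← h2]; exact huv')
      have := eq_singleton_of_head?_of_getLast? hw.1.support_nodup (x := u)
        (by rw [head?_support]; rfl) (by rw [getLast?_support, e]; rfl)
      rw [h, this]
      rfl
  · rintro _ ⟨u, v, w, hw, huv, rfl⟩ _ ⟨u', v', w', hw', huv', rfl⟩ x y x' y' h h' h1 h2 h3
    obtain ⟨a, c, rfl, rfl, hl⟩ := h.exists_of_map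
    obtain ⟨b, d, rfl, rfl, hl'⟩ := h'.exists_of_map
    rw [linked_support_iff] at hl hl'
    exact hG a b c d (toInt_lt.1 h1) (toInt_lt.1 h2) (toInt_lt.1 h3) (w.adj_of_mem_edges hl)
      (w'.adj_of_mem_edges hl')

theorem exists_mem_ofGraph {G : SimpleGraph (Fin n)} {u v : Fin n} {w : G.Walk u v}
    (hw : IsComponentPath w) : ∃ l ∈ ofGraph G, (l = w.support.map toInt ∨
      l = (w.support.map toInt).reverse) := by
  rcases le_total u v with h | h
  · exact ⟨_, ⟨u, v, w, hw, h, rfl⟩, Or.inl rfl⟩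
  · exact ⟨_, ⟨v, u, w.reverse, isComponentPath_reverse hw, h, rfl⟩, Or.inr (by simp)⟩

/-- For goodness, suppose that a point `i` between the ends `u < v` of a path lies on another path.
An end `u'` of that path is not between `u` and `v`, by the order condition; then `i` and `u'`
alternate with `u` and `v`, which is impossible for disjoint uncrossed paths. -/
theorem ofGraph_mem_ordered {G : SimpleGraph (Fin n)} (hG : IsOrderedPartition G) :
    ofGraph G ∈ ordered 0 (n : ℤ) := by
  obtain ⟨hnc, hcov, hord⟩ := hG
  have hS := isSystem_ofGraph hnc
  refine ⟨hS, ?_, ?_⟩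
  · intro x
    rw [Set.mem_Ico]
    constructor
    · rintro ⟨_, ⟨u, v, w, hw, huv, rfl⟩, hx⟩
      obtain ⟨z, hz, rfl⟩ := List.mem_map.1 hx
      simp [toInt]
    · rintro ⟨h0, h1⟩
      obtain ⟨i, rfl⟩ := exists_toInt h0 h1
      obtain ⟨u, v, w, hw, hi⟩ := hcov i
      obtain ⟨l, hl, h⟩ := exists_mem_ofGraph hw
      refine ⟨l, hl, ?_⟩
      rcases h with rfl | rfl
      · exact List.mem_map_of_mem hi
      · rw [List.mem_reverse]
        exact List.mem_map_of_mem hi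
  · intro l hl h hh t ht
    have hl₀ := hl
    obtain ⟨u, v, w, hw, huv, rfl⟩ := hl
    have eh : toInt u = h := by simpa [head?_support] using hh
    have et : toInt v = t := by simpa [getLast?_support] using ht
    subst eh; subst et
    refine ⟨toInt_le.2 huv, fun x hx1 hx2 => ?_⟩
    have hu : toInt u ∈ w.support.map toInt := List.mem_map_of_mem w.start_mem_support
    have hv : toInt v ∈ w.support.map toInt := List.mem_map_of_mem w.end_mem_support
    obtain ⟨i, rfl⟩ := exists_toInt (n := n) (x := x) (le_trans (by simp [toInt]) hx1)
      (lt_of_le_of_lt hx2 (by simp [toInt]))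
    by_contra hi
    have hui : u < i := lt_of_le_of_ne (toInt_le.1 hx1) fun e => hi (e ▸ hu)
    have hiv : i < v := lt_of_le_of_ne (toInt_le.1 hx2) fun e => hi (e ▸ hv)
    obtain ⟨u', v', w', hw', hi'⟩ := hcov i
    obtain ⟨l', hl', he⟩ := exists_mem_ofGraph hw'
    have hmem : ∀ z, z ∈ w'.support → toInt z ∈ l' := by
      intro z hz
      rcases he with rfl | rfl
      · exact List.mem_map_of_mem hz
      · rw [List.mem_reverse]
        exact List.mem_map_of_mem hz
    have hne : w.support.map toInt ≠ l' := fun e => hi (e ▸ hmem i hi')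
    have hk := hmem u' w'.start_mem_support
    have hku : u' ≠ u := by
      rintro rfl
      exact hne (hS.eq_of_mem _ hl₀ _ hl' _ hu hk)
    have hkv : u' ≠ v := by
      rintro rfl
      exact hne (hS.eq_of_mem _ hl₀ _ hl' _ hv hk)
    have := hord u v (hui.trans hiv) ⟨w, hw⟩ u'
    by_cases h1 : u < u'
    · by_cases h2 : u' < v
      · exact this h1 h2 ⟨v', w', hw'⟩
      · have h2 : v < u' := lt_of_le_of_ne (not_lt.1 h2) hkv.symm
        exact hS.no_alternation hl₀ hl' hne hu (hmem i hi') hv hk (toInt_lt.2 hui)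
          (toInt_lt.2 hiv) (toInt_lt.2 h2)
    · have h1 : u' < u := lt_of_le_of_ne (not_lt.1 h1) hku
      exact hS.no_alternation hl' hl₀ hne.symm hk hu (hmem i hi') hv (toInt_lt.2 h1)
        (toInt_lt.2 hui) (toInt_lt.2 hiv)

theorem toGraph_ofGraph {G : SimpleGraph (Fin n)} (hG : IsOrderedPartition G) :
    toGraph n (ofGraph G) = G := by
  ext x y
  rw [toGraph_adj (isSystem_ofGraph hG.1)]
  constructor
  · rintro ⟨_, ⟨u, v, w, hw, huv, rfl⟩, h⟩
    rw [linked_map toInt_injective, linked_support_iff] at h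
    exact w.adj_of_mem_edges h
  · intro h
    obtain ⟨u, v, w, hw, hx⟩ := hG.2.1 x
    obtain ⟨l, hl, he⟩ := exists_mem_ofGraph hw
    refine ⟨l, hl, ?_⟩
    have h1 := hw.2.2 x y hx h
    rw [← linked_support_iff, ← linked_map toInt_injective] at h1
    rcases he with rfl | rfl
    · exact h1
    · rwa [linked_reverse]

/-- There are as many ordered non-crossing path partitions of `n` points as ordered systems on
an interval of length `n`. -/
theorem ncard_isOrderedPartition (n : ℕ) :
    {G : SimpleGraph (Fin n) | IsOrderedPartition G}.ncard = orderedCount n := by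
  rw [orderedCount, ← toGraph_injOn.ncard_image]
  congr 1
  ext G
  constructor
  · exact fun hG => ⟨ofGraph G, ofGraph_mem_ordered hG, toGraph_ofGraph hG⟩
  · rintro ⟨P, hP, rfl⟩
    exact isOrderedPartition_toGraph hP

end PathSystem

/-! ### Geometry: crossing segments in convex position -/

namespace PathSystem

variable {n : ℕ} {p : Fin n → Plane}

/-- Twice the signed area of the triangle `x y z`. -/
def area (x y z : Plane) : ℝ := (y 0 - x 0) * (z 1 - x 1) - (y 1 - x 1) * (z 0 - x 0)

theorem area_neg (hp : IsClockwiseConvex p) {i j k : Fin n} (hij : i < j) (hjk : j < k) :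
    area (p i) (p j) (p k) < 0 := hp.2 i j k hij hjk

theorem area_rotate (x y z : Plane) : area y z x = area x y z := by
  simp only [area]; ring

theorem area_swap (x y z : Plane) : area x z y = -area x y z := by
  simp only [area]; ring

theorem area_combination {s t : ℝ} (h : s + t = 1) (x y u v : Plane) :
    area x y (s • u + t • v) = s * area x y u + t * area x y v := by
  obtain rfl : s = 1 - t := by linarith
  simp only [area, PiLp.add_apply, PiLp.smul_apply, smul_eq_mul]
  ring

theorem area_eq_zero_of_mem_segment {x y z : Plane} (h : z ∈ segment ℝ x y) : area x y z = 0 := by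
  obtain ⟨s, t, -, -, hst, rfl⟩ := h
  rw [area_combination hst]
  simp only [area]
  ring

/-- The four triangle areas are the coefficients of the affine dependence
$s_4p_a+s_2p_c=s_3p_b+s_1p_d$. They all have the same sign, so after normalisation both sides are
convex combinations describing one point. -/
theorem exists_mem_segment_inter (hp : IsClockwiseConvex p) {a b c d : Fin n} (hab : a < b)
    (hbc : b < c) (hcd : c < d) :
    (segment ℝ (p a) (p c) ∩ segment ℝ (p b) (p d)).Nonempty := by
  have h1 := area_neg hp hab hbc
  have h2 := area_neg hp hab (hbc.trans hcd)
  have h3 := area_neg hp (hab.trans hbc) hcd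
  have h4 := area_neg hp hbc hcd
  set s₁ := area (p a) (p b) (p c)
  set s₂ := area (p a) (p b) (p d)
  set s₃ := area (p a) (p c) (p d)
  set s₄ := area (p b) (p c) (p d)
  have hs : s₄ + s₂ = s₃ + s₁ := by
    simp only [s₁, s₂, s₃, s₄, area]; ring
  have hneg : s₄ + s₂ < 0 := by linarith
  have hne := hneg.ne
  refine ⟨(s₄ / (s₄ + s₂)) • p a + (s₂ / (s₄ + s₂)) • p c, ⟨_, _,
    (div_pos_of_neg_of_neg h4 hneg).le, (div_pos_of_neg_of_neg h2 hneg).le, by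
      rw [← add_div, div_self hne], rfl⟩, ⟨s₃ / (s₄ + s₂), s₁ / (s₄ + s₂),
    (div_pos_of_neg_of_neg h3 hneg).le, (div_pos_of_neg_of_neg h1 hneg).le, by
      rw [← add_div, ← hs, div_self hne], ?_⟩⟩
  have key : ∀ i, s₃ * p b i + s₁ * p d i = s₄ * p a i + s₂ * p c i := by
    intro i
    fin_cases i <;> simp only [s₁, s₂, s₃, s₄, area, Fin.zero_eta, Fin.mk_one] <;> ring
  ext i
  have := key i
  simp only [PiLp.add_apply, PiLp.smul_apply, smul_eq_mul]
  rw [div_mul_eq_mul_div, div_mul_eq_mul_div, div_mul_eq_mul_div, div_mul_eq_mul_div, ← add_div,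
    ← add_div, this]

theorem area_pos_of_between (hp : IsClockwiseConvex p) {a b k : Fin n} (hak : a < k) (hkb : k < b) :
    0 < area (p a) (p b) (p k) := by
  rw [area_swap]
  linarith [area_neg hp hak hkb]

theorem area_neg_of_outside (hp : IsClockwiseConvex p) {a b k : Fin n} (hab : a < b)
    (hk : k < a ∨ b < k) : area (p a) (p b) (p k) < 0 := by
  rcases hk with hk | hk
  · rw [area_rotate]
    exact area_neg hp hk hab
  · exact area_neg hp hab hk

/-- The line through `p a` and `p b` separates the points numbered strictly between from the others.
Without alternation `p c` and `p d` lie weakly on one side, so their segment meets the line only in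
an endpoint, which is `p a` or `p b`. -/
theorem segment_inter_subset (hp : IsClockwiseConvex p) {a b c d : Fin n} (hab : a < b)
    (hcd : c < d) (hne : ¬ (a = c ∧ b = d)) (h1 : ¬ (a < c ∧ c < b ∧ b < d))
    (h2 : ¬ (c < a ∧ a < d ∧ d < b)) :
    segment ℝ (p a) (p b) ∩ segment ℝ (p c) (p d) ⊆ {p a, p b} ∩ {p c, p d} := by
  rintro z ⟨hz, s, t, hs, ht, hst, rfl⟩
  have h0 := area_eq_zero_of_mem_segment hz
  rw [area_combination hst] at h0
  have hsign : ∀ k, k ≠ a → k ≠ b → (a < k ∧ k < b ∧ 0 < area (p a) (p b) (p k)) ∨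
      ((k < a ∨ b < k) ∧ area (p a) (p b) (p k) < 0) := by
    intro k hka hkb
    rcases lt_or_gt_of_ne hka with h | h
    · exact Or.inr ⟨Or.inl h, area_neg_of_outside hp hab (Or.inl h)⟩
    · rcases lt_or_gt_of_ne hkb with h' | h'
      · exact Or.inl ⟨h, h', area_pos_of_between hp h h'⟩
      · exact Or.inr ⟨Or.inr h', area_neg_of_outside hp hab (Or.inr h')⟩
  have haa : area (p a) (p b) (p a) = 0 := by simp only [area]; ring
  have hbb : area (p a) (p b) (p b) = 0 := by simp only [area]; ring
  by_cases hc : c = a ∨ c = b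
  · by_cases hd : d = a ∨ d = b
    · exfalso
      rcases hc with rfl | rfl <;> rcases hd with rfl | rfl
      · exact lt_irrefl _ hcd
      · exact hne ⟨rfl, rfl⟩
      · exact lt_asymm hab hcd
      · exact lt_irrefl _ hcd
    · have hc0 : area (p a) (p b) (p c) = 0 := by
        rcases hc with rfl | rfl
        exacts [haa, hbb]
      have hd0 : area (p a) (p b) (p d) ≠ 0 := by
        rcases hsign d (fun e => hd (Or.inl e)) (fun e => hd (Or.inr e)) with h | h
        exacts [h.2.2.ne', h.2.ne]
      have ht0 : t = 0 := by
        rw [hc0, mul_zero, zero_add] at h0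
        exact (mul_eq_zero.1 h0).resolve_right hd0
      subst ht0
      have hs1 : s = 1 := by linarith
      subst hs1
      simp only [one_smul, zero_smul, add_zero]
      refine ⟨?_, by simp⟩
      rcases hc with rfl | rfl <;> simp
  · by_cases hd : d = a ∨ d = b
    · have hd0 : area (p a) (p b) (p d) = 0 := by
        rcases hd with rfl | rfl
        exacts [haa, hbb]
      have hc0 : area (p a) (p b) (p c) ≠ 0 := by
        rcases hsign c (fun e => hc (Or.inl e)) (fun e => hc (Or.inr e)) with h | h
        exacts [h.2.2.ne', h.2.ne]
      have hs0 : s = 0 := by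
        rw [hd0, mul_zero, add_zero] at h0
        exact (mul_eq_zero.1 h0).resolve_right hc0
      subst hs0
      have ht1 : t = 1 := by linarith
      subst ht1
      simp only [one_smul, zero_smul, zero_add]
      refine ⟨?_, by simp⟩
      rcases hd with rfl | rfl <;> simp
    · exfalso
      rw [not_or] at hc hd
      rcases hsign c hc.1 hc.2 with ⟨e1, e2, e3⟩ | ⟨e1, e2⟩ <;>
      rcases hsign d hd.1 hd.2 with ⟨f1, f2, f3⟩ | ⟨f1, f2⟩
      · rcases hs.eq_or_lt with rfl | hs
        · have : t = 1 := by linarith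
          subst this
          linarith
        · have := mul_pos hs e3
          have := mul_nonneg ht f3.le
          linarith
      · rcases f1 with f1 | f1
        · exact lt_asymm hcd (f1.trans e1)
        · exact h1 ⟨e1, e2, f1⟩
      · rcases e1 with e1 | e1
        · exact h2 ⟨e1, f1, f2⟩
        · exact lt_asymm hcd (f2.trans e1)
      · rcases hs.eq_or_lt with rfl | hs
        · have : t = 1 := by linarith
          subst this
          linarith
        · have := mul_neg_of_pos_of_neg hs e2
          have := mul_nonpos_of_nonneg_of_nonpos ht f2.le
          linarith

/-- For points in convex position, numbered clockwise, two edges cross if and only if their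
endpoints alternate. -/
theorem nonCrossing_iff (hp : IsClockwiseConvex p) (G : SimpleGraph (Fin n)) :
    NonCrossing p G ↔
      ∀ a b c d : Fin n, a < b → b < c → c < d → G.Adj a c → G.Adj b d → False := by
  constructor
  · intro h a b c d hab hbc hcd hac hbd
    obtain ⟨z, hz⟩ := exists_mem_segment_inter hp hab hbc hcd
    have hne : s(a, c) ≠ s(b, d) := by
      rw [Ne, Sym2.eq_iff]
      rintro (⟨e, -⟩ | ⟨e, -⟩)
      · exact hab.ne e
      · exact (hab.trans (hbc.trans hcd)).ne e
    obtain ⟨h1, h2⟩ := h a c b d hac hbd hne hz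
    have hinj := hp.1.injective
    rcases h1 with h1 | h1 <;> rcases h2 with h2 | h2
    · exact hab.ne (hinj (h1.symm.trans h2))
    · exact (hab.trans (hbc.trans hcd)).ne (hinj (h1.symm.trans h2))
    · exact hbc.ne' (hinj (h1.symm.trans h2))
    · exact hcd.ne (hinj (h1.symm.trans h2))
  · intro h
    have key : ∀ a b c d : Fin n, a < b → c < d → G.Adj a b → G.Adj c d → s(a, b) ≠ s(c, d) →
        segment ℝ (p a) (p b) ∩ segment ℝ (p c) (p d) ⊆ {p a, p b} ∩ {p c, p d} := by
      intro a b c d hab hcd hab' hcd' hne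
      refine segment_inter_subset hp hab hcd ?_ ?_ ?_
      · rintro ⟨rfl, rfl⟩
        exact hne rfl
      · exact fun e => h a c b d e.1 e.2.1 e.2.2 hab' hcd'
      · exact fun e => h c a d b e.1 e.2.1 e.2.2 hcd' hab'
    intro a b c d hab hcd hne
    rcases lt_or_gt_of_ne hab.ne with h1 | h1 <;> rcases lt_or_gt_of_ne hcd.ne with h2 | h2
    · exact key a b c d h1 h2 hab hcd hne
    · have := key a b d c h1 h2 hab hcd.symm (by rwa [Sym2.eq_swap (a := d)])
      rwa [segment_symm ℝ (p d), Set.pair_comm (p d)] at this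
    · have := key b a c d h1 h2 hab.symm hcd (by rwa [Sym2.eq_swap (a := b)])
      rwa [segment_symm ℝ (p b), Set.pair_comm (p b)] at this
    · have := key b a d c h1 h2 hab.symm hcd.symm
        (by rwa [Sym2.eq_swap (a := b), Sym2.eq_swap (a := d)])
      rwa [segment_symm ℝ (p b), Set.pair_comm (p b), segment_symm ℝ (p d),
        Set.pair_comm (p d)] at this

theorem numOrderedNCP_eq (hp : IsClockwiseConvex p) : numOrderedNCP p = orderedCount n := by
  rw [numOrderedNCP, ← ncard_isOrderedPartition]
  congr 1
  ext G
  simp only [Set.mem_ofPred_eq, IsOrderedNCPPartition, IsNCPPartition, nonCrossing_iff hp,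
    IsOrderedPartition, and_assoc]

end PathSystem

/-! ### Lagrange inversion -/

open Polynomial in
/-- The coefficients of Lagrange inversion: the coefficient of `t ^ k` in `v ^ r`, where
`v = t * Ψ v`. -/
noncomputable def lagrangeCoeff {S : Type*} [CommRing S] [Algebra ℚ S] (Ψ : S[X]) (k r : ℕ) : S :=
  if k = 0 then (if r = 0 then 1 else 0)
  else if r ≤ k then algebraMap ℚ S (r / k) * (Ψ ^ k).coeff (k - r) else 0

section Lagrange

open Polynomial

theorem coeff_X_mul_derivative {S : Type*} [CommRing S] (p : S[X]) (n : ℕ) :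
    (X * derivative p).coeff n = n * p.coeff n := by
  cases n with
  | zero => simp
  | succ n =>
    rw [coeff_X_mul, coeff_derivative]
    push_cast
    ring

variable {S : Type*} [CommRing S] [Algebra ℚ S] (Ψ : S[X])

theorem lagrangeCoeff_of_lt {k r : ℕ} (h : k < r) : lagrangeCoeff Ψ k r = 0 := by
  rw [lagrangeCoeff]
  split_ifs <;> first | omega | rfl

theorem lagrangeCoeff_zero_right {k : ℕ} (h : k ≠ 0) : lagrangeCoeff Ψ k 0 = 0 := by
  simp [lagrangeCoeff, h]

/-- This is the comparison of coefficients of $t^{M+r}$ in $v^r=t^r\Psi(v)^r$. It reduces to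
$(M+r)(\Psi^r)'\Psi^M=r(\Psi^{M+r})'$, read off at degree $M$ after multiplication by $X$. -/
theorem sum_coeff_mul_lagrangeCoeff {r : ℕ} (hr : r ≠ 0) {M N : ℕ} (hN : M < N) :
    ∑ j ∈ Finset.range N, (Ψ ^ r).coeff j * lagrangeCoeff Ψ M j = lagrangeCoeff Ψ (M + r) r := by
  have hsub : ∑ j ∈ Finset.range N, (Ψ ^ r).coeff j * lagrangeCoeff Ψ M j =
      ∑ j ∈ Finset.range (M + 1), (Ψ ^ r).coeff j * lagrangeCoeff Ψ M j := by
    symm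
    refine Finset.sum_subset (Finset.range_mono hN) fun j _ hj => ?_
    rw [lagrangeCoeff_of_lt, mul_zero]
    simpa using hj
  rw [hsub]
  rcases eq_or_ne M 0 with rfl | hM
  · simp [lagrangeCoeff, hr]
  have hMr : ((M + r : ℕ) : ℚ) ≠ 0 := by positivity
  have hMQ : (M : ℚ) ≠ 0 := by positivity
  have hterm : ∀ j ∈ Finset.range (M + 1), (Ψ ^ r).coeff j * lagrangeCoeff Ψ M j =
      algebraMap ℚ S (1 / M) * ((X * derivative (Ψ ^ r)).coeff j * (Ψ ^ M).coeff (M - j)) := by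
    intro j hj
    have hj : j ≤ M := by simpa [Nat.lt_succ_iff] using hj
    rw [lagrangeCoeff, if_neg hM, if_pos hj, coeff_X_mul_derivative, div_eq_mul_one_div, map_mul,
      map_natCast]
    ring
  have hpoly : ((M + r : ℕ) : S[X]) * (X * derivative (Ψ ^ r) * Ψ ^ M) =
      (r : S[X]) * (X * derivative (Ψ ^ (M + r))) := by
    obtain ⟨r, rfl⟩ := Nat.exists_eq_succ_of_ne_zero hr
    rw [derivative_pow, derivative_pow, Nat.succ_eq_add_one, Nat.add_sub_cancel,
      ← add_assoc, Nat.add_sub_cancel, pow_add]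
    simp only [map_natCast]
    ring
  have hcoeff := congrArg (fun f => f.coeff M) hpoly
  simp only [coeff_natCast_mul, coeff_X_mul_derivative] at hcoeff
  have hconv : (X * derivative (Ψ ^ r) * Ψ ^ M).coeff M = ∑ j ∈ Finset.range (M + 1),
      (X * derivative (Ψ ^ r)).coeff j * (Ψ ^ M).coeff (M - j) := by
    rw [coeff_mul, Finset.Nat.sum_antidiagonal_eq_sum_range_succ_mk]
  rw [Finset.sum_congr rfl hterm, ← Finset.mul_sum,
    ← hconv, lagrangeCoeff, if_neg (by omega), if_pos (by omega), Nat.add_sub_cancel]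
  have e1 : algebraMap ℚ S (1 / M) * (X * derivative (Ψ ^ r) * Ψ ^ M).coeff M =
      algebraMap ℚ S (1 / (M * (M + r : ℕ))) *
        (((M + r : ℕ) : S) * (X * derivative (Ψ ^ r) * Ψ ^ M).coeff M) := by
    rw [← mul_assoc, ← map_natCast (algebraMap ℚ S), ← map_mul]
    congr 2
    field_simp
  rw [e1, hcoeff, ← mul_assoc, ← mul_assoc, ← map_natCast (algebraMap ℚ S),
    ← map_natCast (algebraMap ℚ S), ← map_mul, ← map_mul]
  congr 2
  field_simp

/-- Lagrange inversion, modulo powers of `t`. -/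
theorem pow_dvd_pow_sub_sum_lagrangeCoeff {t v : S} (hv : v = t * Ψ.eval v) (K r : ℕ) :
    t ^ K ∣ v ^ r - ∑ k ∈ Finset.range K, t ^ k * lagrangeCoeff Ψ k r := by
  induction K using Nat.strong_induction_on generalizing r with
  | _ K ih =>
    rcases eq_or_ne r 0 with rfl | hr
    · cases K with
      | zero => simp
      | succ K =>
        rw [Finset.sum_range_succ', Finset.sum_eq_zero fun k _ => by
          rw [lagrangeCoeff_zero_right Ψ (Nat.succ_ne_zero k), mul_zero]]
        simp [lagrangeCoeff]
    -- The factor `t ^ r` lowers the required precision from `K` to `K - r`, so the induction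
    -- hypothesis applies to each power of `v` in the expansion of `(Ψ ^ r).eval v`. The
    -- coefficients of `Ψ` may themselves depend on `t`; divisibility is insensitive to that.
    have hvr : v ^ r = t ^ r * (Ψ ^ r).eval v := by
      conv_lhs => rw [hv]
      rw [mul_pow, eval_pow]
    rcases le_or_gt K r with hKr | hKr
    · rw [Finset.sum_eq_zero fun k hk => by
        rw [lagrangeCoeff_of_lt Ψ (lt_of_lt_of_le (Finset.mem_range.1 hk) hKr), mul_zero],
        sub_zero, hvr]
      exact Dvd.dvd.mul_right (pow_dvd_pow t hKr) _
    · obtain ⟨L, rfl⟩ := Nat.exists_eq_add_of_lt hKr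
      have hL : r + L + 1 = r + (L + 1) := by ring
      rw [hL] at ih ⊢
      generalize L + 1 = L at *
      set N := (Ψ ^ r).natDegree + L + 1
      have hsum : ∑ k ∈ Finset.range (r + L), t ^ k * lagrangeCoeff Ψ k r =
          t ^ r * ∑ j ∈ Finset.range N, (Ψ ^ r).coeff j *
            ∑ k ∈ Finset.range L, t ^ k * lagrangeCoeff Ψ k j := by
        rw [Finset.sum_range_add, Finset.sum_eq_zero fun k hk => by
          rw [lagrangeCoeff_of_lt Ψ (Finset.mem_range.1 hk), mul_zero], zero_add]
        simp only [Finset.mul_sum]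
        rw [Finset.sum_comm]
        refine Finset.sum_congr rfl fun M hM => ?_
        have hM := Finset.mem_range.1 hM
        rw [add_comm r M, ← sum_coeff_mul_lagrangeCoeff Ψ hr (M := M) (N := N) (by omega),
          Finset.mul_sum]
        refine Finset.sum_congr rfl fun j _ => ?_
        ring
      rw [hsum, hvr, eval_eq_sum_range' (n := N) (by omega), ← mul_sub, ← Finset.sum_sub_distrib,
        pow_add]
      refine mul_dvd_mul_left _ (Finset.dvd_sum fun j _ => ?_)
      rw [← mul_sub]
      exact Dvd.dvd.mul_left (ih L (by omega) j) _

end Lagrange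

/-! ### Generating functions -/

namespace PathSystem

open PowerSeries

noncomputable def orderedSeries : ℚ⟦X⟧ := mk fun n => (orderedCount n : ℚ)

noncomputable def tippedSeries : ℚ⟦X⟧ := mk fun n => (tippedCount n : ℚ)

noncomputable def tippedRightSeries : ℚ⟦X⟧ := mk fun n => (tippedRightCount n : ℚ)

noncomputable def irreducibleSeries : ℚ⟦X⟧ := mk fun n => (irreducibleCount n : ℚ)

theorem coeff_mk_mul_mk (f g : ℕ → ℚ) (n : ℕ) :
    coeff n (mk f * mk g) = ∑ m ∈ Finset.range (n + 1), f m * g (n - m) := by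
  rw [coeff_mul, Finset.Nat.sum_antidiagonal_eq_sum_range_succ_mk]
  simp only [coeff_mk]

theorem tippedRightSeries_eq : tippedRightSeries = X * (tippedSeries * orderedSeries) := by
  ext n
  cases n with
  | zero => simp [tippedRightSeries, tippedRightCount_zero]
  | succ n =>
    rw [coeff_succ_X_mul, tippedSeries, orderedSeries, coeff_mk_mul_mk, tippedRightSeries, coeff_mk,
      tippedRightCount_succ]
    push_cast
    rfl

theorem tippedSeries_eq : tippedSeries = 1 + X * tippedSeries + tippedRightSeries := by
  ext n
  cases n with
  | zero => simp [tippedRightSeries, tippedSeries, tippedRightCount_zero, tippedCount_zero]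
  | succ n =>
    rw [map_add, map_add, coeff_succ_X_mul, tippedSeries, tippedRightSeries, coeff_mk, coeff_mk,
      coeff_mk, tippedCount_succ]
    simp [coeff_one]

theorem irreducibleSeries_eq :
    irreducibleSeries = 1 + X * tippedSeries + X * (tippedRightSeries * tippedSeries) := by
  ext n
  cases n with
  | zero => simp [irreducibleSeries, irreducibleCount_zero]
  | succ n =>
    rw [map_add, map_add, coeff_succ_X_mul, coeff_succ_X_mul, tippedSeries, tippedRightSeries,
      coeff_mk_mul_mk, irreducibleSeries, coeff_mk, coeff_mk, irreducibleCount_succ]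
    simp [coeff_one]

theorem orderedSeries_eq : orderedSeries = 1 + X * (irreducibleSeries * orderedSeries) := by
  ext n
  cases n with
  | zero => simp [orderedSeries, orderedCount_zero]
  | succ n =>
    rw [map_add, coeff_succ_X_mul, irreducibleSeries, orderedSeries, coeff_mk_mul_mk, coeff_mk,
      orderedCount_succ]
    simp [coeff_one]

/-- Eliminating the other three series leaves one equation for this one, in the shape $v=t\Psi(v)$
required for Lagrange inversion once divided by $(1-X)^2$. -/
theorem tippedRightSeries_algebraic : (1 - X) ^ 2 * tippedRightSeries =
    X * ((1 + tippedRightSeries) * (1 + X * (tippedRightSeries * (1 + tippedRightSeries)))) := by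
  have h1 := tippedRightSeries_eq
  have h2 := tippedSeries_eq
  have h3 := irreducibleSeries_eq
  have h4 := orderedSeries_eq
  set v := tippedRightSeries
  set τ := tippedSeries
  set F := orderedSeries
  set κ := irreducibleSeries
  have e1 : (1 - X) * τ = 1 + v := by linear_combination h2
  have e2 : (1 - X) * v = X * (1 + v) * F := by linear_combination (1 - X) * h1 + X * F * e1
  have e3 : (1 - X) * κ = (1 - X) + X * (1 + v) ^ 2 := by
    linear_combination (1 - X) * h3 + X * (1 + v) * e1
  linear_combination e2 + X * (1 + v) * h4 - X * κ * e2 + X * v * e3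

/-- Transfers lower bounds from the series accessible to Lagrange inversion to the ordered systems,
at the cost of an index shift. -/
theorem orderedCount_ge (n : ℕ) : tippedRightCount n ≤ orderedCount (n + 2) := by
  calc tippedRightCount n ≤ tippedCount n := by
        cases n with
        | zero => rw [tippedRightCount_zero]; exact Nat.zero_le _
        | succ n => rw [tippedCount_succ]; exact Nat.le_add_left _ _
    _ ≤ irreducibleCount (n + 1) := by
        rw [irreducibleCount_succ]; exact Nat.le_add_right _ _
    _ ≤ orderedCount (n + 2) := by
        rw [orderedCount_succ]
        calc irreducibleCount (n + 1) =
            irreducibleCount (n + 1) * orderedCount (n + 1 - (n + 1)) := by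
              rw [Nat.sub_self, orderedCount_zero, mul_one]
          _ ≤ _ := Finset.single_le_sum
            (f := fun m => irreducibleCount m * orderedCount (n + 1 - m))
            (fun _ _ => Nat.zero_le _) (by simp)

end PathSystem

/-! ### Lower bound by a product of binomial coefficients -/

namespace PathSystem

open PowerSeries

/-- The polynomial `(1 + Y) (1 + X Y (1 + Y))` in `Y` over the power series in `X`. -/
noncomputable def kernelPoly : Polynomial ℚ⟦X⟧ :=
  (1 + Polynomial.X) * (1 + Polynomial.C X * (Polynomial.X * (1 + Polynomial.X)))

/-- The index `c` counts the factors $1+XY(1+Y)$ that contribute $XY(1+Y)$; what remains is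
$X^cY^c(1+Y)^{k+c}$. The guard keeps the truncated subtraction honest. -/
theorem coeff_kernelPoly_pow (k : ℕ) : (kernelPoly ^ k).coeff (k - 1) =
    ∑ c ∈ Finset.range (k + 1), if c ≤ k - 1 then
      C ((k.choose c * (k + c).choose (k - 1 - c) : ℕ) : ℚ) * X ^ c else (0 : ℚ⟦X⟧) := by
  have h : kernelPoly ^ k = ∑ c ∈ Finset.range (k + 1),
      Polynomial.C (X ^ c * ((k.choose c : ℕ) : ℚ⟦X⟧)) *
        (Polynomial.X ^ c * (1 + Polynomial.X) ^ (k + c)) := by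
    rw [kernelPoly, mul_pow, add_comm (1 : Polynomial ℚ⟦X⟧) (Polynomial.C X * _),
      add_pow (Polynomial.C X * _) 1,
      Finset.mul_sum]
    refine Finset.sum_congr rfl fun c _ => ?_
    rw [one_pow, mul_pow, mul_pow, pow_add]
    simp only [Polynomial.C_mul, Polynomial.C_pow, map_natCast]
    ring
  rw [h, Polynomial.finsetSum_coeff]
  refine Finset.sum_congr rfl fun c _ => ?_
  rw [Polynomial.coeff_C_mul, Polynomial.coeff_X_pow_mul']
  split_ifs
  · rw [Polynomial.coeff_one_add_X_pow]
    push_cast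
    simp only [map_mul, map_natCast]
    ring
  · rw [mul_zero]

theorem invOneSubPow_two_pow (k : ℕ) :
    (invOneSubPow ℚ 2) ^ k = invOneSubPow ℚ (2 * k) := by
  simp only [invOneSubPow_eq_inv_one_sub_pow, pow_mul]

theorem coeff_invOneSubPow_nonneg (d n : ℕ) : 0 ≤ coeff n (invOneSubPow ℚ d).val := by
  cases d with
  | zero =>
    rw [invOneSubPow_zero, Units.val_one, coeff_one]
    split_ifs <;> norm_num
  | succ d =>
    rw [invOneSubPow_val_succ_eq_mk_add_choose, coeff_mk]
    positivity

theorem tippedRightSeries_fixedPoint : tippedRightSeries =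
    (X * (invOneSubPow ℚ 2).val) * kernelPoly.eval tippedRightSeries := by
  have h := tippedRightSeries_algebraic
  have h1 : (invOneSubPow ℚ 2).val * (1 - X) ^ 2 = 1 := by
    rw [← invOneSubPow_inv_eq_one_sub_pow]
    exact (invOneSubPow ℚ 2).val_inv
  simp only [kernelPoly, Polynomial.eval_mul, Polynomial.eval_add, Polynomial.eval_one,
    Polynomial.eval_X, Polynomial.eval_C]
  linear_combination (invOneSubPow ℚ 2).val * h - tippedRightSeries * h1

/-- The contribution of one summand of the coefficient of `Y ^ (k - 1)` in `kernelPoly ^ k`. -/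
noncomputable def lagrangeTerm (k c : ℕ) : ℚ⟦X⟧ :=
  (X * (invOneSubPow ℚ 2).val) ^ k * (C ((1 : ℚ) / k) *
    if c ≤ k - 1 then C ((k.choose c * (k + c).choose (k - 1 - c) : ℕ) : ℚ) * X ^ c else 0)

theorem lagrangeTerm_eq {k c : ℕ} (hc : c ≤ k - 1) : lagrangeTerm k c =
    X ^ (k + c) * (C ((1 : ℚ) / k * (k.choose c * (k + c).choose (k - 1 - c) : ℕ)) *
      (invOneSubPow ℚ (2 * k)).val) := by
  rw [lagrangeTerm, if_pos hc, mul_pow, ← Units.val_pow_eq_pow_val, invOneSubPow_two_pow, map_mul,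
    pow_add]
  ring

theorem coeff_lagrangeTerm_nonneg (k c n : ℕ) : 0 ≤ coeff n (lagrangeTerm k c) := by
  by_cases hc : c ≤ k - 1
  · rw [lagrangeTerm_eq hc, coeff_X_pow_mul']
    split_ifs
    · rw [coeff_C_mul]
      exact mul_nonneg (by positivity) (coeff_invOneSubPow_nonneg _ _)
    · exact le_rfl
  · rw [lagrangeTerm, if_neg hc]
    simp

theorem lagrangeCoeff_kernelPoly {k : ℕ} (hk : k ≠ 0) :
    (X * (invOneSubPow ℚ 2).val) ^ k * lagrangeCoeff kernelPoly k 1 =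
      ∑ c ∈ Finset.range (k + 1), lagrangeTerm k c := by
  rw [lagrangeCoeff, if_neg hk, if_pos (by omega), coeff_kernelPoly_pow, Finset.mul_sum,
    Finset.mul_sum]
  refine Finset.sum_congr rfl fun c _ => ?_
  rw [lagrangeTerm, Nat.cast_one]
  rfl

theorem coeff_lagrangeTerm_le {n k c : ℕ} (hk : k ≠ 0) (hck : c < k) (hkn : k ≤ n) :
    coeff n (lagrangeTerm k c) ≤ tippedRightCount n := by
  have hdvd := pow_dvd_pow_sub_sum_lagrangeCoeff kernelPoly tippedRightSeries_fixedPoint (n + 1) 1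
  rw [pow_one] at hdvd
  -- Since `X` divides $t=X/(1-X)^2$, the expansion modulo $t^{n+1}$ determines the coefficient of
  -- $X^n$. It is a finite sum of nonnegative terms, each of which is thus a lower bound.
  have h0 := X_pow_dvd_iff.1 ((pow_dvd_pow_of_dvd (Dvd.intro _ rfl) (n + 1)).trans hdvd) n
    (Nat.lt_succ_self n)
  rw [map_sub, sub_eq_zero, map_sum, tippedRightSeries, coeff_mk] at h0
  rw [h0]
  have hnn : ∀ k ∈ Finset.range (n + 1),
      0 ≤ coeff n ((X * (invOneSubPow ℚ 2).val) ^ k * lagrangeCoeff kernelPoly k 1) := by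
    intro k _
    rcases eq_or_ne k 0 with rfl | hk
    · simp [lagrangeCoeff]
    · rw [lagrangeCoeff_kernelPoly hk, map_sum]
      exact Finset.sum_nonneg fun c _ => coeff_lagrangeTerm_nonneg k c n
  refine le_trans ?_ (Finset.single_le_sum hnn (Finset.mem_range.2 (Nat.lt_succ_of_le hkn)))
  rw [lagrangeCoeff_kernelPoly hk, map_sum]
  exact Finset.single_le_sum (f := fun c => coeff n (lagrangeTerm k c))
    (fun c _ => coeff_lagrangeTerm_nonneg k c n) (Finset.mem_range.2 (by omega))

/-- A lower bound for the number of ordered systems, from Lagrange inversion. -/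
theorem choose_mul_choose_mul_choose_le {n k c : ℕ} (hck : c < k) (hkn : k + c ≤ n) :
    k.choose c * (k + c).choose (2 * c + 1) * (n + k - c - 1).choose (2 * k - 1) ≤
      k * orderedCount (n + 2) := by
  have hk : k ≠ 0 := by omega
  have h := coeff_lagrangeTerm_le hk hck (show k ≤ n by omega)
  rw [lagrangeTerm_eq (by omega), coeff_X_pow_mul', if_pos hkn, coeff_C_mul,
    invOneSubPow_val_eq_mk_sub_one_add_choose_of_pos ℚ (2 * k) (by omega), coeff_mk] at h
  -- The complementary index $2c+1$ is used: in the estimate below it plays the role of the number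
  -- of successes.
  have e1 : (k + c).choose (k - 1 - c) = (k + c).choose (2 * c + 1) := by
    rw [← Nat.choose_symm (by omega)]
    congr 1
    omega
  have e2 : 2 * k - 1 + (n - (k + c)) = n + k - c - 1 := by omega
  rw [e1, e2] at h
  have hk' : (0 : ℚ) < k := by positivity
  have h2 : ((k.choose c * (k + c).choose (2 * c + 1) * (n + k - c - 1).choose (2 * k - 1) : ℕ) : ℚ)
      ≤ (k * tippedRightCount n : ℕ) := by
    have := mul_le_mul_of_nonneg_left h hk'.le
    refine le_of_eq_of_le ?_ (this.trans_eq ?_)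
    · push_cast
      field_simp
    · push_cast
      ring
  exact (Nat.cast_le.1 h2).trans (Nat.mul_le_mul_left k (orderedCount_ge n))

end PathSystem

/-! ### Upper bound from a fixed point -/

/-- The pairs with $i+j<N$ lie in the square $i,j<N$. -/
theorem sum_convolution_le {f g : ℕ → ℝ} (hf : ∀ n, 0 ≤ f n) (hg : ∀ n, 0 ≤ g n) (N : ℕ) :
    ∑ n ∈ Finset.range N, ∑ m ∈ Finset.range (n + 1), f m * g (n - m) ≤
      (∑ n ∈ Finset.range N, f n) * ∑ n ∈ Finset.range N, g n := by
  rw [Finset.sum_mul_sum, ← Finset.sum_product']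
  have h : ∀ n ∈ Finset.range N, ∑ m ∈ Finset.range (n + 1), f m * g (n - m) =
      ∑ ij ∈ Finset.HasAntidiagonal.antidiagonal n, f ij.1 * g ij.2 := fun n _ => by
    rw [Finset.Nat.sum_antidiagonal_eq_sum_range_succ_mk]
  rw [Finset.sum_congr rfl h, ← Finset.sum_biUnion]
  · refine Finset.sum_le_sum_of_subset_of_nonneg ?_ fun _ _ _ => mul_nonneg (hf _) (hg _)
    intro ij hij
    obtain ⟨n, hn, h⟩ := Finset.mem_biUnion.1 hij
    rw [Finset.HasAntidiagonal.mem_antidiagonal] at h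
    rw [Finset.mem_range] at hn
    rw [Finset.mem_product, Finset.mem_range, Finset.mem_range]
    omega
  · intro m _ n _ hmn
    rw [Function.onFun, Finset.disjoint_left]
    intro ij h1 h2
    rw [Finset.HasAntidiagonal.mem_antidiagonal] at h1 h2
    omega

namespace PathSystem

/-- A nonnegative fixed point of the system of equations for the generating functions bounds
their partial sums. -/
theorem sum_counts_le {z F τ q κ : ℝ} (hz : 0 ≤ z) (hF : 0 ≤ F) (hτ : 0 ≤ τ) (hq : 0 ≤ q)
    (hκ : 0 ≤ κ) (e₁ : q = z * (τ * F)) (e₂ : τ = 1 + z * τ + q)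
    (e₃ : κ = 1 + z * τ + z * (q * τ)) (e₄ : F = 1 + z * (κ * F)) (N : ℕ) :
    ∑ n ∈ Finset.range N, orderedCount n * z ^ n ≤ F ∧
    ∑ n ∈ Finset.range N, tippedCount n * z ^ n ≤ τ ∧
    ∑ n ∈ Finset.range N, tippedRightCount n * z ^ n ≤ q ∧
    ∑ n ∈ Finset.range N, irreducibleCount n * z ^ n ≤ κ := by
  -- Each equation bounds the first $N+1$ terms by products of sums of the first $N$ terms. In
  -- `tippedCount_succ` the right-tipped count has the same index as the left side, so `bq` serves
  -- there as well.
  induction N with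
  | zero => simpa using ⟨hF, hτ, hq, hκ⟩
  | succ N ih =>
    obtain ⟨iF, iτ, iq, iκ⟩ := ih
    have hnn : ∀ f : ℕ → ℕ, ∀ n, 0 ≤ (f n : ℝ) * z ^ n := fun f n => by positivity
    have conv : ∀ f g : ℕ → ℕ, ∀ a b : ℝ, 0 ≤ a →
        ∑ n ∈ Finset.range N, (f n : ℝ) * z ^ n ≤ a →
        ∑ n ∈ Finset.range N, (g n : ℝ) * z ^ n ≤ b →
        ∑ n ∈ Finset.range N, ((∑ m ∈ Finset.range (n + 1), f m * g (n - m) : ℕ) : ℝ) *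
          z ^ (n + 1) ≤ z * (a * b) := by
      intro f g a b ha hfa hgb
      have h1 : ∑ n ∈ Finset.range N, ((∑ m ∈ Finset.range (n + 1), f m * g (n - m) : ℕ) : ℝ) *
          z ^ (n + 1) = z * ∑ n ∈ Finset.range N, ∑ m ∈ Finset.range (n + 1),
            ((f m : ℝ) * z ^ m) * ((g (n - m) : ℝ) * z ^ (n - m)) := by
        rw [Finset.mul_sum]
        refine Finset.sum_congr rfl fun n _ => ?_
        push_cast
        rw [Finset.sum_mul, Finset.mul_sum]
        refine Finset.sum_congr rfl fun m hm => ?_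
        have hm : m ≤ n := by simpa [Nat.lt_succ_iff] using hm
        have : z ^ (n + 1) = z * (z ^ m * z ^ (n - m)) := by
          rw [← pow_add, Nat.add_sub_cancel' hm, pow_succ']
        rw [this]
        ring
      rw [h1]
      refine mul_le_mul_of_nonneg_left ((sum_convolution_le (hnn f) (hnn g) N).trans ?_) hz
      exact mul_le_mul hfa hgb (Finset.sum_nonneg fun n _ => hnn g n) ha
    have shift : ∑ n ∈ Finset.range N, (tippedCount n : ℝ) * z ^ (n + 1) ≤ z * τ := by
      have : ∑ n ∈ Finset.range N, (tippedCount n : ℝ) * z ^ (n + 1) =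
          z * ∑ n ∈ Finset.range N, (tippedCount n : ℝ) * z ^ n := by
        rw [Finset.mul_sum]
        exact Finset.sum_congr rfl fun n _ => by ring
      rw [this]
      exact mul_le_mul_of_nonneg_left iτ hz
    have bq := conv tippedCount orderedCount τ F hτ iτ iF
    have bκ := conv tippedRightCount tippedCount q τ hq iq iτ
    have bF := conv irreducibleCount orderedCount κ F hκ iκ iF
    simp only [← tippedRightCount_succ] at bq
    simp only [← orderedCount_succ] at bF
    refine ⟨?_, ?_, ?_, ?_⟩
    · rw [Finset.sum_range_succ', orderedCount_zero]
      norm_num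
      linarith
    · rw [Finset.sum_range_succ', tippedCount_zero]
      simp only [tippedCount_succ, Nat.cast_add, add_mul, Finset.sum_add_distrib]
      norm_num
      linarith
    · rw [Finset.sum_range_succ', tippedRightCount_zero]
      norm_num
      linarith
    · rw [Finset.sum_range_succ', irreducibleCount_zero]
      simp only [irreducibleCount_succ, Nat.cast_add, add_mul, Finset.sum_add_distrib]
      norm_num at bκ ⊢
      linarith

theorem orderedCount_mul_pow_le {z F τ q κ : ℝ} (hz : 0 ≤ z) (hF : 0 ≤ F) (hτ : 0 ≤ τ) (hq : 0 ≤ q)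
    (hκ : 0 ≤ κ) (e₁ : q = z * (τ * F)) (e₂ : τ = 1 + z * τ + q)
    (e₃ : κ = 1 + z * τ + z * (q * τ)) (e₄ : F = 1 + z * (κ * F)) (n : ℕ) :
    orderedCount n * z ^ n ≤ F :=
  (Finset.single_le_sum (f := fun n => (orderedCount n : ℝ) * z ^ n) (fun n _ => by positivity)
    (Finset.self_mem_range_succ n)).trans (sum_counts_le hz hF hτ hq hκ e₁ e₂ e₃ e₄ (n + 1)).1

end PathSystem

/-! ### Binomial probabilities near the mean -/

/-- The probability of `i` successes in `A` trials with success probability `x`. -/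
noncomputable def binomialTerm (A : ℕ) (x : ℝ) (i : ℕ) : ℝ :=
  A.choose i * x ^ i * (1 - x) ^ (A - i)

theorem binomialTerm_nonneg {x : ℝ} (h0 : 0 < x) (h1 : x < 1) (A i : ℕ) :
    0 ≤ binomialTerm A x i := by
  have : 0 < 1 - x := by linarith
  rw [binomialTerm]
  positivity

theorem binomialTerm_symm {A i : ℕ} (hi : i ≤ A) (x : ℝ) :
    binomialTerm A (1 - x) (A - i) = binomialTerm A x i := by
  rw [binomialTerm, binomialTerm, Nat.choose_symm hi, Nat.sub_sub_self hi]
  ring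

theorem sum_binomialTerm (A : ℕ) (x : ℝ) :
    ∑ i ∈ Finset.range (A + 1), binomialTerm A x i = 1 := by
  have := add_pow x (1 - x) A
  rw [add_sub_cancel, one_pow] at this
  rw [this]
  exact Finset.sum_congr rfl fun i _ => by rw [binomialTerm]; ring

theorem binomialTerm_succ {A i : ℕ} (hi : i < A) (x : ℝ) :
    binomialTerm A x (i + 1) * ((i + 1) * (1 - x)) = binomialTerm A x i * ((A - i) * x) := by
  have h := Nat.choose_succ_right_eq A i
  have h' : (A.choose (i + 1) : ℝ) * (i + 1) = A.choose i * (A - i) := by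
    have := congrArg (Nat.cast : ℕ → ℝ) h
    push_cast [hi.le] at this
    exact this
  obtain ⟨d, rfl⟩ := Nat.exists_eq_add_of_lt hi
  rw [binomialTerm, binomialTerm, show i + d + 1 - (i + 1) = d by omega,
    show i + d + 1 - i = d + 1 by omega]
  linear_combination x ^ (i + 1) * (1 - x) ^ (d + 1) * h'

/-- Binomial probabilities do not increase much to the right of an index that is not far below
the mean. -/
theorem binomialTerm_add_le {A B K : ℕ} {x M : ℝ} (h0 : 0 < x) (h1 : x < 1) (hM : 1 ≤ M)
    (hMA : A ≤ M * (1 - x)) (hB : A * x - K ≤ B) (j : ℕ) (hj : B + j ≤ A) :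
    binomialTerm A x (B + j) ≤ M ^ min j K * binomialTerm A x B := by
  have hx : 0 < 1 - x := by linarith
  induction j with
  | zero => simp
  | succ j ih =>
    have ih := ih (by omega)
    have hs := binomialTerm_succ (A := A) (i := B + j) (by omega) x
    have hnn := binomialTerm_nonneg h0 h1 A (B + j)
    have hpos : 0 < ((B + j : ℕ) + 1 : ℝ) * (1 - x) := by positivity
    have hBj : ((B + j : ℕ) : ℝ) = B + j := by push_cast; ring
    -- The ratio of consecutive terms is $(A-i)x/((i+1)(1-x))$. It is always at most $M$, and at
    -- most $1$ once $i\ge Ax$; for $i=B+j$ the latter holds from $j=K$ on.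
    rcases lt_or_ge j K with hjK | hjK
    · rw [min_eq_left (by omega)] at ih ⊢
      have h2 : binomialTerm A x (B + (j + 1)) ≤ M * binomialTerm A x (B + j) := by
        refine le_of_mul_le_mul_right ?_ hpos
        rw [← add_assoc, hs]
        have h3 : ((A : ℝ) - (B + j : ℕ)) * x ≤ M * (((B + j : ℕ) + 1 : ℝ) * (1 - x)) := by
          have a1 : (0 : ℝ) ≤ (B + j : ℕ) := by positivity
          have a2 : ((A : ℝ) - (B + j : ℕ)) * x ≤ A := by
            have : (A : ℝ) * x ≤ A * 1 := by
              exact mul_le_mul_of_nonneg_left h1.le (by positivity)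
            have := mul_nonneg a1 h0.le
            linarith
          have a3 : M * (1 - x) ≤ M * (((B + j : ℕ) + 1 : ℝ) * (1 - x)) := by
            refine mul_le_mul_of_nonneg_left ?_ (by linarith)
            have := mul_nonneg a1 hx.le
            linarith
          linarith
        have := mul_le_mul_of_nonneg_left h3 hnn
        linarith
      calc binomialTerm A x (B + (j + 1)) ≤ M * binomialTerm A x (B + j) := h2
        _ ≤ M * (M ^ j * binomialTerm A x B) := mul_le_mul_of_nonneg_left ih (by linarith)
        _ = M ^ (j + 1) * binomialTerm A x B := by ring
    · rw [min_eq_right (by omega)] at ih ⊢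
      refine le_trans ?_ ih
      refine le_of_mul_le_mul_right ?_ hpos
      rw [← add_assoc, hs]
      refine mul_le_mul_of_nonneg_left ?_ hnn
      have hjK' : (K : ℝ) ≤ j := by exact_mod_cast hjK
      rw [hBj]
      linarith

/-- A binomial probability at bounded distance from the mean is at least the inverse of a
polynomial. -/
theorem one_le_mul_binomialTerm {x : ℝ} (h0 : 0 < x) (h1 : x < 1) (K : ℕ) {A B : ℕ} (hBA : B ≤ A)
    (hB : |(B : ℝ) - A * x| ≤ K) :
    1 ≤ (1 / (x * (1 - x))) ^ K * (A + 1 : ℝ) ^ (K + 1) * binomialTerm A x B := by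
  have hx : 0 < 1 - x := by linarith
  have hxx : 0 < x * (1 - x) := by positivity
  -- One bound for the ratios in both directions. Every probability is then at most $M^K$ times the
  -- one at `B`, and the $A+1$ probabilities add up to $1$.
  set M : ℝ := (A + 1) / (x * (1 - x)) with hMdef
  have hMeq : M * (x * (1 - x)) = A + 1 := div_mul_cancel₀ _ hxx.ne'
  have hxx1 : x * (1 - x) ≤ 1 := by nlinarith
  have hM : 1 ≤ M := by
    rw [hMdef, le_div_iff₀ hxx]
    have : (0 : ℝ) ≤ A := by positivity
    linarith
  have hM0 : 0 ≤ M := by linarith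
  have hM1 : (A : ℝ) ≤ M * (1 - x) := by
    have : M * (x * (1 - x)) ≤ M * (1 - x) :=
      mul_le_mul_of_nonneg_left (by nlinarith) hM0
    linarith
  have hM2 : (A : ℝ) ≤ M * (1 - (1 - x)) := by
    have : M * (x * (1 - x)) ≤ M * (1 - (1 - x)) :=
      mul_le_mul_of_nonneg_left (by nlinarith) hM0
    linarith
  obtain ⟨hB1, hB2⟩ := abs_le.1 hB
  have hnn := binomialTerm_nonneg h0 h1 A B
  have hpow : ∀ j, M ^ min j K ≤ M ^ K := fun j => pow_le_pow_right₀ hM (min_le_right _ _)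
  have key : ∀ i ∈ Finset.range (A + 1), binomialTerm A x i ≤ M ^ K * binomialTerm A x B := by
    intro i hi
    have hi : i ≤ A := by simpa [Nat.lt_succ_iff] using hi
    rcases le_total B i with h | h
    · obtain ⟨j, rfl⟩ := Nat.exists_eq_add_of_le h
      exact (binomialTerm_add_le h0 h1 hM hM1 (by linarith) j hi).trans
        (mul_le_mul_of_nonneg_right (hpow j) hnn)
    · have e : A - i = (A - B) + (B - i) := by omega
      -- To the left of `B`, exchange successes and failures.
      have := binomialTerm_add_le (A := A) (B := A - B) (K := K) (x := 1 - x) (by linarith)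
        (by linarith) hM hM2 (by push_cast [hBA]; linarith) (B - i) (by omega)
      rw [← e, binomialTerm_symm hi, binomialTerm_symm hBA] at this
      exact this.trans (mul_le_mul_of_nonneg_right (hpow _) hnn)
  calc (1 : ℝ) = ∑ i ∈ Finset.range (A + 1), binomialTerm A x i := (sum_binomialTerm A x).symm
    _ ≤ ∑ i ∈ Finset.range (A + 1), M ^ K * binomialTerm A x B := Finset.sum_le_sum key
    _ = (1 / (x * (1 - x))) ^ K * (A + 1 : ℝ) ^ (K + 1) * binomialTerm A x B := by
      rw [Finset.sum_const, Finset.card_range, nsmul_eq_mul, hMdef, div_eq_mul_one_div, mul_pow]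
      push_cast
      ring

/-! ### Exponential growth rate -/

namespace PathSystem

theorem one_le_orderedCount (n : ℕ) : 1 ≤ orderedCount n := by
  induction n with
  | zero => rw [orderedCount_zero]
  | succ n ih =>
    rw [orderedCount_succ]
    refine ih.trans ?_
    have := Finset.single_le_sum (f := fun m => irreducibleCount m * orderedCount (n - m))
      (fun _ _ => Nat.zero_le _) (Finset.mem_range.2 n.succ_pos)
    simpa [irreducibleCount_zero] using this

/-- The weights of the three binomial coefficients in the lower bound for `orderedCount`
multiply to a power of `z` when the parameters are balanced. -/
theorem weights_eq {α β γ z : ℝ} (h₁ : (1 - α) * (1 - β) * γ ^ 2 = z)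
    (h₂ : α * β ^ 2 = (1 - α) * (1 - β) * z) (h₃ : 1 - γ = z) {k c N : ℕ} (hck : c < k)
    (hkN : k + c ≤ N) :
    (α ^ c * (1 - α) ^ (k - c)) * (β ^ (2 * c + 1) * (1 - β) ^ (k + c - (2 * c + 1))) *
      (γ ^ (2 * k - 1) * (1 - γ) ^ (N + k - c - 1 - (2 * k - 1))) * z =
    (1 - α) * β * γ * z ^ N := by
  obtain ⟨e, rfl⟩ := Nat.exists_eq_add_of_lt hck
  obtain ⟨f, rfl⟩ := Nat.exists_eq_add_of_le hkN
  rw [show c + e + 1 - c = e + 1 by omega, show c + e + 1 + c - (2 * c + 1) = e by omega,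
    show 2 * (c + e + 1) - 1 = 2 * c + 2 * e + 1 by omega,
    show c + e + 1 + c + f + (c + e + 1) - c - 1 - (2 * c + 2 * e + 1) = f by omega, h₃]
  -- The exponents grouped by `c`, `e` and `f` have bases $\alpha\beta^2\gamma^2$,
  -- $(1-\alpha)(1-\beta)\gamma^2$ and $1-\gamma$. These equal $z^2$, $z$ and $z$, so the weight
  -- depends on `k` and `c` only through $N=2c+e+1+f$.
  have h₄ : α * β ^ 2 * γ ^ 2 = z ^ 2 := by rw [h₂]; linear_combination z * h₁
  calc _ = (1 - α) * β * γ * (α * β ^ 2 * γ ^ 2) ^ c * ((1 - α) * (1 - β) * γ ^ 2) ^ e *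
        z ^ (f + 1) := by
        rw [mul_pow, mul_pow, mul_pow, mul_pow, ← pow_mul, ← pow_mul, ← pow_mul]
        ring
    _ = _ := by rw [h₄, h₁, ← pow_mul]; ring

/-- Near the balanced choice of `k` and `c` the lower bound for `orderedCount` is sharp up to
polynomial factors. -/
theorem one_le_mul_orderedCount_of_balanced {α β γ z : ℝ} (hα : 0 < α) (hα' : α < 1) (hβ : 0 < β)
    (hβ' : β < 1) (hγ : 0 < γ) (hγ' : γ < 1) (h₀ : 2 * α = β * (1 + α))
    (h₁ : (1 - α) * (1 - β) * γ ^ 2 = z)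
    (h₂ : α * β ^ 2 = (1 - α) * (1 - β) * z) (h₃ : 1 - γ = z) {N : ℕ} (hN : 2 / γ ≤ N) :
    1 ≤ (1 / (α * (1 - α))) ^ 1 * (1 / (β * (1 - β))) ^ 1 * (1 / (γ * (1 - γ))) ^ 4 *
      ((1 - α) * β * γ / z ^ 3) * (2 * ((N + 2 : ℕ) : ℝ)) ^ 10 *
      (orderedCount (N + 2) * z ^ (N + 2)) := by
  have hα1 : 0 < 1 - α := by linarith
  have hβ1 : 0 < 1 - β := by linarith
  have hγ1 : 0 < 1 - γ := by linarith
  have hz : 0 < z := by linarith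
  have hαγ : 0 < γ * (1 - α) := by positivity
  have hαγ' : γ * (1 - α) < 1 := mul_lt_one_of_nonneg_of_lt_one_left hγ.le hγ' (by linarith)
  -- The third binomial is centred if $2k\approx\gamma(N+k-c)$; with $c\approx\alpha k$ this means
  -- $k\approx\gamma N/D$.
  set D : ℝ := 2 - γ * (1 - α) with hD
  have hD0 : 0 < D := by linarith
  set k : ℕ := ⌊γ / D * N⌋₊ with hk
  set c : ℕ := ⌊α * k⌋₊ with hc
  have hk1 : (k : ℝ) ≤ γ / D * N := Nat.floor_le (by positivity)
  have hk2 : γ / D * N < k + 1 := Nat.lt_floor_add_one _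
  have hc1 : (c : ℝ) ≤ α * k := Nat.floor_le (by positivity)
  have hc2 : α * k < c + 1 := Nat.lt_floor_add_one _
  have hkD1 : k * D ≤ γ * N := by
    have := mul_le_mul_of_nonneg_right hk1 hD0.le
    rwa [mul_right_comm, div_mul_cancel₀ _ hD0.ne'] at this
  have hkD2 : γ * N < (k + 1) * D := by
    have := mul_lt_mul_of_pos_right hk2 hD0
    rwa [mul_right_comm, div_mul_cancel₀ _ hD0.ne'] at this
  -- As $D<2$, this makes `k` positive.
  have hNγ : 2 ≤ γ * N := by
    rw [div_le_iff₀ hγ] at hN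
    linarith
  have hkpos : 0 < (k : ℝ) := by
    by_contra hneg
    have : k * D ≤ 0 := mul_nonpos_of_nonpos_of_nonneg (not_lt.1 hneg) hD0.le
    linarith
  have hck : c < k := by
    have : (c : ℝ) < k := hc1.trans_lt (mul_lt_of_lt_one_left hkpos hα')
    exact_mod_cast this
  have hkN : k + c ≤ N := by
    have h4 : γ * (k + c) ≤ γ * N := by
      have e₁ : γ * (k + c) ≤ γ * (k + α * k) := by gcongr
      have e₂ : 0 ≤ (1 - γ) * k := by positivity
      rw [hD] at hkD1
      linarith
    have : (k : ℝ) + c ≤ N := le_of_mul_le_mul_left h4 hγ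
    exact_mod_cast this
  -- Rounding moves the three indices from their means by at most $1$, $1$ and $4$; `h₀` centres the
  -- second one. The resulting exponents $2+2+5$ and the factor `k` account for the power $10$.
  have b₁ := one_le_mul_binomialTerm hα hα' 1 (A := k) (B := c) hck.le (by
    rw [abs_le]
    constructor <;> push_cast <;> linarith)
  have b₂ := one_le_mul_binomialTerm hβ hβ' 1 (A := k + c) (B := 2 * c + 1) (by omega) (by
    have e₁ : β * (α * k - c) ≤ α * k - c := mul_le_of_le_one_left (by linarith) hβ'.le
    have e₂ : 0 ≤ β * (α * k - c) := mul_nonneg hβ.le (by linarith)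
    have e₃ : 2 * (α * k) = β * k + β * (α * k) := by linear_combination k * h₀
    rw [abs_le]
    constructor <;> push_cast <;> linarith)
  have b₃ := one_le_mul_binomialTerm hγ hγ' 4 (A := N + k - c - 1) (B := 2 * k - 1) (by omega) (by
    have e₁ : ((N + k - c - 1 : ℕ) : ℝ) = N + k - c - 1 := by
      rw [Nat.cast_sub (by omega), Nat.cast_sub (by omega)]
      push_cast
      ring
    have e₂ : ((2 * k - 1 : ℕ) : ℝ) = 2 * k - 1 := by
      rw [Nat.cast_sub (by omega)]
      push_cast
      ring
    have e₃ : γ * (α * k - c) ≤ α * k - c := mul_le_of_le_one_left (by linarith) hγ'.le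
    have e₄ : 0 ≤ γ * (α * k - c) := mul_nonneg hγ.le (by linarith)
    rw [hD] at hkD1 hkD2
    rw [e₁, e₂, abs_le]
    constructor <;> push_cast <;> linarith)
  have hw := weights_eq h₁ h₂ h₃ hck hkN
  have hch : ((k.choose c : ℝ) * (k + c).choose (2 * c + 1)) * (N + k - c - 1).choose (2 * k - 1) ≤
      k * orderedCount (N + 2) := by
    exact_mod_cast choose_mul_choose_mul_choose_le hck hkN
  set X : ℝ := 2 * ((N + 2 : ℕ) : ℝ) with hX
  have hkX : (k : ℝ) ≤ X := by
    have : (k : ℝ) ≤ N := by exact_mod_cast (by omega : k ≤ N)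
    rw [hX]
    push_cast
    linarith
  have hX0 : 0 ≤ X := by positivity
  have hX₁ : (k : ℝ) + 1 ≤ X := by
    rw [hX]
    exact_mod_cast (by omega : k + 1 ≤ 2 * (N + 2))
  have hX₂ : ((k + c : ℕ) : ℝ) + 1 ≤ X := by
    rw [hX]
    exact_mod_cast (by omega : k + c + 1 ≤ 2 * (N + 2))
  have hX₃ : ((N + k - c - 1 : ℕ) : ℝ) + 1 ≤ X := by
    rw [hX]
    exact_mod_cast (by omega : N + k - c - 1 + 1 ≤ 2 * (N + 2))
  have t₁ := binomialTerm_nonneg hα hα' k c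
  have t₂ := binomialTerm_nonneg hβ hβ' (k + c) (2 * c + 1)
  have t₃ := binomialTerm_nonneg hγ hγ' (N + k - c - 1) (2 * k - 1)
  set u := (1 / (α * (1 - α))) ^ 1 with hu
  set v := (1 / (β * (1 - β))) ^ 1 with hv
  set w := (1 / (γ * (1 - γ))) ^ 4 with hw'
  have hu0 : 0 ≤ u := by positivity
  have hv0 : 0 ≤ v := by positivity
  have hw0 : 0 ≤ w := by positivity
  have b₁' : 1 ≤ u * X ^ 2 * binomialTerm k α c := b₁.trans (by gcongr)
  have b₂' : 1 ≤ v * X ^ 2 * binomialTerm (k + c) β (2 * c + 1) := b₂.trans (by gcongr)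
  have b₃' : 1 ≤ w * X ^ 5 * binomialTerm (N + k - c - 1) γ (2 * k - 1) := b₃.trans (by gcongr)
  have hprod : binomialTerm k α c * binomialTerm (k + c) β (2 * c + 1) *
      binomialTerm (N + k - c - 1) γ (2 * k - 1) ≤
      X * orderedCount (N + 2) * ((1 - α) * β * γ / z ^ 3 * z ^ (N + 2)) := by
    have hW : (1 - α) * β * γ / z ^ 3 * z ^ (N + 2) =
        (α ^ c * (1 - α) ^ (k - c)) * (β ^ (2 * c + 1) * (1 - β) ^ (k + c - (2 * c + 1))) *
          (γ ^ (2 * k - 1) * (1 - γ) ^ (N + k - c - 1 - (2 * k - 1))) := by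
      refine mul_right_cancel₀ hz.ne' ?_
      rw [hw, div_mul_eq_mul_div, div_mul_eq_mul_div, div_eq_iff (by positivity)]
      ring
    rw [hW]
    calc _ = ((k.choose c : ℝ) * (k + c).choose (2 * c + 1)) *
          (N + k - c - 1).choose (2 * k - 1) * ((α ^ c * (1 - α) ^ (k - c)) *
          (β ^ (2 * c + 1) * (1 - β) ^ (k + c - (2 * c + 1))) *
          (γ ^ (2 * k - 1) * (1 - γ) ^ (N + k - c - 1 - (2 * k - 1)))) := by
          rw [binomialTerm, binomialTerm, binomialTerm]
          ring
      _ ≤ _ := by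
          refine mul_le_mul_of_nonneg_right (hch.trans ?_) (by positivity)
          gcongr
  calc (1 : ℝ) = 1 * 1 * 1 := by norm_num
    _ ≤ (u * X ^ 2 * binomialTerm k α c) * (v * X ^ 2 * binomialTerm (k + c) β (2 * c + 1)) *
        (w * X ^ 5 * binomialTerm (N + k - c - 1) γ (2 * k - 1)) := by gcongr
    _ = u * v * w * X ^ 9 * (binomialTerm k α c * binomialTerm (k + c) β (2 * c + 1) *
        binomialTerm (N + k - c - 1) γ (2 * k - 1)) := by ring
    _ ≤ u * v * w * X ^ 9 *
        (X * orderedCount (N + 2) * ((1 - α) * β * γ / z ^ 3 * z ^ (N + 2))) := by gcongr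
    _ = _ := by ring

/-- The second summand of the constant takes care of the finitely many small `n`, as $z<1$. -/
theorem exists_one_le_mul_orderedCount {α β γ z : ℝ} (hα : 0 < α) (hα' : α < 1) (hβ : 0 < β)
    (hβ' : β < 1) (hγ : 0 < γ) (hγ' : γ < 1) (h₀ : 2 * α = β * (1 + α))
    (h₁ : (1 - α) * (1 - β) * γ ^ 2 = z)
    (h₂ : α * β ^ 2 = (1 - α) * (1 - β) * z) (h₃ : 1 - γ = z) :
    ∃ C : ℝ, 0 < C ∧ ∀ n : ℕ, 1 ≤ n → 1 ≤ C * (n : ℝ) ^ 10 * (orderedCount n * z ^ n) := by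
  have hα1 : 0 < 1 - α := by linarith
  have hβ1 : 0 < 1 - β := by linarith
  have hγ1 : 0 < 1 - γ := by linarith
  have hz : 0 < z := by linarith
  set R : ℝ := (1 / (α * (1 - α))) ^ 1 * (1 / (β * (1 - β))) ^ 1 * (1 / (γ * (1 - γ))) ^ 4 *
    ((1 - α) * β * γ / z ^ 3) with hR
  have hR0 : 0 < R := by positivity
  set n₀ : ℕ := ⌈2 / γ⌉₊ + 2 with hn₀
  refine ⟨R * 2 ^ 10 + (z⁻¹) ^ n₀, by positivity, fun n hn => ?_⟩
  have hF : (1 : ℝ) ≤ orderedCount n := by exact_mod_cast one_le_orderedCount n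
  rcases le_or_gt n₀ n with h | h
  · obtain ⟨N, rfl⟩ : ∃ N, n = N + 2 := ⟨n - 2, by omega⟩
    have := one_le_mul_orderedCount_of_balanced hα hα' hβ hβ' hγ hγ' h₀ h₁ h₂ h₃ (N := N)
      (Nat.ceil_le.1 (by omega))
    have hle : R * 2 ^ 10 ≤ R * 2 ^ 10 + (z⁻¹) ^ n₀ := le_add_of_nonneg_right (by positivity)
    rw [← hR, mul_pow, ← mul_assoc R] at this
    refine this.trans ?_
    gcongr
  · have hn1 : (1 : ℝ) ≤ (n : ℝ) ^ 10 := one_le_pow₀ (by exact_mod_cast hn)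
    have hz1 : 1 ≤ (z⁻¹) ^ n₀ * z ^ n := by
      calc (1 : ℝ) = (z⁻¹) ^ n * z ^ n := by rw [← mul_pow, inv_mul_cancel₀ hz.ne', one_pow]
        _ ≤ _ := by
          gcongr
          exact (one_le_inv₀ hz).2 (by linarith)
    calc (1 : ℝ) ≤ (z⁻¹) ^ n₀ * z ^ n := hz1
      _ = (z⁻¹) ^ n₀ * 1 * (1 * z ^ n) := by ring
      _ ≤ _ := by
        gcongr
        have : 0 ≤ R * 2 ^ 10 := by positivity
        linarith

/-- The growth rate of the number of ordered partitions, in terms of a root of the equation that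
singles out the dominant singularity. -/
theorem exists_growth_bounds {s z : ℝ} (h0 : 0 < s) (h1 : s < 1)
    (hs : 3 * s ^ 6 + 2 * s ^ 5 + s ^ 4 + 2 * s ^ 3 + s ^ 2 = 1)
    (hz : z = 2 * s ^ 3 / (1 + s ^ 2 + 2 * s ^ 3)) :
    ∃ C : ℝ, 0 < C ∧ ∀ n : ℕ, 1 ≤ n →
      orderedCount n * z ^ n ≤ C ∧ 1 ≤ C * (n : ℝ) ^ 10 * (orderedCount n * z ^ n) := by
  have hs2 : s ^ 2 < 1 := by nlinarith
  have hs2' : 0 < 1 - s ^ 2 := by linarith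
  have hz0 : 0 < z := by rw [hz]; positivity
  -- With $s=z\tau$ the equations give $F=q/s$ and $s/z=1+s+q$; the value of $q$ is the one at the
  -- singular point, and the last equation becomes `hs`.
  have upper := orderedCount_mul_pow_le (z := z) (F := (1 - s ^ 2) / (2 * s ^ 3)) (τ := s / z)
    (q := (1 - s ^ 2) / (2 * s ^ 2)) (κ := (1 + s) ^ 2 / (2 * s)) hz0.le (by positivity)
    (by positivity) (by positivity) (by positivity)
    (by field_simp) (by rw [hz]; field_simp; ring) (by field_simp; ring)
    (by rw [hz]; field_simp; linear_combination -hs)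
  -- Relative weights at the singular point: $\alpha=zq(1+q)/(1+zq(1+q))$, $\beta=1/(1+q)$ and
  -- $\gamma=1-z$. The relation $2\alpha=\beta(1+\alpha)$ is the criticality condition
  -- $q\Psi'(q)=\Psi(q)$.
  obtain ⟨C, hC, lower⟩ := exists_one_le_mul_orderedCount (α := s ^ 2)
    (β := 2 * s ^ 2 / (1 + s ^ 2)) (γ := (1 + s ^ 2) / (1 + s ^ 2 + 2 * s ^ 3)) (z := z)
    (by positivity) hs2 (by positivity)
    (by rw [div_lt_one (by positivity)]; linarith) (by positivity)
    (by rw [div_lt_one (by positivity)]; linarith [pow_pos h0 3])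
    (by field_simp)
    (by rw [hz]; field_simp; linear_combination -hs)
    (by rw [hz]; field_simp; linear_combination hs)
    (by rw [hz]; field_simp; ring)
  refine ⟨C + (1 - s ^ 2) / (2 * s ^ 3), by positivity, fun n hn => ⟨?_, ?_⟩⟩
  · exact (upper n).trans (le_add_of_nonneg_left hC.le)
  · refine (lower n hn).trans ?_
    gcongr
    exact le_add_of_nonneg_right (by positivity)

/-- The intermediate value theorem locates the root in an interval of length $2\cdot10^{-12}$, short
enough to bound the numerator and denominator of $\rho-1$ separately. -/
theorem exists_root : ∃ s : ℝ, 0 < s ∧ s < 1 ∧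
    3 * s ^ 6 + 2 * s ^ 5 + s ^ 4 + 2 * s ^ 3 + s ^ 2 = 1 ∧
    4.6421263038 < 1 + (1 + s ^ 2) / (2 * s ^ 3) ∧
    1 + (1 + s ^ 2) / (2 * s ^ 3) < 4.6421263039 := by
  let f : ℝ → ℝ := fun s => 3 * s ^ 6 + 2 * s ^ 5 + s ^ 4 + 2 * s ^ 3 + s ^ 2
  have hf : ContinuousOn f (Set.Icc 0.565925767968 0.565925767970) := by fun_prop
  obtain ⟨s, ⟨hs₁, hs₂⟩, hs⟩ := intermediate_value_Icc (by norm_num) hf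
    (show (1 : ℝ) ∈ _ by constructor <;> norm_num [f])
  have h0 : 0 < s := by linarith
  refine ⟨s, h0, by linarith, hs, ?_, ?_⟩
  · have h2 : (0.565925767968 : ℝ) ^ 2 ≤ s ^ 2 := by gcongr
    have h3 : s ^ 3 ≤ (0.565925767970 : ℝ) ^ 3 := by gcongr
    have : (3.6421263038 : ℝ) < (1 + s ^ 2) / (2 * s ^ 3) := by
      rw [lt_div_iff₀ (by positivity)]
      norm_num at h2 h3 ⊢
      linarith
    linarith
  · have h2 : s ^ 2 ≤ (0.565925767970 : ℝ) ^ 2 := by gcongr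
    have h3 : (0.565925767968 : ℝ) ^ 3 ≤ s ^ 3 := by gcongr
    have : (1 + s ^ 2) / (2 * s ^ 3) < (3.6421263039 : ℝ) := by
      rw [div_lt_iff₀ (by positivity)]
      norm_num at h2 h3 ⊢
      linarith
    linarith

end PathSystem

theorem theorem4 :
    (∃ (C : ℝ) (d : ℕ), ∀ (n : ℕ) (p : Fin n → Plane), 1 ≤ n → IsClockwiseConvex p →
      (numOrderedNCP p : ℝ) ≤ C * (n : ℝ) ^ d * (4.642126305 : ℝ) ^ n) ∧
    ∃ ρ : ℝ, 4.6421263038 < ρ ∧ ρ < 4.6421263039 ∧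
      ∃ (C : ℝ) (d : ℕ), 0 < C ∧
        ∀ (n : ℕ) (p : Fin n → Plane), 1 ≤ n → IsClockwiseConvex p →
          ρ ^ n / (C * (n : ℝ) ^ d) ≤ (numOrderedNCP p : ℝ) ∧
          (numOrderedNCP p : ℝ) ≤ C * (n : ℝ) ^ d * ρ ^ n := by
  obtain ⟨s, h0, h1, hs, hlo, hhi⟩ := PathSystem.exists_root
  set ρ : ℝ := 1 + (1 + s ^ 2) / (2 * s ^ 3) with hρ
  obtain ⟨C, hC, h⟩ := PathSystem.exists_growth_bounds (z := ρ⁻¹) h0 h1 hs (by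
    rw [hρ]
    field_simp
    ring)
  have hρ0 : 0 < ρ := by linarith
  have upper : ∀ (n : ℕ) (p : Fin n → Plane), 1 ≤ n → IsClockwiseConvex p →
      (numOrderedNCP p : ℝ) ≤ C * (n : ℝ) ^ 10 * ρ ^ n := by
    intro n p hn hp
    rw [PathSystem.numOrderedNCP_eq hp]
    have hle := (h n hn).1
    rw [inv_pow, ← div_eq_mul_inv, div_le_iff₀ (by positivity)] at hle
    have hn1 : (1 : ℝ) ≤ (n : ℝ) ^ 10 := one_le_pow₀ (by exact_mod_cast hn)
    refine hle.trans ?_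
    gcongr
    exact le_mul_of_one_le_right hC.le hn1
  refine ⟨⟨C, 10, fun n p hn hp => (upper n p hn hp).trans ?_⟩, ρ, hlo, hhi, C, 10, hC,
    fun n p hn hp => ⟨?_, upper n p hn hp⟩⟩
  · gcongr
    linarith
  · have hn0 : (0 : ℝ) < n := by exact_mod_cast hn
    have hge := (h n hn).2
    rw [PathSystem.numOrderedNCP_eq hp, div_le_iff₀ (by positivity)]
    rw [inv_pow, ← mul_assoc, ← div_eq_mul_inv, one_le_div (by positivity)] at hge
    linarith
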